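/- Let $k$ be a field, $G$ a group with unit $\epsilon$, and $\Phi\colon G\times G\times G\to k^*$ a normalized 3-cocycle, i.e. $\Phi(e,f,g)\Phi(e,fg,h)\Phi(f,g,h)=\Phi(ef,g,h)\Phi(e,f,gh)$ and $\Phi(\epsilon,e,f)=\Phi(e,\epsilon,f)=\Phi(e,f,\epsilon)=1$. Regard $kG$ as a Majid algebra (dual quasi-Hopf algebra) with reassociator $\Phi$ and quasi-antipode $\mathcal S(g)=g^{-1}$, $\alpha(g)=1$, $\beta(g)=1/\Phi(g,g^{-1},g)$. Let $\mathcal C$ be the set of conjugacy classes of $G$, and let $R=\sum_{C\in\mathcal C}R_C C$ be a ramification datum ($R_C\in\mathbb Z_{\ge 0}$, possibly infinitely many nonzero). Let $Q=Q(G,R)$ be the Hopf quiver, with vertex set $G$ and with $R_C$ arrows from $x$ to $cx$ for all $x\in G$, $C\in\mathcal C$, $c\in C$. Let $kQ$ be its path coalgebra, graded by the length of paths, with $\Delta(p)=\sum p''\otimes p'$ over all ways to write $p$ as $p'$ followed by $p''$. A Majid algebra structure on $kQ$ (product, unit, reassociator, quasi-antipode) is called graded if its structure maps preserve degrees, $k$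 being in degree $0$; so the reassociator, $\alpha$ and $\beta$ vanish in positive degrees. For each $C\in\mathcal C$ choose $g(C)\in C$, let $Z_C$ be the centralizer of $g(C)$, and put $\tilde\Phi_C(e,f)=\tilde\Phi(e,f,g(C))$ for $e,f\in Z_C$, where $$\tilde\Phi(e,f,g)=\frac{\Phi(e,f,g)\,\Phi(ef,f^{-1},e^{-1})\,\Phi(e,fg,f^{-1})}{\Phi(efg,f^{-1},e^{-1})\,\Phi(e,f,f^{-1})}.$$ A $\tilde\Phi_C$-representation of $Z_C$ is a $k$-vector space $V$ with a map $\rho\colon Z_C\to GL(V)$ such that $\rho(\epsilon)=\mathrm{Id}_V$ and $\rho(e)\rho(f)=\tilde\Phi_C(e,f)\rho(ef)$ for all $e,f\in Z_C$. Then the graded Majid algebra structures on $kQ$ that contain $(kG,\Phi,\mathcal S,\alpha,\beta)$, through the identification of the elements of $G$ with the vertices, as the sub Majid algebra $kQ_0$, taken up to isomorphisms of graded Majid algebras which are the identity on $kQ_0$, are in one-to-one correspondence with the collections $(M_C)_{C\in\mathcal C}$, where $M_C$ is a $\tilde\Phi_C$-representation of $Z_C$ of dimension $R_C$, taken up to linear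 isomorphisms $M_C\cong N_C$ of representations for every $C$. The correspondence sends a structure to the collection of the spaces $M_C={}^{g(C)}(kQ_1)^{\epsilon}=\{m\in kQ_1 : \Delta(m)=g(C)\otimes m+m\otimes\epsilon\}$ with the action $f\triangleright v=(f\cdot v)\cdot f^{-1}$ of $f\in Z_C$. -/

import Mathlib

open scoped TensorProduct

universe u v w

noncomputable section

/-! ## The path coalgebra of a quiver -/

/-- The path coalgebra `kQ`: the vector space with basis the paths of the quiver `V`
(an element `⟨x, y, p⟩` of the index type is a path `p` from `x` to `y`).
It is kept as a type of its own, because `Finsupp` carries another coalgebra structure. -/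
def PathCoalg (k : Type u) [Field k] (V : Type v) [Quiver.{w} V] :=
  (Σ (x : V) (y : V), Quiver.Path x y) →₀ k

namespace PathCoalg

instance (k : Type u) [Field k] (V : Type v) [Quiver.{w} V] : AddCommGroup (PathCoalg k V) :=
  inferInstanceAs (AddCommGroup ((Σ (x : V) (y : V), Quiver.Path x y) →₀ k))

instance (k : Type u) [Field k] (V : Type v) [Quiver.{w} V] : Module k (PathCoalg k V) :=
  inferInstanceAs (Module k ((Σ (x : V) (y : V), Quiver.Path x y) →₀ k))

/-- The basis of all paths. -/
def pathBasis (k : Type u) [Field k] (V : Type v) [Quiver.{w} V] :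
    Module.Basis (Σ (x : V) (y : V), Quiver.Path x y) k (PathCoalg k V) :=
  Module.Basis.ofRepr (LinearEquiv.refl k ((Σ (x : V) (y : V), Quiver.Path x y) →₀ k))

/-- A path, as an element of the path coalgebra. -/
def ofPath (k : Type u) [Field k] {V : Type v} [Quiver.{w} V] {x y : V} (p : Quiver.Path x y) :
    PathCoalg k V :=
  pathBasis k V ⟨x, y, p⟩

/-- A vertex (a path of length zero), as an element of the path coalgebra. -/
def vertex (k : Type u) [Field k] {V : Type v} [Quiver.{w} V] (x : V) : PathCoalg k V :=
  ofPath k (Quiver.Path.nil : Quiver.Path x x)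

/-- All the ways to write a path `p` from `x` to `y` as a concatenation of a path `p.2.2` from `x`
to an intermediate vertex `p.1`, followed by a path `p.2.1` from there to `y`. -/
def cuts {V : Type v} [Quiver.{w} V] {x : V} : {y : V} → Quiver.Path x y →
    List (Σ z : V, Quiver.Path z y × Quiver.Path x z)
  | _, .nil => [⟨x, .nil, .nil⟩]
  | y, .cons p a =>
      ⟨y, .nil, .cons p a⟩ :: (cuts p).map fun c => ⟨c.1, .cons c.2.1 a, c.2.2⟩

/-- `Δ(p) = ∑ p'' ⊗ p'` over all the ways to write `p` as `p'` followed by `p''`. In particular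
`Δ(a) = y ⊗ a + a ⊗ x` for an arrow `a` from `x` to `y`. -/
def comulMap (k : Type u) [Field k] (V : Type v) [Quiver.{w} V] :
    PathCoalg k V →ₗ[k] PathCoalg k V ⊗[k] PathCoalg k V :=
  (pathBasis k V).constr k fun p =>
    ((cuts p.2.2).map fun c => ofPath k c.2.1 ⊗ₜ[k] ofPath k c.2.2).sum

/-- The counit is one on the vertices and zero on the paths of positive length. -/
def counitMap (k : Type u) [Field k] (V : Type v) [Quiver.{w} V] : PathCoalg k V →ₗ[k] k :=
  (pathBasis k V).constr k fun p => if p.2.2.length = 0 then 1 else 0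

section Helpers

variable (k : Type u) [Field k] {V : Type v} [Quiver.{w} V]

open Classical in
/-- Helper for the coalgebra axioms: append the arrow `a` to all paths where this makes sense, and
kill the other paths. -/
def appendArrow {y z : V} (a : y ⟶ z) : PathCoalg k V →ₗ[k] PathCoalg k V :=
  (pathBasis k V).constr k fun p =>
    if h : p.2.1 = y then ofPath k ((h ▸ p.2.2 : Quiver.Path p.1 y).cons a) else 0

lemma appendArrow_ofPath {x y z : V} (a : y ⟶ z) (p : Quiver.Path x y) :
    appendArrow k a (ofPath k p) = ofPath k (p.cons a) := by
  rw [appendArrow, ofPath, Module.Basis.constr_basis]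
  simp

lemma appendArrow_ofPath_ne {x y y' z : V} (a : y ⟶ z) (p : Quiver.Path x y') (h : y' ≠ y) :
    appendArrow k a (ofPath k p) = 0 := by
  rw [appendArrow, ofPath, Module.Basis.constr_basis]
  simp [h]

lemma comulMap_ofPath {x y : V} (p : Quiver.Path x y) :
    comulMap k V (ofPath k p) =
      ((cuts p).map fun c => ofPath k c.2.1 ⊗ₜ[k] ofPath k c.2.2).sum := by
  rw [comulMap, ofPath, Module.Basis.constr_basis]

lemma comulMap_nil (x : V) :
    comulMap k V (ofPath k (Quiver.Path.nil : Quiver.Path x x)) =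
      vertex k x ⊗ₜ[k] vertex k x := by
  rw [comulMap_ofPath]
  simp [cuts, vertex]

lemma comulMap_cons {x y z : V} (p : Quiver.Path x y) (a : y ⟶ z) :
    comulMap k V (ofPath k (p.cons a)) = vertex k z ⊗ₜ[k] ofPath k (p.cons a) +
      (appendArrow k a).rTensor _ (comulMap k V (ofPath k p)) := by
  rw [comulMap_ofPath, comulMap_ofPath]
  simp [cuts, vertex, map_list_sum, Function.comp_def, appendArrow_ofPath]

lemma counitMap_nil (x : V) :
    counitMap k V (ofPath k (Quiver.Path.nil : Quiver.Path x x)) = 1 := by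
  rw [counitMap, ofPath, Module.Basis.constr_basis]
  simp

lemma counitMap_cons {x y z : V} (p : Quiver.Path x y) (a : y ⟶ z) :
    counitMap k V (ofPath k (p.cons a)) = 0 := by
  rw [counitMap, ofPath, Module.Basis.constr_basis]
  simp

lemma counitMap_comp_appendArrow {y z : V} (a : y ⟶ z) :
    counitMap k V ∘ₗ appendArrow k a = 0 := by
  refine (pathBasis k V).ext fun ⟨x, y', p⟩ => ?_
  change counitMap k V (appendArrow k a (ofPath k p)) = 0
  by_cases h : y' = y
  · subst h
    rw [appendArrow_ofPath, counitMap_cons]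
  · rw [appendArrow_ofPath_ne k a p h, map_zero]

lemma comulMap_comp_appendArrow {y z : V} (a : y ⟶ z) :
    comulMap k V ∘ₗ appendArrow k a = (TensorProduct.mk k _ _ (vertex k z)) ∘ₗ appendArrow k a +
      (appendArrow k a).rTensor _ ∘ₗ comulMap k V := by
  refine (pathBasis k V).ext fun ⟨x, y', p⟩ => ?_
  change comulMap k V (appendArrow k a (ofPath k p)) =
    vertex k z ⊗ₜ[k] appendArrow k a (ofPath k p) +
      (appendArrow k a).rTensor _ (comulMap k V (ofPath k p))
  by_cases h : y' = y
  · subst h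
    rw [appendArrow_ofPath, comulMap_cons]
  · rw [appendArrow_ofPath_ne k a p h, map_zero, TensorProduct.tmul_zero, zero_add,
      comulMap_ofPath]
    simp [map_list_sum, Function.comp_def, appendArrow_ofPath_ne k a _ h]

end Helpers

/-- The coalgebra structure of the path coalgebra. -/
instance instCoalgebra (k : Type u) [Field k] (V : Type v) [Quiver.{w} V] :
    Coalgebra k (PathCoalg k V) where
  comul := comulMap k V
  counit := counitMap k V
  coassoc := by
    refine (pathBasis k V).ext fun ⟨x, y, p⟩ => ?_
    change TensorProduct.assoc k _ _ _ ((comulMap k V).rTensor _ (comulMap k V (ofPath k p))) =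
      (comulMap k V).lTensor _ (comulMap k V (ofPath k p))
    induction p with
    | nil =>
      rw [comulMap_nil]
      simp [vertex, comulMap_nil]
    | @cons y z p a ih =>
      have key : ∀ t : PathCoalg k V ⊗[k] PathCoalg k V,
          TensorProduct.assoc k _ _ _ ((comulMap k V).rTensor _
              ((appendArrow k a).rTensor _ t)) =
            vertex k z ⊗ₜ[k] (appendArrow k a).rTensor _ t +
              (appendArrow k a).rTensor _
                (TensorProduct.assoc k _ _ _ ((comulMap k V).rTensor _ t)) := by
        intro t
        induction t with
        | zero => simp
        | add s t hs ht =>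
          simp only [map_add, hs, ht, TensorProduct.tmul_add]
          abel
        | tmul u v =>
          have h := LinearMap.congr_fun (comulMap_comp_appendArrow k a) u
          simp only [LinearMap.comp_apply, LinearMap.add_apply, TensorProduct.mk_apply] at h
          simp only [LinearMap.rTensor_tmul, h, TensorProduct.add_tmul, map_add,
            TensorProduct.assoc_tmul, add_right_inj]
          induction comulMap k V u with
          | zero => simp
          | add s t hs ht => simp only [map_add, TensorProduct.add_tmul, hs, ht]
          | tmul u u' => simp
      have key' : ∀ t : PathCoalg k V ⊗[k] PathCoalg k V,
          (comulMap k V).lTensor _ ((appendArrow k a).rTensor _ t) =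
            (appendArrow k a).rTensor _ ((comulMap k V).lTensor _ t) := by
        intro t
        rw [← LinearMap.comp_apply, LinearMap.lTensor_comp_rTensor,
          ← LinearMap.rTensor_comp_lTensor, LinearMap.comp_apply]
      rw [comulMap_cons, map_add, map_add, map_add, key, key', ih, LinearMap.rTensor_tmul,
        LinearMap.lTensor_tmul, comulMap_cons, vertex, comulMap_nil, vertex,
        TensorProduct.assoc_tmul, TensorProduct.tmul_add]
      abel
  rTensor_counit_comp_comul := by
    refine (pathBasis k V).ext fun ⟨x, y, p⟩ => ?_
    change (counitMap k V).rTensor _ (comulMap k V (ofPath k p)) = 1 ⊗ₜ ofPath k p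
    cases p with
    | nil => simp [comulMap_nil, vertex, counitMap_nil]
    | cons p a =>
      rw [comulMap_cons, map_add, LinearMap.rTensor_tmul, vertex, counitMap_nil,
        ← LinearMap.comp_apply, ← LinearMap.rTensor_comp, counitMap_comp_appendArrow]
      simp
  lTensor_counit_comp_comul := by
    refine (pathBasis k V).ext fun ⟨x, y, p⟩ => ?_
    change (counitMap k V).lTensor _ (comulMap k V (ofPath k p)) = ofPath k p ⊗ₜ 1
    induction p with
    | nil => simp [comulMap_nil, vertex, counitMap_nil]
    | cons p a ih =>
      rw [comulMap_cons, map_add, LinearMap.lTensor_tmul, counitMap_cons,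
        ← LinearMap.comp_apply, LinearMap.lTensor_comp_rTensor, ← LinearMap.rTensor_comp_lTensor,
        LinearMap.comp_apply, ih]
      simp [appendArrow_ofPath]

/-- The part of degree `n`, spanned by the paths of length `n`. -/
def degree (k : Type u) [Field k] (V : Type v) [Quiver.{w} V] (n : ℕ) :
    Submodule k (PathCoalg k V) :=
  Submodule.span k {m | ∃ (x y : V) (p : Quiver.Path x y), p.length = n ∧ m = ofPath k p}

end PathCoalg

/-! ## Majid algebras -/

section Majid

/-- `c ↦ f(c₁) u(c₂)` for a functional `f` and a linear map `u` on a coalgebra. -/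
def lconv {k : Type u} [Field k] {C : Type v} [AddCommGroup C] [Module k C] [Coalgebra k C]
    {X : Type w} [AddCommGroup X] [Module k X] (f : C →ₗ[k] k) (u : C →ₗ[k] X) : C →ₗ[k] X :=
  (TensorProduct.lid k X).toLinearMap ∘ₗ TensorProduct.map f u ∘ₗ Coalgebra.comul

/-- `c ↦ u(c₁) f(c₂)` for a functional `f` and a linear map `u` on a coalgebra. -/
def rconv {k : Type u} [Field k] {C : Type v} [AddCommGroup C] [Module k C] [Coalgebra k C]
    {X : Type w} [AddCommGroup X] [Module k X] (u : C →ₗ[k] X) (f : C →ₗ[k] k) : C →ₗ[k] X :=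
  (TensorProduct.rid k X).toLinearMap ∘ₗ TensorProduct.map u f ∘ₗ Coalgebra.comul

/-- A Majid algebra (dual quasi-Hopf algebra) structure on a coalgebra `H`: a product and a unit
which are coalgebra maps, a reassociator `Φ` with convolution inverse `Φ⁻¹`, and a quasi-antipode
`(S, α, β)`. -/
structure MajidAlgebra (k : Type u) [Field k] (H : Type v) [AddCommGroup H] [Module k H]
    [Coalgebra k H] where
  /-- The product. -/
  mul : H ⊗[k] H →ₗc[k] H
  /-- The unit element. -/
  one : H
  /-- The reassociator. -/
  reassoc : H ⊗[k] (H ⊗[k] H) →ₗ[k] k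
  /-- The convolution inverse of the reassociator. -/
  reassocInv : H ⊗[k] (H ⊗[k] H) →ₗ[k] k
  /-- The first component of the quasi-antipode. -/
  antipode : H →ₗ[k] H
  /-- The second component of the quasi-antipode. -/
  alpha : H →ₗ[k] k
  /-- The third component of the quasi-antipode. -/
  beta : H →ₗ[k] k
  /-- The map `k → H` given by the unit is a coalgebra map. -/
  isGroupLikeElem_one : IsGroupLikeElem k one
  one_mul : ∀ a : H, mul (one ⊗ₜ a) = a
  mul_one : ∀ a : H, mul (a ⊗ₜ one) = a
  reassoc_conv_inv : lconv reassoc reassocInv = Coalgebra.counit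
  inv_conv_reassoc : lconv reassocInv reassoc = Coalgebra.counit
  /-- `a₁(b₁c₁) Φ(a₂,b₂,c₂) = Φ(a₁,b₁,c₁) (a₂b₂)c₂`. -/
  quasi_assoc :
    rconv (mul.toLinearMap ∘ₗ mul.toLinearMap.lTensor H) reassoc =
      lconv reassoc (mul.toLinearMap ∘ₗ mul.toLinearMap.rTensor H ∘ₗ
        (TensorProduct.assoc k H H H).symm.toLinearMap)
  /-- `Φ(a₁,b₁,c₁d₁) Φ(a₂b₂,c₂,d₂) = Φ(b₁,c₁,d₁) Φ(a₁,b₂c₂,d₂) Φ(a₂,b₃,c₃)`. -/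
  pentagon :
    lconv (reassoc ∘ₗ (mul.toLinearMap.lTensor H).lTensor H)
        (reassoc ∘ₗ mul.toLinearMap.rTensor (H ⊗[k] H) ∘ₗ
          (TensorProduct.assoc k H H (H ⊗[k] H)).symm.toLinearMap) =
      lconv ((TensorProduct.lid k k).toLinearMap ∘ₗ TensorProduct.map Coalgebra.counit reassoc)
        (lconv
          (reassoc ∘ₗ (mul.toLinearMap.rTensor H ∘ₗ
            (TensorProduct.assoc k H H H).symm.toLinearMap).lTensor H)
          ((TensorProduct.rid k k).toLinearMap ∘ₗ TensorProduct.map reassoc Coalgebra.counit ∘ₗ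
            (TensorProduct.assoc k H (H ⊗[k] H) H).symm.toLinearMap ∘ₗ
            (TensorProduct.assoc k H H H).symm.toLinearMap.lTensor H))
  /-- `Φ(a,1,b) = ε(a) ε(b)`. -/
  reassoc_one : ∀ a b : H,
    reassoc (a ⊗ₜ (one ⊗ₜ b)) = Coalgebra.counit (R := k) a * Coalgebra.counit (R := k) b
  /-- The antipode is a coalgebra antimorphism: `ε(S(a)) = ε(a)`, `S(a)₁ ⊗ S(a)₂ = S(a₂) ⊗ S(a₁)`. -/
  counit_antipode : Coalgebra.counit ∘ₗ antipode = (Coalgebra.counit : H →ₗ[k] k)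
  comul_antipode :
    Coalgebra.comul ∘ₗ antipode =
      TensorProduct.map antipode antipode ∘ₗ (TensorProduct.comm k H H).toLinearMap ∘ₗ
        (Coalgebra.comul : H →ₗ[k] H ⊗[k] H)
  /-- `S(a₁) α(a₂) a₃ = α(a) 1`. -/
  antipode_alpha : ∀ a : H,
    mul (TensorProduct.map antipode (lconv alpha LinearMap.id) (Coalgebra.comul (R := k) a)) =
      alpha a • one
  /-- `a₁ β(a₂) S(a₃) = β(a) 1`. -/
  beta_antipode : ∀ a : H,
    mul (TensorProduct.map LinearMap.id (lconv beta antipode) (Coalgebra.comul (R := k) a)) =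
      beta a • one
  /-- `Φ(a₁,S(a₃),a₅) β(a₂) α(a₄) = ε(a)`. -/
  reassoc_antipode : ∀ a : H,
    reassoc (TensorProduct.map LinearMap.id
        (TensorProduct.map (lconv beta antipode) (lconv alpha LinearMap.id) ∘ₗ Coalgebra.comul)
        (Coalgebra.comul (R := k) a)) = Coalgebra.counit (R := k) a
  /-- `Φ⁻¹(S(a₁),a₃,S(a₅)) α(a₂) β(a₄) = ε(a)`. -/
  reassocInv_antipode : ∀ a : H,
    reassocInv (TensorProduct.map antipode
        (TensorProduct.map (lconv alpha LinearMap.id) (lconv beta antipode) ∘ₗ Coalgebra.comul)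
        (Coalgebra.comul (R := k) a)) = Coalgebra.counit (R := k) a

/-- The Majid algebra structure is graded, for the given grading of the coalgebra `H`: the
structure maps preserve degrees, where the ground field is in degree zero. -/
structure MajidAlgebra.IsGraded {k : Type u} [Field k] {H : Type v} [AddCommGroup H] [Module k H]
    [Coalgebra k H] (A : MajidAlgebra k H) (deg : ℕ → Submodule k H) : Prop where
  mul_mem : ∀ {i j : ℕ} {a b : H}, a ∈ deg i → b ∈ deg j → A.mul (a ⊗ₜ b) ∈ deg (i + j)
  one_mem : A.one ∈ deg 0
  reassoc_eq_zero : ∀ {i j l : ℕ} {a b c : H}, a ∈ deg i → b ∈ deg j → c ∈ deg l →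
    i + j + l ≠ 0 → A.reassoc (a ⊗ₜ (b ⊗ₜ c)) = 0
  antipode_mem : ∀ {i : ℕ} {a : H}, a ∈ deg i → A.antipode a ∈ deg i
  alpha_eq_zero : ∀ {i : ℕ} {a : H}, a ∈ deg i → i ≠ 0 → A.alpha a = 0
  beta_eq_zero : ∀ {i : ℕ} {a : H}, a ∈ deg i → i ≠ 0 → A.beta a = 0

/-- The coalgebra automorphism `φ` of `H` is an isomorphism of Majid algebras from `A` to `B`. -/
structure MajidAlgebra.IsIso {k : Type u} [Field k] {H : Type v} [AddCommGroup H] [Module k H]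
    [Coalgebra k H] (A B : MajidAlgebra k H) (φ : H ≃ₗc[k] H) : Prop where
  map_mul : ∀ a b : H, φ (A.mul (a ⊗ₜ b)) = B.mul (φ a ⊗ₜ φ b)
  map_one : φ A.one = B.one
  map_reassoc : ∀ a b c : H, A.reassoc (a ⊗ₜ (b ⊗ₜ c)) = B.reassoc (φ a ⊗ₜ (φ b ⊗ₜ φ c))
  map_antipode : ∀ a : H, φ (A.antipode a) = B.antipode (φ a)
  map_alpha : ∀ a : H, A.alpha a = B.alpha (φ a)
  map_beta : ∀ a : H, A.beta a = B.beta (φ a)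

end Majid

/-! ## Groups with a 3-cocycle, Hopf quivers -/

/-- `Φ` is a normalized 3-cocycle on the group `G`, with values in `kˣ`. -/
structure IsNormalizedThreeCocycle {k : Type u} [Field k] {G : Type v} [Group G]
    (Φ : G → G → G → kˣ) : Prop where
  cocycle : ∀ e f g h : G,
    Φ e f g * Φ e (f * g) h * Φ f g h = Φ (e * f) g h * Φ e f (g * h)
  one_left : ∀ e f : G, Φ 1 e f = 1
  one_middle : ∀ e f : G, Φ e 1 f = 1
  one_right : ∀ e f : G, Φ e f 1 = 1

/-- The vertices of the Hopf quiver `Q(G, R)` are the elements of `G`. The ramification datum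
`R = ∑ R_C C` is given by its coefficients. -/
def HopfQuiver {G : Type v} [Group G] (_R : ConjClasses G → ℕ) : Type v := G

namespace HopfQuiver

/-- For `x` in `G` and `c` in the conjugacy class `C`, there are `R_C` arrows from `x` to `c * x`;
in other words, there are `R_C` arrows from `x` to `y` where `C` is the class of `y * x⁻¹`. -/
instance {G : Type v} [Group G] (R : ConjClasses G → ℕ) : Quiver.{0} (HopfQuiver R) where
  Hom (x y : G) := Fin (R (ConjClasses.mk (y * x⁻¹)))

/-- The group element `g`, as a vertex in the path coalgebra of the Hopf quiver. -/
def elt (k : Type u) [Field k] {G : Type v} [Group G] (R : ConjClasses G → ℕ) (g : G) :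
    PathCoalg k (HopfQuiver R) :=
  PathCoalg.vertex k (V := HopfQuiver R) g

end HopfQuiver

/-- A graded Majid algebra structure on the path coalgebra of the Hopf quiver `Q(G, R)`, which
contains the group algebra `kG`, with reassociator `Φ` and quasi-antipode
`S(g) = g⁻¹`, `α(g) = 1`, `β(g) = Φ(g,g⁻¹,g)⁻¹`, as the sub Majid algebra of degree zero. -/
structure HopfQuiverMajid {k : Type u} [Field k] {G : Type v} [Group G] (Φ : G → G → G → kˣ)
    (R : ConjClasses G → ℕ) extends MajidAlgebra k (PathCoalg k (HopfQuiver R)) where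
  isGraded : toMajidAlgebra.IsGraded (PathCoalg.degree k (HopfQuiver R))
  mul_elt : ∀ g h : G,
    mul (HopfQuiver.elt k R g ⊗ₜ HopfQuiver.elt k R h) = HopfQuiver.elt k R (g * h)
  one_eq : one = HopfQuiver.elt k R 1
  reassoc_elt : ∀ f g h : G,
    reassoc (HopfQuiver.elt k R f ⊗ₜ (HopfQuiver.elt k R g ⊗ₜ HopfQuiver.elt k R h)) = Φ f g h
  antipode_elt : ∀ g : G, antipode (HopfQuiver.elt k R g) = HopfQuiver.elt k R g⁻¹
  alpha_elt : ∀ g : G, alpha (HopfQuiver.elt k R g) = 1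
  beta_elt : ∀ g : G, beta (HopfQuiver.elt k R g) = ((Φ g g⁻¹ g)⁻¹ : kˣ)

namespace HopfQuiverMajid

/-- Isomorphism of graded Majid algebra structures over `kG`: there is an isomorphism of graded
Majid algebras which is the identity on `kG`. -/
def Isomorphic {k : Type u} [Field k] {G : Type v} [Group G] {Φ : G → G → G → kˣ}
    {R : ConjClasses G → ℕ} (A B : HopfQuiverMajid Φ R) : Prop :=
  ∃ φ : PathCoalg k (HopfQuiver R) ≃ₗc[k] PathCoalg k (HopfQuiver R),
    A.toMajidAlgebra.IsIso B.toMajidAlgebra φ ∧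
    (∀ (n : ℕ) (a : PathCoalg k (HopfQuiver R)),
      φ a ∈ PathCoalg.degree k (HopfQuiver R) n ↔ a ∈ PathCoalg.degree k (HopfQuiver R) n) ∧
    ∀ g : G, φ (HopfQuiver.elt k R g) = HopfQuiver.elt k R g

instance setoid {k : Type u} [Field k] {G : Type v} [Group G] (Φ : G → G → G → kˣ)
    (R : ConjClasses G → ℕ) : Setoid (HopfQuiverMajid Φ R) where
  r := Isomorphic
  iseqv :=
    { refl := fun A => ⟨CoalgEquiv.refl k _,
        ⟨fun _ _ => rfl, rfl, fun _ _ _ => rfl, fun _ => rfl, fun _ => rfl, fun _ => rfl⟩,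
        fun _ _ => Iff.rfl, fun _ => rfl⟩
      symm := by
        rintro A B ⟨φ, h, hd, hg⟩
        have e : ∀ a, φ (φ.symm a) = a := φ.apply_symm_apply
        have inj : Function.Injective fun a => φ a := φ.injective
        refine ⟨φ.symm, ⟨fun a b => ?_, ?_, fun a b c => ?_, fun a => ?_, fun a => ?_,
          fun a => ?_⟩, fun n a => ?_, fun g => ?_⟩
        · apply inj
          beta_reduce
          rw [h.map_mul, e, e, e]
        · apply inj
          beta_reduce
          rw [h.map_one, e]
        · rw [h.map_reassoc, e, e, e]
        · apply inj
          beta_reduce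
          rw [h.map_antipode, e, e]
        · rw [h.map_alpha, e]
        · rw [h.map_beta, e]
        · rw [← hd, e]
        · apply inj
          beta_reduce
          rw [e, hg]
      trans := by
        rintro A B D ⟨φ, h, hd, hg⟩ ⟨ψ, h', hd', hg'⟩
        refine ⟨φ.trans ψ, ⟨fun a b => ?_, ?_, fun a b c => ?_, fun a => ?_, fun a => ?_,
          fun a => ?_⟩, fun n a => ?_, fun g => ?_⟩
        · exact (congrArg ψ (h.map_mul a b)).trans (h'.map_mul _ _)
        · exact (congrArg ψ h.map_one).trans h'.map_one
        · exact (h.map_reassoc a b c).trans (h'.map_reassoc _ _ _)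
        · exact (congrArg ψ (h.map_antipode a)).trans (h'.map_antipode _)
        · exact (h.map_alpha a).trans (h'.map_alpha _)
        · exact (h.map_beta a).trans (h'.map_beta _)
        · exact (hd' n (φ a)).trans (hd n a)
        · exact (congrArg ψ (hg g)).trans (hg' g) }

end HopfQuiverMajid

/-- The isotypic component `ᵍMʰ = {m | δ_L(m) = g ⊗ m, δ_R(m) = m ⊗ h}` of the space `M = kQ₁`
spanned by the arrows. On `M` the comultiplication is `Δ = δ_L + δ_R`, with `δ_L` taking values in
`kG ⊗ M` and `δ_R` in `M ⊗ kG`. -/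
def isotypic (k : Type u) [Field k] {G : Type v} [Group G] (R : ConjClasses G → ℕ) (g h : G) :
    Submodule k (PathCoalg k (HopfQuiver R)) :=
  PathCoalg.degree k (HopfQuiver R) 1 ⊓
    LinearMap.eqLocus (Coalgebra.comul (R := k) (A := PathCoalg k (HopfQuiver R)))
      (TensorProduct.mk k _ _ (HopfQuiver.elt k R g) +
        (TensorProduct.mk k _ _).flip (HopfQuiver.elt k R h))

/-! ## Projective representations -/

/-- `Φ̃(e,f,g) = Φ(e,f,g) Φ(ef,f⁻¹,e⁻¹) Φ(e,fg,f⁻¹) / (Φ(efg,f⁻¹,e⁻¹) Φ(e,f,f⁻¹))`. -/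
def tildeCocycle {k : Type u} [Field k] {G : Type v} [Group G] (Φ : G → G → G → kˣ)
    (e f g : G) : kˣ :=
  Φ e f g * Φ (e * f) f⁻¹ e⁻¹ * Φ e (f * g) f⁻¹ / (Φ (e * f * g) f⁻¹ e⁻¹ * Φ e f f⁻¹)

/-- A projective representation of the group `Z` with the factors `a`, also called an
`a`-representation, of dimension `n`. -/
structure ProjRep (k : Type u) [Field k] {Z : Type v} [Group Z] (a : Z → Z → kˣ) (n : ℕ) where
  /-- The underlying vector space. -/
  V : Type u
  [addCommGroup : AddCommGroup V]
  [module : Module k V]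
  /-- The action. -/
  ρ : Z → (V ≃ₗ[k] V)
  map_one : ρ 1 = LinearEquiv.refl k V
  map_mul : ∀ (g h : Z) (v : V), ρ g (ρ h v) = (a g h : k) • ρ (g * h) v
  rank_eq : Module.rank k V = n

attribute [instance] ProjRep.addCommGroup ProjRep.module

/-- The collections `(M_C)` of `Φ̃_C`-representations `M_C` of dimension `R_C` of the centralizer
`Z_C` of the chosen element `γ C` of `C`, where `Φ̃_C(e,f) = Φ̃(e,f,γ C)`. -/
def RepCollection {k : Type u} [Field k] {G : Type v} [Group G] (Φ : G → G → G → kˣ)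
    (R : ConjClasses G → ℕ) (γ : ConjClasses G → G) :=
  ∀ C : ConjClasses G,
    ProjRep k (Z := Subgroup.centralizer {γ C}) (fun e f => tildeCocycle Φ e f (γ C)) (R C)

namespace RepCollection

/-- Isomorphism of collections: for every class, there is a linear isomorphism which commutes with
the actions. -/
def Isomorphic {k : Type u} [Field k] {G : Type v} [Group G] {Φ : G → G → G → kˣ}
    {R : ConjClasses G → ℕ} {γ : ConjClasses G → G} (M N : RepCollection Φ R γ) : Prop :=
  ∀ C : ConjClasses G, ∃ φ : (M C).V ≃ₗ[k] (N C).V, ∀ (f : Subgroup.centralizer {γ C}) (v),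
    φ ((M C).ρ f v) = (N C).ρ f (φ v)

instance setoid {k : Type u} [Field k] {G : Type v} [Group G] (Φ : G → G → G → kˣ)
    (R : ConjClasses G → ℕ) (γ : ConjClasses G → G) : Setoid (RepCollection Φ R γ) where
  r := Isomorphic
  iseqv :=
    { refl := fun _ _ => ⟨LinearEquiv.refl k _, fun _ _ => rfl⟩
      symm := by
        intro M N h C
        obtain ⟨φ, hφ⟩ := h C
        refine ⟨φ.symm, fun f v => φ.injective ?_⟩
        rw [hφ, φ.apply_symm_apply, φ.apply_symm_apply]
      trans := by
        intro M N L h h' C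
        obtain ⟨φ, hφ⟩ := h C
        obtain ⟨ψ, hψ⟩ := h' C
        refine ⟨φ.trans ψ, fun f v => ?_⟩
        rw [LinearEquiv.trans_apply, LinearEquiv.trans_apply, hφ, hψ] }

/-- The collection `(M_C)` is the one attached to the graded Majid algebra structure `A`: up to
isomorphism, `M_C` is the isotypic component `ᶜMᵉ` of `M = kQ₁` (where `c = γ C` is the chosen
element of `C` and `e` the unit of `G`), with the action `f ▷ v = (f.v).f⁻¹` of `Z_C`. -/
def IsAttachedTo {k : Type u} [Field k] {G : Type v} [Group G] {Φ : G → G → G → kˣ}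
    {R : ConjClasses G → ℕ} {γ : ConjClasses G → G} (M : RepCollection Φ R γ)
    (A : HopfQuiverMajid Φ R) : Prop :=
  ∀ C : ConjClasses G, ∃ φ : (M C).V →ₗ[k] PathCoalg k (HopfQuiver R),
    Function.Injective φ ∧ LinearMap.range φ = isotypic k R (γ C) 1 ∧
    ∀ (f : Subgroup.centralizer {γ C}) (v : (M C).V),
      φ ((M C).ρ f v) =
        A.mul (A.mul (HopfQuiver.elt k R f ⊗ₜ φ v) ⊗ₜ HopfQuiver.elt k R (f : G)⁻¹)

end RepCollection

end

/-!
For paths `p` of the quiver let `coord k p` be the linear functional on `kQ` that reads off the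
coefficient of `p`. The coordinate of a path of positive length is a convolution product of the
coordinates of its arrows (`coord_cons`). Hence a linear map into `kQ` that respects the
comultiplications is determined by its components in degrees zero and one (`comulHom_ext`), and
every compatible pair of such components on a graded coalgebra extends (`exists_comulHom`).

The product of a graded Majid algebra structure on `kQ` over `(kG, Φ)` is such a map, defined on
`kQ ⊗ kQ`. Its component in degree zero is the product of `G`. Its component in degree one consists
of a left and a right action of `G` on the arrows, which are associative and commute up to factors
given by `Φ` (`ArrowBimodule`). The reassociator and the functionals of the quasi-antipode are
supported on `G`, and isomorphisms too are determined by what they do on arrows. So graded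
structures amount to such bimodules: each structure has a bimodule
(`HopfQuiverMajid.arrowBimodule`), each bimodule comes from a structure (`exists_hopfQuiverMajid`),
and isomorphisms of bimodules extend to isomorphisms of graded Majid algebras
(`HopfQuiverMajid.isomorphic_of_arrow`).

It remains to compare bimodules with projective representations. Write `ʸMˣ` for the span of the
arrows from `x` to `y`. The adjoint action `m ↦ (f.m).f⁻¹` sends `ᶜM¹` to `ᵈM¹` with `d = fcf⁻¹`,
and the three associativity relations of the bimodule show that it is projective with factors `Φ̃`
(`ArrowBimodule.adj_adj`). This gives a collection of representations (`exists_isAttachedTo`). The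
collection determines the bimodule, because every `ʸMˣ` consists of the translates `(t.v).(t⁻¹x)`
of the elements `v` of some `ᶜM¹` with `c` among the chosen representatives, and the bimodule
permutes translates with factors that depend on `Φ` only (`ArrowBimodule.exists_l_r_l_eq`,
`RepCollection.IsAttachedTo.isomorphic_majid`).

Conversely, the factors `Φ̃` agree up to a coboundary with factors `τ`, which form a 2-cocycle of the
action groupoid of `G` on itself by conjugation (`transgression`, `tildeCocycle_mul`). A
representation of the centralizer of `c`, renormalized to the factors `τ`, extends to the action
groupoid of the conjugacy class of `c` (`exists_groupoidAction`), and the extensions for all classes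
make up a bimodule with the given representations (`RepCollection.exists_arrowBimodule`).
-/

noncomputable section

/-! ### Functionals on a coalgebra -/

section Convolution

variable {k : Type u} [Field k] {C : Type v} [AddCommGroup C] [Module k C]

/-- The convolution product `c ↦ φ(c₁) ψ(c₂)` of two functionals on `C`, for a comultiplication `Δ`
on `C`. The comultiplication is an explicit argument, so that the opposite one can be used too. -/
def convMul (Δ : C →ₗ[k] C ⊗[k] C) (φ ψ : C →ₗ[k] k) : C →ₗ[k] k :=
  (TensorProduct.lid k k).toLinearMap ∘ₗ TensorProduct.map φ ψ ∘ₗ Δ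

/-- Coassociativity of a comultiplication. -/
def IsCoassoc (Δ : C →ₗ[k] C ⊗[k] C) : Prop :=
  (TensorProduct.assoc k C C C).toLinearMap ∘ₗ Δ.rTensor C ∘ₗ Δ = Δ.lTensor C ∘ₗ Δ

lemma convMul_apply (Δ : C →ₗ[k] C ⊗[k] C) (φ ψ : C →ₗ[k] k) (c : C) :
    convMul Δ φ ψ c = TensorProduct.lid k k (TensorProduct.map φ ψ (Δ c)) := rfl

@[simp] lemma convMul_zero (Δ : C →ₗ[k] C ⊗[k] C) (φ : C →ₗ[k] k) : convMul Δ φ 0 = 0 := by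
  simp [convMul]

@[simp] lemma zero_convMul (Δ : C →ₗ[k] C ⊗[k] C) (φ : C →ₗ[k] k) : convMul Δ 0 φ = 0 := by
  simp [convMul]

lemma convMul_assoc {Δ : C →ₗ[k] C ⊗[k] C} (h : IsCoassoc Δ) (φ ψ χ : C →ₗ[k] k) :
    convMul Δ (convMul Δ φ ψ) χ = convMul Δ φ (convMul Δ ψ χ) := by
  ext c
  have h := congrArg (fun t => TensorProduct.lid k k (TensorProduct.map φ
    ((TensorProduct.lid k k).toLinearMap ∘ₗ TensorProduct.map ψ χ) t)) (LinearMap.congr_fun h c)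
  simp only [LinearMap.comp_apply, LinearEquiv.coe_coe] at h
  simp only [convMul_apply]
  convert h using 1
  · generalize Δ c = t
    induction t with
    | zero => simp
    | add s t hs ht => simp only [map_add, hs, ht]
    | tmul x y =>
      simp only [TensorProduct.map_tmul, LinearMap.rTensor_tmul, convMul_apply]
      generalize Δ x = t
      induction t with
      | zero => simp
      | add s t hs ht => simp only [map_add, hs, ht, TensorProduct.add_tmul]
      | tmul x' y' => simp [mul_assoc]
  · generalize Δ c = t
    induction t with
    | zero => simp
    | add s t hs ht => simp only [map_add, hs, ht]
    | tmul x y => simp [convMul_apply]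

lemma isCoassoc_comul [Coalgebra k C] :
    IsCoassoc (Coalgebra.comul : C →ₗ[k] C ⊗[k] C) :=
  Coalgebra.coassoc

lemma isCoassoc_comm_comul [Coalgebra k C] :
    IsCoassoc ((TensorProduct.comm k C C).toLinearMap ∘ₗ (Coalgebra.comul : C →ₗ[k] C ⊗[k] C)) := by
  unfold IsCoassoc
  ext c
  have h := congrArg (fun t => TensorProduct.assoc k C C C (TensorProduct.comm k C (C ⊗[k] C)
      ((TensorProduct.comm k C C).toLinearMap.lTensor C t)))
    (Coalgebra.coassoc_apply (R := k) c).symm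
  simp only [LinearMap.comp_apply, LinearEquiv.coe_coe]
  convert h using 1
  · generalize (Coalgebra.comul (R := k) c) = t
    induction t with
    | zero => simp
    | add s t hs ht => simp only [map_add, hs, ht]
    | tmul x y => simp
  · generalize (Coalgebra.comul (R := k) c) = t
    induction t with
    | zero => simp
    | add s t hs ht => simp only [map_add, hs, ht]
    | tmul x y =>
      simp only [TensorProduct.comm_tmul, LinearMap.lTensor_tmul, LinearMap.rTensor_tmul,
        LinearMap.comp_apply, LinearEquiv.coe_coe]
      generalize (Coalgebra.comul (R := k) x) = t
      induction t with
      | zero => simp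
      | add s t hs ht => simp only [map_add, hs, ht, TensorProduct.add_tmul, TensorProduct.tmul_add]
      | tmul x' y' => simp

lemma lconv_eq_convMul [Coalgebra k C] (φ ψ : C →ₗ[k] k) :
    lconv φ ψ = convMul Coalgebra.comul φ ψ := rfl

lemma rconv_eq_convMul [Coalgebra k C] (φ ψ : C →ₗ[k] k) :
    rconv φ ψ = convMul Coalgebra.comul φ ψ := by
  simp only [rconv, convMul, TensorProduct.lid_eq_rid]

lemma comp_lconv [Coalgebra k C] {X Y : Type*} [AddCommGroup X] [Module k X] [AddCommGroup Y]
    [Module k Y] (g : X →ₗ[k] Y) (φ : C →ₗ[k] k) (f : C →ₗ[k] X) :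
    g ∘ₗ lconv φ f = lconv φ (g ∘ₗ f) := by
  ext c
  simp only [lconv, LinearMap.comp_apply]
  generalize (Coalgebra.comul (R := k) c) = t
  induction t with
  | zero => simp
  | add s t hs ht => simp only [map_add, hs, ht]
  | tmul x y => simp

lemma comp_rconv [Coalgebra k C] {X Y : Type*} [AddCommGroup X] [Module k X] [AddCommGroup Y]
    [Module k Y] (g : X →ₗ[k] Y) (f : C →ₗ[k] X) (φ : C →ₗ[k] k) :
    g ∘ₗ rconv f φ = rconv (g ∘ₗ f) φ := by
  ext c
  simp only [rconv, LinearMap.comp_apply]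
  generalize (Coalgebra.comul (R := k) c) = t
  induction t with
  | zero => simp
  | add s t hs ht => simp only [map_add, hs, ht]
  | tmul x y => simp

/-- A linear map which is compatible with the comultiplications induces a map of convolution
products. -/
lemma convMul_comp {D : Type*} [AddCommGroup D] [Module k D] {Δ : C →ₗ[k] C ⊗[k] C}
    {Δ' : D →ₗ[k] D ⊗[k] D} {F : C →ₗ[k] D} (h : Δ' ∘ₗ F = TensorProduct.map F F ∘ₗ Δ)
    (φ ψ : D →ₗ[k] k) : convMul Δ' φ ψ ∘ₗ F = convMul Δ (φ ∘ₗ F) (ψ ∘ₗ F) := by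
  rw [convMul, convMul, LinearMap.comp_assoc, LinearMap.comp_assoc, h,
    TensorProduct.map_comp, LinearMap.comp_assoc]

end Convolution

namespace PathCoalg

/-! ### Coordinates on the path coalgebra -/

section Coord

variable (k : Type u) [Field k] {V : Type v} [Quiver.{w} V]

/-- The coordinate of a path. -/
def coord {x y : V} (p : Quiver.Path x y) : PathCoalg k V →ₗ[k] k :=
  (pathBasis k V).coord ⟨x, y, p⟩

lemma coord_ofPath_self {x y : V} (p : Quiver.Path x y) : coord k p (ofPath k p) = 1 := by
  simp [coord, ofPath]

lemma coord_ofPath_ne {x y x' y' : V} (p : Quiver.Path x y) (q : Quiver.Path x' y')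
    (h : (⟨x', y', q⟩ : Σ (x : V) (y : V), Quiver.Path x y) ≠ ⟨x, y, p⟩) :
    coord k p (ofPath k q) = 0 := by
  simp [coord, ofPath, h]

lemma coord_ofPath_of_length_ne {x y x' y' : V} (p : Quiver.Path x y) (q : Quiver.Path x' y')
    (h : q.length ≠ p.length) : coord k p (ofPath k q) = 0 := by
  apply coord_ofPath_ne
  intro e
  apply h
  have := congrArg (fun s : Σ (x : V) (y : V), Quiver.Path x y => s.2.2.length) e
  exact this

variable {k}

lemma ext_coord {h h' : PathCoalg k V}
    (H : ∀ (x y : V) (p : Quiver.Path x y), coord k p h = coord k p h') : h = h' := by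
  apply (pathBasis k V).ext_elem
  rintro ⟨x, y, p⟩
  exact H x y p

lemma hom_ext {X : Type*} [AddCommGroup X] [Module k X] {f g : PathCoalg k V →ₗ[k] X}
    (H : ∀ (x y : V) (p : Quiver.Path x y), f (ofPath k p) = g (ofPath k p)) : f = g :=
  (pathBasis k V).ext fun ⟨x, y, p⟩ => H x y p

lemma hom_ext_coord {X : Type*} [AddCommGroup X] [Module k X] {f g : X →ₗ[k] PathCoalg k V}
    (H : ∀ (x y : V) (p : Quiver.Path x y), coord k p ∘ₗ f = coord k p ∘ₗ g) : f = g := by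
  ext c
  exact ext_coord fun x y p => LinearMap.congr_fun (H x y p) c

lemma comul_eq : (Coalgebra.comul : PathCoalg k V →ₗ[k] _) = comulMap k V := rfl

lemma counit_eq : (Coalgebra.counit : PathCoalg k V →ₗ[k] k) = counitMap k V := rfl

variable (k V) in
/-- The projection onto the part of degree zero. -/
def projZero : PathCoalg k V →ₗ[k] PathCoalg k V :=
  (pathBasis k V).constr k fun p => if p.2.2.length = 0 then ofPath k p.2.2 else 0

lemma projZero_ofPath {x y : V} (p : Quiver.Path x y) :
    projZero k V (ofPath k p) = if p.length = 0 then ofPath k p else 0 := by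
  rw [projZero, ofPath, Module.Basis.constr_basis]
  rfl

@[simp] lemma projZero_vertex (x : V) : projZero k V (vertex k x) = vertex k x := by
  rw [vertex, projZero_ofPath]; simp

lemma projZero_comp_appendArrow {y z : V} (a : y ⟶ z) :
    projZero k V ∘ₗ appendArrow k a = 0 := by
  refine hom_ext fun x y' p => ?_
  rw [LinearMap.comp_apply]
  by_cases h : y' = y
  · subst h
    rw [appendArrow_ofPath, projZero_ofPath]
    simp
  · rw [appendArrow_ofPath_ne k a p h, map_zero]; rfl

/-- The left coaction of the vertices on a path. -/
lemma projZero_rTensor_comul {x y : V} (p : Quiver.Path x y) :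
    (projZero k V).rTensor _ (Coalgebra.comul (R := k) (ofPath k p)) =
      vertex k y ⊗ₜ ofPath k p := by
  rw [comul_eq]
  cases p with
  | nil => rw [comulMap_nil, LinearMap.rTensor_tmul, projZero_vertex]; rfl
  | cons p a =>
    rw [comulMap_cons, map_add, LinearMap.rTensor_tmul, projZero_vertex, ← LinearMap.comp_apply,
      ← LinearMap.rTensor_comp, projZero_comp_appendArrow]
    simp

/-- The right coaction of the vertices on a path. -/
lemma projZero_lTensor_comul {x y : V} (p : Quiver.Path x y) :
    (projZero k V).lTensor _ (Coalgebra.comul (R := k) (ofPath k p)) =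
      ofPath k p ⊗ₜ vertex k x := by
  rw [comul_eq]
  induction p with
  | nil => rw [comulMap_nil, LinearMap.lTensor_tmul, projZero_vertex]; rfl
  | cons p a ih =>
    rw [comulMap_cons, map_add, LinearMap.lTensor_tmul, projZero_ofPath,
        ← LinearMap.comp_apply, LinearMap.lTensor_comp_rTensor, ← LinearMap.rTensor_comp_lTensor,
        LinearMap.comp_apply, ih]
    simp [appendArrow_ofPath]

lemma comul_vertex (x : V) :
    Coalgebra.comul (R := k) (vertex k x) = vertex k x ⊗ₜ[k] vertex k x :=
  comulMap_nil k x

lemma counit_vertex (x : V) : Coalgebra.counit (R := k) (vertex k x) = 1 :=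
  counitMap_nil k x

lemma coord_nil_comp_projZero (x : V) :
    coord k (.nil : Quiver.Path x x) ∘ₗ projZero k V = coord k (.nil : Quiver.Path x x) := by
  refine hom_ext fun x' y' p => ?_
  rw [LinearMap.comp_apply, projZero_ofPath]
  split_ifs with h
  · rfl
  · rw [coord_ofPath_of_length_ne _ _ _ (by simpa using h), map_zero]

lemma coord_nil_vertex_ne {x y : V} (h : y ≠ x) :
    coord k (.nil : Quiver.Path x x) (vertex k y) = 0 := by
  apply coord_ofPath_ne
  intro e
  exact h (congrArg Sigma.fst e)

lemma coord_nil_vertex_self (x : V) :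
    coord k (.nil : Quiver.Path x x) (vertex k x) = 1 :=
  coord_ofPath_self _ _

/-- Convolution with a functional that is supported in degree zero. -/
lemma convMul_apply_ofPath {φ : PathCoalg k V →ₗ[k] k} (h : φ ∘ₗ projZero k V = φ)
    (ψ : PathCoalg k V →ₗ[k] k) {x y : V} (p : Quiver.Path x y) :
    convMul Coalgebra.comul φ ψ (ofPath k p) = φ (vertex k y) * ψ (ofPath k p) := by
  have h1 : TensorProduct.map φ ψ = TensorProduct.map φ ψ ∘ₗ (projZero k V).rTensor _ := by
    rw [LinearMap.rTensor, ← TensorProduct.map_comp, h, LinearMap.comp_id]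
  rw [convMul_apply, h1, LinearMap.comp_apply, projZero_rTensor_comul]
  simp

lemma coord_cons_comp_appendArrow_self {x y z : V} (p : Quiver.Path x y) (a : y ⟶ z) :
    coord k (p.cons a) ∘ₗ appendArrow k a = coord k p := by
  refine hom_ext fun x' y' q => ?_
  rw [LinearMap.comp_apply]
  by_cases h : y' = y
  · subst h
    rw [appendArrow_ofPath]
    by_cases h2 : (⟨x', y', q⟩ : Σ (x : V) (y : V), Quiver.Path x y) = ⟨x, y', p⟩
    · simp only [Sigma.mk.injEq] at h2
      obtain ⟨rfl, h3⟩ := h2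
      simp only [heq_eq_eq, Sigma.mk.injEq, true_and] at h3
      subst h3
      rw [coord_ofPath_self, coord_ofPath_self]
    · rw [coord_ofPath_ne _ _ _ h2, coord_ofPath_ne]
      intro e
      apply h2
      simp only [Sigma.mk.injEq] at e
      obtain ⟨rfl, e⟩ := e
      simp only [heq_eq_eq, Sigma.mk.injEq, true_and, Quiver.Path.cons.injEq, and_true] at e
      rw [e]
  · rw [appendArrow_ofPath_ne k a q h, map_zero, coord_ofPath_ne]
    intro e
    exact h (congrArg (fun s : Σ (x : V) (y : V), Quiver.Path x y => s.2.1) e)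

lemma coord_cons_comp_appendArrow_ne {x y z y' z' : V} (p : Quiver.Path x y) (a : y ⟶ z)
    (b : y' ⟶ z') (h : (⟨y', z', b⟩ : Σ (x : V) (y : V), x ⟶ y) ≠ ⟨y, z, a⟩) :
    coord k (p.cons a) ∘ₗ appendArrow k b = 0 := by
  refine hom_ext fun x' w q => ?_
  rw [LinearMap.comp_apply]
  by_cases h1 : w = y'
  · subst h1
    rw [appendArrow_ofPath, coord_ofPath_ne]
    · rfl
    intro e
    apply h
    simp only [Sigma.mk.injEq] at e
    obtain ⟨rfl, e⟩ := e
    simp only [heq_eq_eq, Sigma.mk.injEq] at e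
    obtain ⟨rfl, e⟩ := e
    simp only [heq_eq_eq, Quiver.Path.cons.injEq] at e
    obtain ⟨rfl, _, e⟩ := e
    rw [eq_of_heq e]
  · rw [appendArrow_ofPath_ne k b q h1, map_zero]; rfl

/-- The coordinate of a composition of a path with an arrow is a convolution product. -/
lemma coord_cons {x y z : V} (p : Quiver.Path x y) (a : y ⟶ z) :
    coord k (p.cons a) = convMul Coalgebra.comul (coord k a.toPath) (coord k p) := by
  refine hom_ext fun x' w q => ?_
  cases q with
  | nil =>
    rw [convMul_apply, comul_eq, comulMap_nil, TensorProduct.map_tmul,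
      coord_ofPath_of_length_ne _ _ _ (by simp), vertex,
      coord_ofPath_of_length_ne _ a.toPath _ (by simp)]
    simp
  | @cons w' _ q b =>
    rw [convMul_apply, comul_eq, comulMap_cons, map_add, TensorProduct.map_tmul, vertex,
      coord_ofPath_of_length_ne _ a.toPath _ (by simp), TensorProduct.zero_tmul, zero_add,
      ← LinearMap.comp_apply, LinearMap.map_comp_rTensor, ← appendArrow_ofPath,
      ← LinearMap.comp_apply (f := coord k _)]
    by_cases h : (⟨w', w, b⟩ : Σ (x : V) (y : V), x ⟶ y) = ⟨y, z, a⟩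
    · simp only [Sigma.mk.injEq] at h
      obtain ⟨rfl, h⟩ := h
      simp only [heq_eq_eq, Sigma.mk.injEq] at h
      obtain ⟨rfl, h⟩ := h
      simp only [heq_eq_eq] at h
      subst h
      rw [coord_cons_comp_appendArrow_self, Quiver.Hom.toPath, coord_cons_comp_appendArrow_self,
        ← comul_eq, ← convMul_apply, convMul_apply_ofPath (coord_nil_comp_projZero _),
        coord_nil_vertex_self, one_mul]
    · rw [coord_cons_comp_appendArrow_ne _ _ _ h, Quiver.Hom.toPath,
        coord_cons_comp_appendArrow_ne _ _ _ h]
      simp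

lemma convMul_coord_nil_self {x y : V} (p : Quiver.Path x y) :
    convMul Coalgebra.comul (coord k (.nil : Quiver.Path y y)) (coord k p) = coord k p := by
  refine hom_ext fun x' w q => ?_
  rw [convMul_apply_ofPath (coord_nil_comp_projZero _)]
  by_cases h : w = y
  · subst h
    rw [coord_nil_vertex_self, one_mul]
  · rw [coord_ofPath_ne, mul_zero]
    intro e
    exact h (congrArg (fun s : Σ (x : V) (y : V), Quiver.Path x y => s.2.1) e)

lemma convMul_coord_nil_ne {x y z : V} (p : Quiver.Path x y) (h : z ≠ y) :
    convMul Coalgebra.comul (coord k (.nil : Quiver.Path z z)) (coord k p) = 0 := by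
  refine hom_ext fun x' w q => ?_
  rw [convMul_apply_ofPath (coord_nil_comp_projZero _)]
  by_cases h' : w = y
  · subst h'
    rw [coord_nil_vertex_ne (Ne.symm h), zero_mul]; rfl
  · rw [coord_ofPath_ne, mul_zero]
    · rfl
    intro e
    exact h' (congrArg (fun s : Σ (x : V) (y : V), Quiver.Path x y => s.2.1) e)

end Coord

end PathCoalg

/-! ### Coalgebra maps into the path coalgebra -/

namespace PathCoalg

section Cofree

variable {k : Type u} [Field k] {V : Type v} [Quiver.{w} V]

lemma tensor_ext_coord {t t' : PathCoalg k V ⊗[k] PathCoalg k V}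
    (H : ∀ (x y : V) (p : Quiver.Path x y) (x' y' : V) (q : Quiver.Path x' y'),
      TensorProduct.lid k k (TensorProduct.map (coord k p) (coord k q) t) =
        TensorProduct.lid k k (TensorProduct.map (coord k p) (coord k q) t')) : t = t' := by
  apply ((pathBasis k V).tensorProduct (pathBasis k V)).ext_elem
  rintro ⟨⟨x, y, p⟩, ⟨x', y', q⟩⟩
  have key : ∀ t, ((pathBasis k V).tensorProduct (pathBasis k V)).repr t
      (⟨x, y, p⟩, ⟨x', y', q⟩) =
        TensorProduct.lid k k (TensorProduct.map (coord k p) (coord k q) t) := by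
    intro t
    induction t with
    | zero => simp
    | add s t hs ht => simp only [map_add, Finsupp.add_apply, hs, ht]
    | tmul u v => simp [coord, Module.Basis.tensorProduct_repr_tmul_apply, mul_comm]
  rw [key, key, H]

variable {C : Type*} [AddCommGroup C] [Module k C] {Δ : C →ₗ[k] C ⊗[k] C}

/-- A map into the path coalgebra which respects comultiplications is determined by its components
in the degrees zero and one. -/
theorem comulHom_ext {F F' : C →ₗ[k] PathCoalg k V}
    (hF : Coalgebra.comul ∘ₗ F = TensorProduct.map F F ∘ₗ Δ)
    (hF' : Coalgebra.comul ∘ₗ F' = TensorProduct.map F' F' ∘ₗ Δ)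
    (h0 : ∀ x : V, coord k (.nil : Quiver.Path x x) ∘ₗ F = coord k (.nil : Quiver.Path x x) ∘ₗ F')
    (h1 : ∀ (x y : V) (a : x ⟶ y), coord k a.toPath ∘ₗ F = coord k a.toPath ∘ₗ F') : F = F' := by
  refine hom_ext_coord fun x y p => ?_
  induction p with
  | nil => exact h0 x
  | cons p a ih => rw [coord_cons, convMul_comp hF, convMul_comp hF', h1, ih]

/-- A family of functionals, indexed by paths, that behaves like the coordinates. -/
lemma convMul_path (hΔ : IsCoassoc Δ) {N : ∀ {x y : V}, Quiver.Path x y → (C →ₗ[k] k)}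
    (hcons : ∀ {x y z : V} (p : Quiver.Path x y) (a : y ⟶ z),
      N (p.cons a) = convMul Δ (N a.toPath) (N p))
    (hnil : ∀ {x y : V} (p : Quiver.Path x y),
      convMul Δ (N (.nil : Quiver.Path y y)) (N p) = N p)
    {x y z : V} (p : Quiver.Path y z) (q : Quiver.Path x y) :
    convMul Δ (N p) (N q) = N (q.comp p) := by
  induction p with
  | nil => exact hnil q
  | cons p a ih => rw [hcons, convMul_assoc hΔ, ih, Quiver.Path.comp_cons, hcons]

lemma convMul_path_ne (hΔ : IsCoassoc Δ) {N : ∀ {x y : V}, Quiver.Path x y → (C →ₗ[k] k)}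
    (hcons : ∀ {x y z : V} (p : Quiver.Path x y) (a : y ⟶ z),
      N (p.cons a) = convMul Δ (N a.toPath) (N p))
    (hnil : ∀ {x y z : V} (p : Quiver.Path x y), z ≠ y →
      convMul Δ (N (.nil : Quiver.Path z z)) (N p) = 0)
    {x y y' z : V} (p : Quiver.Path y z) (q : Quiver.Path x y') (h : y ≠ y') :
    convMul Δ (N p) (N q) = 0 := by
  induction p with
  | nil => exact hnil q h
  | cons p a ih => rw [hcons, convMul_assoc hΔ, ih, convMul_zero]

/-- A linear map whose coordinates multiply like the coordinates of the path coalgebra respects the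
comultiplications. -/
lemma comul_comp_of_coord (hΔ : IsCoassoc Δ) {F : C →ₗ[k] PathCoalg k V}
    (hcons : ∀ {x y z : V} (p : Quiver.Path x y) (a : y ⟶ z),
      coord k (p.cons a) ∘ₗ F = convMul Δ (coord k a.toPath ∘ₗ F) (coord k p ∘ₗ F))
    (hnil : ∀ {x y : V} (p : Quiver.Path x y),
      convMul Δ (coord k (.nil : Quiver.Path y y) ∘ₗ F) (coord k p ∘ₗ F) = coord k p ∘ₗ F)
    (hnil' : ∀ {x y z : V} (p : Quiver.Path x y), z ≠ y →
      convMul Δ (coord k (.nil : Quiver.Path z z) ∘ₗ F) (coord k p ∘ₗ F) = 0) :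
    Coalgebra.comul ∘ₗ F = TensorProduct.map F F ∘ₗ Δ := by
  ext c
  apply tensor_ext_coord
  intro x y p x' y' q
  have h : convMul Coalgebra.comul (coord k p) (coord k q) ∘ₗ F =
      convMul Δ (coord k p ∘ₗ F) (coord k q ∘ₗ F) := by
    by_cases h : x = y'
    · subst h
      rw [convMul_path (N := fun p => coord k p ∘ₗ F) hΔ hcons hnil,
        convMul_path (N := fun p => coord k p) isCoassoc_comul coord_cons convMul_coord_nil_self]
    · rw [convMul_path_ne (N := fun p => coord k p ∘ₗ F) hΔ hcons hnil' _ _ h,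
        convMul_path_ne (N := fun p => coord k p) isCoassoc_comul coord_cons
          convMul_coord_nil_ne _ _ h, LinearMap.zero_comp]
  have h := LinearMap.congr_fun h c
  rw [LinearMap.comp_apply, convMul_apply, convMul_apply] at h
  rw [LinearMap.comp_apply, h, TensorProduct.map_comp]
  rfl

variable (k V) in
/-- The bilinear map which sends an arrow `a` and a path `p` to the path `p` followed by `a`, if it
exists, and to zero otherwise. It vanishes on the other pairs of paths. -/
def consMap : PathCoalg k V →ₗ[k] PathCoalg k V →ₗ[k] PathCoalg k V :=
  (pathBasis k V).constr k fun p =>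
    match p with
    | ⟨_, _, .cons .nil a⟩ => appendArrow k a
    | _ => 0

lemma consMap_arrow {x y : V} (a : x ⟶ y) :
    consMap k V (ofPath k a.toPath) = appendArrow k a := by
  rw [consMap, ofPath, Module.Basis.constr_basis]
  rfl

lemma consMap_nil (x : V) :
    consMap k V (ofPath k (.nil : Quiver.Path x x)) = 0 := by
  rw [consMap, ofPath, Module.Basis.constr_basis]

lemma consMap_cons_cons {x y z w : V} (p : Quiver.Path x y) (a : y ⟶ z) (b : z ⟶ w) :
    consMap k V (ofPath k ((p.cons a).cons b)) = 0 := by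
  rw [consMap, ofPath, Module.Basis.constr_basis]

lemma coord_cons_consMap {x y z : V} (p : Quiver.Path x y) (a : y ⟶ z) (m h : PathCoalg k V) :
    coord k (p.cons a) (consMap k V m h) = coord k a.toPath m * coord k p h := by
  have key : (coord k (p.cons a)).compRight k ∘ₗ consMap k V =
      (LinearMap.toSpanSingleton k _ (coord k p)) ∘ₗ coord k a.toPath := by
    refine hom_ext fun x' w q => ?_
    match q with
    | .nil =>
      rw [LinearMap.comp_apply, LinearMap.comp_apply, consMap_nil, map_zero,
        coord_ofPath_of_length_ne _ _ _ (by simp), map_zero]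
    | .cons (.cons q b) d =>
      rw [LinearMap.comp_apply, LinearMap.comp_apply, consMap_cons_cons, map_zero,
        coord_ofPath_of_length_ne _ _ _ (by simp), map_zero]
    | .cons .nil b =>
      change coord k (p.cons a) ∘ₗ consMap k V (ofPath k b.toPath) =
        coord k a.toPath (ofPath k b.toPath) • coord k p
      rw [consMap_arrow]
      by_cases h : (⟨x', w, b⟩ : Σ (x : V) (y : V), x ⟶ y) = ⟨y, z, a⟩
      · simp only [Sigma.mk.injEq] at h
        obtain ⟨rfl, h⟩ := h
        simp only [heq_eq_eq, Sigma.mk.injEq] at h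
        obtain ⟨rfl, h⟩ := h
        simp only [heq_eq_eq] at h
        subst h
        rw [coord_cons_comp_appendArrow_self, coord_ofPath_self, one_smul]
      · rw [coord_cons_comp_appendArrow_ne _ _ _ h, coord_ofPath_ne, zero_smul]
        intro e
        apply h
        simp only [Sigma.mk.injEq] at e
        obtain ⟨rfl, e⟩ := e
        simp only [heq_eq_eq, Sigma.mk.injEq] at e
        obtain ⟨rfl, e⟩ := e
        simp only [heq_eq_eq, Quiver.Hom.toPath, Quiver.Path.cons.injEq, true_and] at e
        rw [e]
  exact LinearMap.congr_fun (LinearMap.congr_fun key m) h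

lemma coord_nil_consMap (x : V) (m h : PathCoalg k V) :
    coord k (.nil : Quiver.Path x x) (consMap k V m h) = 0 := by
  have key : (coord k (.nil : Quiver.Path x x)).compRight k ∘ₗ consMap k V = 0 := by
    refine hom_ext fun x' w q => ?_
    match q with
    | .nil => rw [LinearMap.comp_apply, consMap_nil, map_zero]; rfl
    | .cons (.cons q b) d => rw [LinearMap.comp_apply, consMap_cons_cons, map_zero]; rfl
    | .cons .nil b =>
      refine hom_ext fun x'' w'' r => ?_
      change coord k (.nil : Quiver.Path x x) (consMap k V (ofPath k b.toPath) (ofPath k r)) = 0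
      rw [consMap_arrow]
      by_cases h : w'' = x'
      · subst h
        rw [appendArrow_ofPath, coord_ofPath_of_length_ne _ _ _ (by simp)]
      · rw [appendArrow_ofPath_ne _ _ _ h, map_zero]
  exact LinearMap.congr_fun (LinearMap.congr_fun key m) h

/-- The coordinates of the map into the path coalgebra with given components `f₀` and `f₁` in the
degrees zero and one. -/
def pathFunctional (Δ : C →ₗ[k] C ⊗[k] C) (f₀ f₁ : C →ₗ[k] PathCoalg k V) :
    ∀ {x y : V}, Quiver.Path x y → (C →ₗ[k] k)
  | x, _, .nil => coord k (.nil : Quiver.Path x x) ∘ₗ f₀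
  | _, _, .cons p a => convMul Δ (coord k a.toPath ∘ₗ f₁) (pathFunctional Δ f₀ f₁ p)

/-- The part of degree `n` of the map into the path coalgebra with given components `f₀` and `f₁`
in the degrees zero and one. -/
def gradedPart (Δ : C →ₗ[k] C ⊗[k] C) (f₀ f₁ : C →ₗ[k] PathCoalg k V) :
    ℕ → (C →ₗ[k] PathCoalg k V)
  | 0 => f₀
  | n + 1 => TensorProduct.lift (consMap k V) ∘ₗ TensorProduct.map f₁ (gradedPart Δ f₀ f₁ n) ∘ₗ Δ

lemma coord_gradedPart {f₀ f₁ : C →ₗ[k] PathCoalg k V}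
    (h₀ : ∀ {x y : V} (p : Quiver.Path x y), p.length ≠ 0 → coord k p ∘ₗ f₀ = 0)
    {x y : V} (p : Quiver.Path x y) (n : ℕ) :
    coord k p ∘ₗ gradedPart Δ f₀ f₁ n =
      if p.length = n then pathFunctional Δ f₀ f₁ p else 0 := by
  induction p generalizing n with
  | nil =>
    cases n with
    | zero => simp [gradedPart, pathFunctional]
    | succ n =>
      ext c
      simp only [gradedPart, LinearMap.comp_apply]
      generalize Δ c = t
      induction t with
      | zero => simp
      | add s t hs ht => simp_all [map_add]
      | tmul u v => simp [coord_nil_consMap]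
  | cons p a ih =>
    cases n with
    | zero =>
      simp only [gradedPart, Quiver.Path.length_cons, Nat.add_eq_zero_iff, one_ne_zero, and_false,
        if_false]
      exact h₀ _ (by simp)
    | succ n =>
      have : coord k (p.cons a) ∘ₗ gradedPart Δ f₀ f₁ (n + 1) =
          convMul Δ (coord k a.toPath ∘ₗ f₁) (coord k p ∘ₗ gradedPart Δ f₀ f₁ n) := by
        ext c
        simp only [gradedPart, LinearMap.comp_apply, convMul_apply]
        generalize Δ c = t
        induction t with
        | zero => simp
        | add s t hs ht => simp_all [map_add]
        | tmul u v => simp [coord_cons_consMap]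
      rw [this, ih]
      simp only [Quiver.Path.length_cons, Nat.add_right_cancel_iff, pathFunctional]
      split_ifs
      · rfl
      · rw [convMul_zero]

lemma mem_degree_iff {n : ℕ} {h : PathCoalg k V} :
    h ∈ degree k V n ↔ ∀ (x y : V) (p : Quiver.Path x y), p.length ≠ n → coord k p h = 0 := by
  constructor
  · intro hh x y p hp
    induction hh using Submodule.span_induction with
    | mem m hm =>
      obtain ⟨x', y', q, hq, rfl⟩ := hm
      exact coord_ofPath_of_length_ne _ _ _ (by omega)
    | zero => simp
    | add a b _ _ ha hb => rw [map_add, ha, hb, add_zero]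
    | smul c a _ ha => rw [map_smul, ha, smul_zero]
  · intro hh
    rw [← (pathBasis k V).linearCombination_repr h, Finsupp.linearCombination_apply, Finsupp.sum]
    refine Submodule.sum_mem _ fun ⟨x, y, p⟩ hp => Submodule.smul_mem _ _
      (Submodule.subset_span ⟨x, y, p, ?_, rfl⟩)
    by_contra hl
    exact Finsupp.mem_support_iff.mp hp (hh x y p hl)

lemma ofPath_mem_degree {x y : V} (p : Quiver.Path x y) : ofPath k p ∈ degree k V p.length :=
  Submodule.subset_span ⟨x, y, p, rfl, rfl⟩

/-- A comultiplication is graded, where the degrees are those of the elements of a basis. -/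
def IsGradedComul {ι : Type*} (Δ : C →ₗ[k] C ⊗[k] C) (b : Module.Basis ι k C) (deg : ι → ℕ) : Prop :=
  ∀ i, Δ (b i) ∈ Submodule.span k {t | ∃ j l, deg j + deg l = deg i ∧ t = b j ⊗ₜ[k] b l}

lemma IsGradedComul.convMul_eq_zero {ι : Type*} {b : Module.Basis ι k C} {deg : ι → ℕ}
    (h : IsGradedComul Δ b deg) {φ ψ : C →ₗ[k] k} {m n : ℕ}
    (hφ : ∀ i, deg i ≠ m → φ (b i) = 0) (hψ : ∀ i, deg i ≠ n → ψ (b i) = 0) (i : ι)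
    (hi : deg i ≠ m + n) : convMul Δ φ ψ (b i) = 0 := by
  rw [convMul_apply]
  have := h i
  generalize Δ (b i) = t at this
  induction this using Submodule.span_induction with
  | mem t ht =>
    obtain ⟨j, l, hjl, rfl⟩ := ht
    rw [TensorProduct.map_tmul]
    by_cases hj : deg j = m
    · rw [hψ l (by omega)]; simp
    · rw [hφ j hj]; simp
  | zero => simp
  | add a b _ _ ha hb => rw [map_add, map_add, ha, hb, add_zero]
  | smul c a _ ha => rw [map_smul, map_smul, ha, smul_zero]

/-- The universal property of the path coalgebra, for a graded coalgebra: compatible components in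
degree zero and one extend to a graded map which respects the comultiplications. The hypotheses
`h₀₀`, `h₀₁` and `h₁₀` say that the component `f₀` respects the comultiplications, and that `f₁` is
a map of bicomodules along it. -/
theorem exists_comulHom (hΔ : IsCoassoc Δ) {ι : Type*} {b : Module.Basis ι k C} {deg : ι → ℕ}
    (hb : IsGradedComul Δ b deg) (f₀ f₁ : C →ₗ[k] PathCoalg k V)
    (hf₀ : ∀ {x y : V} (p : Quiver.Path x y), p.length ≠ 0 → coord k p ∘ₗ f₀ = 0)
    (hf₀' : ∀ i, deg i ≠ 0 → f₀ (b i) = 0)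
    (hf₁ : ∀ i, deg i ≠ 1 → f₁ (b i) = 0)
    (h₀₀ : ∀ x : V, convMul Δ (coord k (.nil : Quiver.Path x x) ∘ₗ f₀)
      (coord k (.nil : Quiver.Path x x) ∘ₗ f₀) = coord k (.nil : Quiver.Path x x) ∘ₗ f₀)
    (h₀₀' : ∀ x y : V, x ≠ y → convMul Δ (coord k (.nil : Quiver.Path x x) ∘ₗ f₀)
      (coord k (.nil : Quiver.Path y y) ∘ₗ f₀) = 0)
    (h₀₁ : ∀ {x y : V} (a : x ⟶ y), convMul Δ (coord k (.nil : Quiver.Path y y) ∘ₗ f₀)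
      (coord k a.toPath ∘ₗ f₁) = coord k a.toPath ∘ₗ f₁)
    (h₀₁' : ∀ {x y z : V} (a : x ⟶ y), z ≠ y → convMul Δ (coord k (.nil : Quiver.Path z z) ∘ₗ f₀)
      (coord k a.toPath ∘ₗ f₁) = 0)
    (h₁₀ : ∀ {x y : V} (a : x ⟶ y), convMul Δ (coord k a.toPath ∘ₗ f₁)
      (coord k (.nil : Quiver.Path x x) ∘ₗ f₀) = coord k a.toPath ∘ₗ f₁) :
    ∃ F : C →ₗ[k] PathCoalg k V, Coalgebra.comul ∘ₗ F = TensorProduct.map F F ∘ₗ Δ ∧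
      (∀ x : V, coord k (.nil : Quiver.Path x x) ∘ₗ F = coord k (.nil : Quiver.Path x x) ∘ₗ f₀) ∧
      (∀ (x y : V) (a : x ⟶ y), coord k a.toPath ∘ₗ F = coord k a.toPath ∘ₗ f₁) ∧
      ∀ i, F (b i) ∈ degree k V (deg i) := by
  set N : ∀ {x y : V}, Quiver.Path x y → (C →ₗ[k] k) := fun p => pathFunctional Δ f₀ f₁ p
  have hN0 : ∀ x, N (.nil : Quiver.Path x x) = coord k (.nil : Quiver.Path x x) ∘ₗ f₀ :=
    fun x => by simp only [N, pathFunctional]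
  have hN1 : ∀ (x y : V) (a : x ⟶ y), N a.toPath = coord k a.toPath ∘ₗ f₁ := by
    intro x y a
    simp only [N, pathFunctional, Quiver.Hom.toPath]
    exact h₁₀ a
  have hNc : ∀ {x y z : V} (p : Quiver.Path x y) (a : y ⟶ z),
      N (p.cons a) = convMul Δ (N a.toPath) (N p) := by
    intro x y z p a
    rw [hN1]
    simp only [N, pathFunctional]
  have hdeg : ∀ {x y : V} (p : Quiver.Path x y) (i : ι), deg i ≠ p.length → N p (b i) = 0 := by
    intro x y p
    induction p with
    | nil => intro i hi; rw [hN0, LinearMap.comp_apply, hf₀' i hi, map_zero]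
    | cons p a ih =>
      intro i hi
      rw [hNc]
      refine hb.convMul_eq_zero (m := 1) (n := p.length) ?_ ih i ?_
      · intro j hj
        rw [hN1, LinearMap.comp_apply, hf₁ j hj, map_zero]
      · rw [Quiver.Path.length_cons] at hi; omega
  -- The image of a basis element of degree `n` is the combination of the paths of length `n` with
  -- the values of `N` as coefficients, so that the coordinates of the map are the functionals `N p`.
  refine ⟨b.constr k fun i => gradedPart Δ f₀ f₁ (deg i) (b i), ?_⟩
  set F := b.constr k fun i => gradedPart Δ f₀ f₁ (deg i) (b i) with hF
  have hFN : ∀ {x y : V} (p : Quiver.Path x y), coord k p ∘ₗ F = N p := by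
    intro x y p
    refine b.ext fun i => ?_
    have := LinearMap.congr_fun (coord_gradedPart (Δ := Δ) (f₁ := f₁) hf₀ p (deg i)) (b i)
    rw [LinearMap.comp_apply] at this
    rw [LinearMap.comp_apply, hF, Module.Basis.constr_basis, this]
    split_ifs with h
    · rfl
    · rw [hdeg p i (Ne.symm h)]; rfl
  refine ⟨comul_comp_of_coord hΔ ?_ ?_ ?_, ?_, ?_, ?_⟩
  · intro x y z p a
    rw [hFN, hFN, hFN, hNc]
  · intro x y p
    rw [hFN, hFN]
    cases p with
    | nil => rw [hN0]; exact h₀₀ x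
    | cons p a => rw [hNc, ← convMul_assoc hΔ, hN0, hN1, h₀₁]
  · intro x y z p h
    rw [hFN, hFN]
    cases p with
    | nil => rw [hN0, hN0]; exact h₀₀' z x h
    | cons p a => rw [hNc, ← convMul_assoc hΔ, hN0, hN1, h₀₁' a h, zero_convMul]
  · intro x; rw [hFN, hN0]
  · intro x y a; rw [hFN, hN1]
  · intro i
    rw [mem_degree_iff]
    intro x y p hp
    rw [← LinearMap.comp_apply, hFN, hdeg p i (Ne.symm hp)]

lemma cuts_length {x y : V} (p : Quiver.Path x y) :
    ∀ c ∈ cuts p, c.2.1.length + c.2.2.length = p.length := by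
  induction p with
  | nil => simp [cuts]
  | cons p a ih =>
    intro c hc
    simp only [cuts, List.mem_cons, List.mem_map] at hc
    rcases hc with rfl | ⟨c', hc', rfl⟩
    · simp
    · have := ih c' hc'
      simp only [Quiver.Path.length_cons]
      omega

variable (k V) in
lemma isGradedComul_comul : IsGradedComul (Coalgebra.comul : PathCoalg k V →ₗ[k] _)
    (pathBasis k V) fun p => p.2.2.length := by
  rintro ⟨x, y, p⟩
  change comulMap k V (ofPath k p) ∈ _
  rw [comulMap_ofPath]
  refine list_sum_mem fun t ht => ?_
  obtain ⟨c, hc, rfl⟩ := List.mem_map.mp ht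
  exact Submodule.subset_span ⟨⟨_, _, c.2.1⟩, ⟨_, _, c.2.2⟩, cuts_length p c hc, rfl⟩

lemma IsGradedComul.comm {ι : Type*} {b : Module.Basis ι k C} {deg : ι → ℕ}
    (h : IsGradedComul Δ b deg) :
    IsGradedComul ((TensorProduct.comm k C C).toLinearMap ∘ₗ Δ) b deg := by
  intro i
  have := Submodule.mem_map_of_mem (f := (TensorProduct.comm k C C).toLinearMap) (h i)
  rw [Submodule.map_span] at this
  refine Submodule.span_mono ?_ this
  rintro _ ⟨_, ⟨j, l, hjl, rfl⟩, rfl⟩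
  exact ⟨l, j, by omega, by simp⟩

lemma IsGradedComul.tensorProduct {C D : Type*} [AddCommGroup C] [Module k C] [Coalgebra k C]
    [AddCommGroup D] [Module k D] [Coalgebra k D] {ι κ : Type*} {b : Module.Basis ι k C}
    {b' : Module.Basis κ k D} {deg : ι → ℕ} {deg' : κ → ℕ}
    (h : IsGradedComul Coalgebra.comul b deg) (h' : IsGradedComul Coalgebra.comul b' deg') :
    IsGradedComul Coalgebra.comul (b.tensorProduct b') fun i => deg i.1 + deg' i.2 := by
  rintro ⟨i, i'⟩
  rw [Module.Basis.tensorProduct_apply, TensorProduct.comul_tmul]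
  have h := h i
  have h' := h' i'
  generalize (Coalgebra.comul (R := k) (b i)) = t at h ⊢
  generalize (Coalgebra.comul (R := k) (b' i')) = t' at h' ⊢
  induction h using Submodule.span_induction with
  | mem t ht =>
    obtain ⟨j, l, hjl, rfl⟩ := ht
    induction h' using Submodule.span_induction with
    | mem t ht =>
      obtain ⟨j', l', hjl', rfl⟩ := ht
      refine Submodule.subset_span ⟨(j, j'), (l, l'), ?_, ?_⟩
      · simp only; omega
      · simp
    | zero => simp
    | add s t _ _ hs ht => rw [TensorProduct.tmul_add, map_add]; exact add_mem hs ht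
    | smul c s _ hs =>
      rw [TensorProduct.tmul_smul, map_smul]; exact Submodule.smul_mem _ _ hs
  | zero => simp
  | add s t _ _ hs ht => rw [TensorProduct.add_tmul, map_add]; exact add_mem hs ht
  | smul c s _ hs =>
    rw [← TensorProduct.smul_tmul', map_smul]; exact Submodule.smul_mem _ _ hs

lemma hom_ext_tensor {X : Type*} [AddCommGroup X] [Module k X]
    {f g : PathCoalg k V ⊗[k] PathCoalg k V →ₗ[k] X}
    (H : ∀ (x y : V) (p : Quiver.Path x y) (x' y' : V) (q : Quiver.Path x' y'),
      f (ofPath k p ⊗ₜ ofPath k q) = g (ofPath k p ⊗ₜ ofPath k q)) : f = g := by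
  refine TensorProduct.ext (hom_ext fun x y p => hom_ext fun x' y' q => ?_)
  exact H x y p x' y' q

end Cofree

end PathCoalg

namespace PathCoalg

/-! ### Parts of low degree and coactions -/

section LowDegree

variable {k : Type u} [Field k] {V : Type v} [Quiver.{w} V]

variable (k) in
/-- The linear map which takes given values on the vertices and vanishes in positive degrees. -/
def onVertices {X : Type*} [AddCommGroup X] [Module k X] (f : V → X) : PathCoalg k V →ₗ[k] X :=
  (pathBasis k V).constr k fun p => if p.2.2.length = 0 then f p.1 else 0

@[simp] lemma onVertices_vertex {X : Type*} [AddCommGroup X] [Module k X] (f : V → X) (x : V) :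
    onVertices k f (vertex k x) = f x := by
  rw [onVertices, vertex, ofPath, Module.Basis.constr_basis]
  simp

lemma onVertices_ofPath {X : Type*} [AddCommGroup X] [Module k X] (f : V → X) {x y : V}
    (p : Quiver.Path x y) (hp : p.length ≠ 0) : onVertices k f (ofPath k p) = 0 := by
  rw [onVertices, ofPath, Module.Basis.constr_basis]
  simp [hp]

lemma projZero_ofPath_eq_zero {x y : V} (p : Quiver.Path x y) (hp : p.length ≠ 0) :
    projZero k V (ofPath k p) = 0 := by
  rw [projZero_ofPath, if_neg hp]

/-- Paths of length zero are vertices. -/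
lemma ofPath_cases {motive : ∀ {x y : V}, Quiver.Path x y → Prop}
    (nil : ∀ x, motive (.nil : Quiver.Path x x))
    (pos : ∀ {x y : V} (p : Quiver.Path x y), p.length ≠ 0 → motive p)
    {x y : V} (p : Quiver.Path x y) : motive p := by
  cases p with
  | nil => exact nil x
  | cons p a => exact pos _ (by simp)

/-- Paths of length one are arrows. -/
lemma ofPath_cases_one {motive : ∀ {x y : V}, Quiver.Path x y → Prop}
    (arrow : ∀ {x y : V} (a : x ⟶ y), motive a.toPath)
    (ne : ∀ {x y : V} (p : Quiver.Path x y), p.length ≠ 1 → motive p)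
    {x y : V} (p : Quiver.Path x y) : motive p := by
  cases p with
  | nil => exact ne _ (by simp)
  | cons p a =>
    cases p with
    | nil => exact arrow a
    | cons p b => exact ne _ (by simp)

lemma onVertices_comp_projZero {X : Type*} [AddCommGroup X] [Module k X] (f : V → X) :
    onVertices k f ∘ₗ projZero k V = onVertices k f := by
  refine hom_ext fun x y p => ?_
  rw [LinearMap.comp_apply, projZero_ofPath]
  split_ifs with h
  · rfl
  · rw [onVertices_ofPath f p h, map_zero]

lemma onVertices_projZero {X : Type*} [AddCommGroup X] [Module k X] (f : V → X)
    (h : PathCoalg k V) : onVertices k f (projZero k V h) = onVertices k f h :=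
  LinearMap.congr_fun (onVertices_comp_projZero f) h

lemma counit_eq_onVertices : (Coalgebra.counit : PathCoalg k V →ₗ[k] k) =
    onVertices k fun _ => 1 := by
  refine hom_ext fun x y p => ?_
  rw [counit_eq, counitMap, ofPath, Module.Basis.constr_basis, onVertices,
    Module.Basis.constr_basis]

lemma counit_projZero (h : PathCoalg k V) :
    Coalgebra.counit (R := k) (projZero k V h) = Coalgebra.counit (R := k) h := by
  rw [counit_eq_onVertices, onVertices_projZero]

variable (k V) in
/-- The projection onto the part of degree one. -/
def projOne : PathCoalg k V →ₗ[k] PathCoalg k V :=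
  (pathBasis k V).constr k fun p => if p.2.2.length = 1 then ofPath k p.2.2 else 0

lemma projOne_ofPath {x y : V} (p : Quiver.Path x y) :
    projOne k V (ofPath k p) = if p.length = 1 then ofPath k p else 0 := by
  rw [projOne, ofPath, Module.Basis.constr_basis]
  rfl

lemma projOne_of_mem {h : PathCoalg k V} (hh : h ∈ degree k V 1) : projOne k V h = h := by
  induction hh using Submodule.span_induction with
  | mem m hm =>
    obtain ⟨x, y, p, hp, rfl⟩ := hm
    rw [projOne_ofPath, if_pos hp]
  | zero => simp
  | add a b _ _ ha hb => rw [map_add, ha, hb]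
  | smul c a _ ha => rw [map_smul, ha]

lemma projZero_of_mem_one {h : PathCoalg k V} {n : ℕ} (hh : h ∈ degree k V n) (hn : n ≠ 0) :
    projZero k V h = 0 := by
  induction hh using Submodule.span_induction with
  | mem m hm =>
    obtain ⟨x, y, p, hp, rfl⟩ := hm
    rw [projZero_ofPath, if_neg (by omega)]
  | zero => simp
  | add a b _ _ ha hb => rw [map_add, ha, hb, add_zero]
  | smul c a _ ha => rw [map_smul, ha, smul_zero]

lemma vertex_mem_degree (x : V) : vertex k x ∈ degree k V 0 :=
  ofPath_mem_degree (.nil : Quiver.Path x x)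

lemma arrow_mem_degree {x y : V} (a : x ⟶ y) : ofPath k a.toPath ∈ degree k V 1 :=
  ofPath_mem_degree a.toPath

lemma eq_of_mem_degree_one {h h' : PathCoalg k V} (hh : h ∈ degree k V 1)
    (hh' : h' ∈ degree k V 1)
    (H : ∀ (x y : V) (a : x ⟶ y), coord k a.toPath h = coord k a.toPath h') : h = h' := by
  refine ext_coord fun x y p => ?_
  induction p using ofPath_cases_one with
  | arrow a => exact H _ _ a
  | ne p hp => rw [mem_degree_iff.mp hh _ _ _ hp, mem_degree_iff.mp hh' _ _ _ hp]

lemma eq_of_mem_degree_zero {h h' : PathCoalg k V} (hh : h ∈ degree k V 0)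
    (hh' : h' ∈ degree k V 0)
    (H : ∀ x : V, coord k (.nil : Quiver.Path x x) h = coord k (.nil : Quiver.Path x x) h') :
    h = h' := by
  refine ext_coord fun x y p => ?_
  cases p with
  | nil => exact H x
  | cons p a =>
    rw [mem_degree_iff.mp hh _ _ _ (by simp), mem_degree_iff.mp hh' _ _ _ (by simp)]

lemma coord_nil_of_mem {h : PathCoalg k V} {n : ℕ} (hh : h ∈ degree k V n) (hn : n ≠ 0) (x : V) :
    coord k (.nil : Quiver.Path x x) h = 0 :=
  mem_degree_iff.mp hh _ _ _ (by simpa using Ne.symm hn)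

lemma coord_arrow_of_mem {h : PathCoalg k V} {n : ℕ} (hh : h ∈ degree k V n) (hn : n ≠ 1)
    {x y : V} (a : x ⟶ y) : coord k a.toPath h = 0 :=
  mem_degree_iff.mp hh _ _ _ (by simpa using Ne.symm hn)

end LowDegree

end PathCoalg

section Coaction

variable {k : Type u} [Field k] {C : Type*} [AddCommGroup C] [Module k C] [Coalgebra k C]
  {D : Type*} [AddCommGroup D] [Module k D] [Coalgebra k D]

/-- The left coaction, given by the projection `P` onto a subcoalgebra, sends `c` to `g ⊗ c`. -/
def IsLeftCoact (P : C →ₗ[k] C) (c g : C) : Prop :=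
  P.rTensor C (Coalgebra.comul (R := k) c) = g ⊗ₜ c

/-- The right coaction, given by the projection `P` onto a subcoalgebra, sends `c` to `c ⊗ g`. -/
def IsRightCoact (P : C →ₗ[k] C) (c g : C) : Prop :=
  P.lTensor C (Coalgebra.comul (R := k) c) = c ⊗ₜ g

lemma IsLeftCoact.tmul {P : C →ₗ[k] C} {P' : D →ₗ[k] D} {c g : C} {c' g' : D}
    (h : IsLeftCoact P c g) (h' : IsLeftCoact P' c' g') :
    IsLeftCoact (TensorProduct.map P P') (c ⊗ₜ c') (g ⊗ₜ g') := by
  unfold IsLeftCoact at *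
  rw [TensorProduct.comul_tmul]
  have key : ∀ (s : C ⊗[k] C) (t : D ⊗[k] D),
      (TensorProduct.map P P').rTensor _
        (TensorProduct.AlgebraTensorModule.tensorTensorTensorComm k k k k C C D D (s ⊗ₜ t)) =
      TensorProduct.AlgebraTensorModule.tensorTensorTensorComm k k k k C C D D
        (P.rTensor _ s ⊗ₜ P'.rTensor _ t) := by
    intro s t
    induction s with
    | zero => simp
    | add s s' hs hs' => simp only [TensorProduct.add_tmul, map_add, hs, hs']
    | tmul x y =>
      induction t with
      | zero => simp
      | add s s' hs hs' => simp only [TensorProduct.tmul_add, map_add, hs, hs']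
      | tmul x' y' => simp
  rw [key, h, h']
  simp

lemma IsRightCoact.tmul {P : C →ₗ[k] C} {P' : D →ₗ[k] D} {c g : C} {c' g' : D}
    (h : IsRightCoact P c g) (h' : IsRightCoact P' c' g') :
    IsRightCoact (TensorProduct.map P P') (c ⊗ₜ c') (g ⊗ₜ g') := by
  unfold IsRightCoact at *
  rw [TensorProduct.comul_tmul]
  have key : ∀ (s : C ⊗[k] C) (t : D ⊗[k] D),
      (TensorProduct.map P P').lTensor _
        (TensorProduct.AlgebraTensorModule.tensorTensorTensorComm k k k k C C D D (s ⊗ₜ t)) =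
      TensorProduct.AlgebraTensorModule.tensorTensorTensorComm k k k k C C D D
        (P.lTensor _ s ⊗ₜ P'.lTensor _ t) := by
    intro s t
    induction s with
    | zero => simp
    | add s s' hs hs' => simp only [TensorProduct.add_tmul, map_add, hs, hs']
    | tmul x y =>
      induction t with
      | zero => simp
      | add s s' hs hs' => simp only [TensorProduct.tmul_add, map_add, hs, hs']
      | tmul x' y' => simp
  rw [key, h, h']
  simp

lemma IsLeftCoact.lconv_apply {P : C →ₗ[k] C} {c g : C} (h : IsLeftCoact P c g) {φ : C →ₗ[k] k}
    (hφ : φ ∘ₗ P = φ) {X : Type*} [AddCommGroup X] [Module k X] (f : C →ₗ[k] X) :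
    lconv φ f c = φ g • f c := by
  have h1 : TensorProduct.map φ f = TensorProduct.map φ f ∘ₗ P.rTensor _ := by
    rw [LinearMap.rTensor, ← TensorProduct.map_comp, hφ, LinearMap.comp_id]
  rw [lconv, h1, LinearMap.comp_apply, LinearMap.comp_apply, LinearMap.comp_apply, h]
  simp

lemma IsRightCoact.rconv_apply {P : C →ₗ[k] C} {c g : C} (h : IsRightCoact P c g)
    {φ : C →ₗ[k] k} (hφ : φ ∘ₗ P = φ) {X : Type*} [AddCommGroup X] [Module k X]
    (f : C →ₗ[k] X) : rconv f φ c = φ g • f c := by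
  have h1 : TensorProduct.map f φ = TensorProduct.map f φ ∘ₗ P.lTensor _ := by
    rw [LinearMap.lTensor, ← TensorProduct.map_comp, hφ, LinearMap.comp_id]
  rw [rconv, h1, LinearMap.comp_apply, LinearMap.comp_apply, LinearMap.comp_apply, h]
  simp

lemma convMul_comm_comul (φ ψ : C →ₗ[k] k) :
    convMul ((TensorProduct.comm k C C).toLinearMap ∘ₗ Coalgebra.comul) φ ψ =
      convMul Coalgebra.comul ψ φ := by
  ext c
  simp only [convMul_apply, LinearMap.comp_apply]
  generalize (Coalgebra.comul (R := k) c) = t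
  induction t with
  | zero => simp
  | add s t hs ht => simp_all only [map_add]
  | tmul x y => simp [mul_comm]

end Coaction

/-! ### Isotypic components of the arrows -/

section Isotypic

open PathCoalg HopfQuiver

variable {k : Type u} [Field k] {G : Type v} [Group G] {R : ConjClasses G → ℕ}

/-- The vertex of the Hopf quiver given by a group element. -/
def HopfQuiver.of (R : ConjClasses G → ℕ) (g : G) : HopfQuiver R := g

/-- The group element given by a vertex of the Hopf quiver. -/
def HopfQuiver.val (x : HopfQuiver R) : G := x

lemma elt_val (x : HopfQuiver R) : elt k R x.val = vertex k x := rfl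

/-- The linear map which takes given values on the elements of `G` and vanishes in positive
degrees. -/
def onElts (k : Type u) [Field k] (R : ConjClasses G → ℕ) {X : Type*} [AddCommGroup X] [Module k X]
    (f : G → X) : PathCoalg k (HopfQuiver R) →ₗ[k] X :=
  onVertices k fun x : HopfQuiver R => f x.val

section OnElts

variable {X : Type*} [AddCommGroup X] [Module k X]

@[simp] lemma onElts_elt (f : G → X) (g : G) : onElts k R f (elt k R g) = f g :=
  onVertices_vertex _ _

lemma onElts_ofPath (f : G → X) {x y : HopfQuiver R} (p : Quiver.Path x y) (hp : p.length ≠ 0) :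
    onElts k R f (ofPath k p) = 0 :=
  onVertices_ofPath _ p hp

@[simp] lemma onElts_projZero (f : G → X) (h : PathCoalg k (HopfQuiver R)) :
    onElts k R f (projZero k (HopfQuiver R) h) = onElts k R f h :=
  onVertices_projZero _ h

lemma onElts_of_mem (f : G → X) {h : PathCoalg k (HopfQuiver R)} {n : ℕ}
    (hh : h ∈ degree k (HopfQuiver R) n) (hn : n ≠ 0) : onElts k R f h = 0 := by
  rw [← onElts_projZero, projZero_of_mem_one hh hn, map_zero]

end OnElts

lemma hom_ext_elt {X : Type*} [AddCommGroup X] [Module k X]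
    {f g : PathCoalg k (HopfQuiver R) →ₗ[k] X} (elt : ∀ h : G, f (elt k R h) = g (elt k R h))
    (pos : ∀ {x y : HopfQuiver R} (p : Quiver.Path x y), p.length ≠ 0 →
      f (ofPath k p) = g (ofPath k p)) : f = g := by
  refine hom_ext fun x y p => ?_
  induction p using ofPath_cases with
  | nil x => exact elt x.val
  | pos p hp => exact pos p hp

@[simp] lemma projZero_elt (g : G) : projZero k (HopfQuiver R) (elt k R g) = elt k R g :=
  projZero_vertex _

lemma elt_mem_degree (g : G) : elt k R g ∈ degree k (HopfQuiver R) 0 := vertex_mem_degree _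

lemma comul_elt (g : G) : Coalgebra.comul (R := k) (elt k R g) = elt k R g ⊗ₜ[k] elt k R g :=
  comul_vertex _

@[simp] lemma counit_elt (g : G) : Coalgebra.counit (R := k) (elt k R g) = 1 :=
  counit_vertex _

lemma isLeftCoact_path {x y : HopfQuiver R} (p : Quiver.Path x y) :
    IsLeftCoact (projZero k (HopfQuiver R)) (ofPath k p) (elt k R y.val) :=
  projZero_rTensor_comul p

lemma isRightCoact_path {x y : HopfQuiver R} (p : Quiver.Path x y) :
    IsRightCoact (projZero k (HopfQuiver R)) (ofPath k p) (elt k R x.val) :=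
  projZero_lTensor_comul p

lemma coord_nil_elt (x : HopfQuiver R) (g : G) [Decidable (x.val = g)] :
    coord k (.nil : Quiver.Path x x) (elt k R g) = if x.val = g then 1 else 0 := by
  split_ifs with h
  · subst h; exact coord_nil_vertex_self x
  · exact coord_nil_vertex_ne fun e => h e.symm

lemma comul_arrow {V : Type v} [Quiver.{w} V] {x y : V} (a : x ⟶ y) :
    Coalgebra.comul (R := k) (ofPath k a.toPath) =
      vertex k y ⊗ₜ ofPath k a.toPath + ofPath k a.toPath ⊗ₜ vertex k x := by
  rw [comul_eq]
  change comulMap k V (ofPath k (Quiver.Path.nil.cons a)) = _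
  rw [comulMap_cons, comulMap_nil, LinearMap.rTensor_tmul, vertex, vertex, appendArrow_ofPath]
  rfl

lemma mem_isotypic {g h : G} {m : PathCoalg k (HopfQuiver R)} :
    m ∈ isotypic k R g h ↔ m ∈ degree k (HopfQuiver R) 1 ∧
      Coalgebra.comul (R := k) m = elt k R g ⊗ₜ m + m ⊗ₜ elt k R h := by
  simp [isotypic, LinearMap.mem_eqLocus]

lemma arrow_mem_isotypic {x y : HopfQuiver R} (a : x ⟶ y) :
    ofPath k a.toPath ∈ isotypic k R y.val x.val :=
  mem_isotypic.mpr ⟨arrow_mem_degree a, comul_arrow a⟩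

lemma coord_of_mem_isotypic_left {g h : G} {m : PathCoalg k (HopfQuiver R)}
    (hm : m ∈ isotypic k R g h) {x y : HopfQuiver R} (a : x ⟶ y) (hy : y.val ≠ g) :
    coord k a.toPath m = 0 := by
  obtain ⟨h1, h2⟩ := mem_isotypic.mp hm
  classical
  rw [← convMul_coord_nil_self, convMul_apply, h2, map_add, TensorProduct.map_tmul,
    TensorProduct.map_tmul, coord_nil_elt, if_neg hy,
    coord_nil_of_mem h1 one_ne_zero]
  simp

lemma coord_of_mem_isotypic_right {g h : G} {m : PathCoalg k (HopfQuiver R)}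
    (hm : m ∈ isotypic k R g h) {x y : HopfQuiver R} (a : x ⟶ y) (hx : x.val ≠ h) :
    coord k a.toPath m = 0 := by
  obtain ⟨h1, h2⟩ := mem_isotypic.mp hm
  classical
  change coord k (Quiver.Path.nil.cons a) m = 0
  rw [coord_cons, convMul_apply, h2, map_add, TensorProduct.map_tmul,
    TensorProduct.map_tmul, coord_nil_elt, if_neg hx,
    coord_nil_of_mem h1 one_ne_zero]
  simp

/-- The isotypic component `ᵍMʰ` is spanned by the arrows from `h` to `g`. -/
lemma isotypic_eq_span (g h : G) : isotypic k R g h =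
    Submodule.span k (Set.range fun a : HopfQuiver.of R h ⟶ HopfQuiver.of R g =>
      ofPath k a.toPath) := by
  apply le_antisymm
  · intro m hm
    rw [← (pathBasis k (HopfQuiver R)).linearCombination_repr m, Finsupp.linearCombination_apply,
      Finsupp.sum]
    refine Submodule.sum_mem _ fun ⟨x, y, p⟩ hp => Submodule.smul_mem _ _ ?_
    have hp : coord k p m ≠ 0 := Finsupp.mem_support_iff.mp hp
    induction p using ofPath_cases_one with
    | ne p hl => exact absurd (mem_degree_iff.mp (mem_isotypic.mp hm).1 _ _ _ hl) hp
    | @arrow x y a =>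
      have hx : x.val = h := by
        by_contra hx
        exact hp (coord_of_mem_isotypic_right hm a hx)
      have hy : y.val = g := by
        by_contra hy
        exact hp (coord_of_mem_isotypic_left hm a hy)
      subst hx hy
      exact Submodule.subset_span ⟨a, rfl⟩
  · rw [Submodule.span_le]
    rintro _ ⟨a, rfl⟩
    exact arrow_mem_isotypic a

lemma isotypic_le_degree (g h : G) : isotypic k R g h ≤ degree k (HopfQuiver R) 1 :=
  inf_le_left

end Isotypic

/-! ### Products on the path coalgebra and bimodule structures on the arrows -/

open PathCoalg HopfQuiver

section Product

variable {k : Type u} [Field k] {G : Type v} [Group G] {R : ConjClasses G → ℕ}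

/-- A Majid bimodule structure over `(kG, Φ)` on the space `M = kQ₁` of arrows of the Hopf quiver:
actions of the elements of `G` on both sides, which are associative up to the factors given by `Φ`
and compatible with the coactions. The operators are defined on the whole path coalgebra, but only
their restrictions to the arrows matter. -/
structure ArrowBimodule (k : Type u) [Field k] {G : Type v} [Group G] (Φ : G → G → G → kˣ)
    (R : ConjClasses G → ℕ) where
  /-- The left action of `G`. -/
  l : G → PathCoalg k (HopfQuiver R) →ₗ[k] PathCoalg k (HopfQuiver R)
  /-- The right action of `G`. -/
  r : G → PathCoalg k (HopfQuiver R) →ₗ[k] PathCoalg k (HopfQuiver R)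
  l_mem : ∀ (e : G) {x y : G} {m : PathCoalg k (HopfQuiver R)}, m ∈ isotypic k R y x →
    l e m ∈ isotypic k R (e * y) (e * x)
  r_mem : ∀ (e : G) {x y : G} {m : PathCoalg k (HopfQuiver R)}, m ∈ isotypic k R y x →
    r e m ∈ isotypic k R (y * e) (x * e)
  l_one : ∀ {x y : G} {m : PathCoalg k (HopfQuiver R)}, m ∈ isotypic k R y x → l 1 m = m
  r_one : ∀ {x y : G} {m : PathCoalg k (HopfQuiver R)}, m ∈ isotypic k R y x → r 1 m = m
  l_l : ∀ (e f : G) {x y : G} {m : PathCoalg k (HopfQuiver R)}, m ∈ isotypic k R y x →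
    (Φ e f x : k) • l e (l f m) = (Φ e f y : k) • l (e * f) m
  l_r : ∀ (e f : G) {x y : G} {m : PathCoalg k (HopfQuiver R)}, m ∈ isotypic k R y x →
    (Φ e x f : k) • l e (r f m) = (Φ e y f : k) • r f (l e m)
  r_r : ∀ (e f : G) {x y : G} {m : PathCoalg k (HopfQuiver R)}, m ∈ isotypic k R y x →
    (Φ x e f : k) • r (e * f) m = (Φ y e f : k) • r f (r e m)

/-- The product `F` on the path coalgebra restricts to the product of `G` and to the given bimodule
structure on the arrows. -/
structure IsArrowProduct {Φ : G → G → G → kˣ} (B : ArrowBimodule k Φ R)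
    (F : PathCoalg k (HopfQuiver R) ⊗[k] PathCoalg k (HopfQuiver R) →ₗ[k]
      PathCoalg k (HopfQuiver R)) : Prop where
  comul : Coalgebra.comul ∘ₗ F = TensorProduct.map F F ∘ₗ Coalgebra.comul
  mul_mem : ∀ {i j : ℕ} {a b : PathCoalg k (HopfQuiver R)}, a ∈ degree k (HopfQuiver R) i →
    b ∈ degree k (HopfQuiver R) j → F (a ⊗ₜ b) ∈ degree k (HopfQuiver R) (i + j)
  elt_elt : ∀ g h : G, F (elt k R g ⊗ₜ elt k R h) = elt k R (g * h)
  elt_arrow : ∀ (g : G) {x y : G} {m : PathCoalg k (HopfQuiver R)}, m ∈ isotypic k R y x →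
    F (elt k R g ⊗ₜ m) = B.l g m
  arrow_elt : ∀ (g : G) {x y : G} {m : PathCoalg k (HopfQuiver R)}, m ∈ isotypic k R y x →
    F (m ⊗ₜ elt k R g) = B.r g m

variable (k R) in
/-- The degree zero component of the product. -/
def productZero : PathCoalg k (HopfQuiver R) ⊗[k] PathCoalg k (HopfQuiver R) →ₗ[k]
    PathCoalg k (HopfQuiver R) :=
  TensorProduct.lift (onElts k R fun g => onElts k R fun h => elt k R (g * h))

/-- The degree one component of the product. -/
def productOne {Φ : G → G → G → kˣ} (B : ArrowBimodule k Φ R) :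
    PathCoalg k (HopfQuiver R) ⊗[k] PathCoalg k (HopfQuiver R) →ₗ[k] PathCoalg k (HopfQuiver R) :=
  TensorProduct.lift (onElts k R fun g => B.l g ∘ₗ projOne k (HopfQuiver R)) +
    TensorProduct.lift (onElts k R fun g => B.r g ∘ₗ projOne k (HopfQuiver R)).flip

lemma productZero_elt (g h : G) : productZero k R (elt k R g ⊗ₜ elt k R h) = elt k R (g * h) := by
  simp [productZero]

lemma onElts_onElts_projZero {X : Type*} [AddCommGroup X] [Module k X] (f : G → G → X)
    (a b : PathCoalg k (HopfQuiver R)) :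
    onElts k R (fun g => onElts k R (f g)) a (projZero k (HopfQuiver R) b) =
      onElts k R (fun g => onElts k R (f g)) a b := by
  suffices h : LinearMap.lcomp k X (projZero k (HopfQuiver R)) ∘ₗ
      onElts k R (fun g => onElts k R (f g)) = onElts k R (fun g => onElts k R (f g)) from
    LinearMap.congr_fun (LinearMap.congr_fun h a) b
  refine hom_ext_elt (fun g => ?_) fun p hp => ?_
  · ext b
    simp
  · rw [LinearMap.comp_apply, onElts_ofPath _ p hp, map_zero]

lemma productZero_projZero (a b : PathCoalg k (HopfQuiver R)) :
    productZero k R (projZero k (HopfQuiver R) a ⊗ₜ projZero k (HopfQuiver R) b) =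
      productZero k R (a ⊗ₜ b) := by
  rw [productZero, TensorProduct.lift.tmul, TensorProduct.lift.tmul, onElts_projZero,
    onElts_onElts_projZero]

lemma productZero_comp : productZero k R ∘ₗ
    TensorProduct.map (projZero k (HopfQuiver R)) (projZero k (HopfQuiver R)) =
      productZero k R :=
  TensorProduct.ext' productZero_projZero

lemma productZero_pos {x y x' y' : HopfQuiver R} (p : Quiver.Path x y) (q : Quiver.Path x' y')
    (h : p.length + q.length ≠ 0) : productZero k R (ofPath k p ⊗ₜ ofPath k q) = 0 := by
  rw [← productZero_projZero]
  by_cases hp : p.length = 0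
  · rw [projZero_ofPath_eq_zero q (by omega)]; simp
  · rw [projZero_ofPath_eq_zero p hp]; simp

lemma productOne_elt_arrow {Φ : G → G → G → kˣ} (B : ArrowBimodule k Φ R) (g : G)
    {x y : G} {m : PathCoalg k (HopfQuiver R)} (hm : m ∈ isotypic k R y x) :
    productOne B (elt k R g ⊗ₜ m) = B.l g m := by
  rw [productOne, LinearMap.add_apply, TensorProduct.lift.tmul, TensorProduct.lift.tmul,
    LinearMap.flip_apply, onElts_of_mem _ (isotypic_le_degree _ _ hm) one_ne_zero, onElts_elt,
    LinearMap.comp_apply, projOne_of_mem (isotypic_le_degree _ _ hm)]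
  simp

lemma productOne_arrow_elt {Φ : G → G → G → kˣ} (B : ArrowBimodule k Φ R) (g : G)
    {x y : G} {m : PathCoalg k (HopfQuiver R)} (hm : m ∈ isotypic k R y x) :
    productOne B (m ⊗ₜ elt k R g) = B.r g m := by
  rw [productOne, LinearMap.add_apply, TensorProduct.lift.tmul, TensorProduct.lift.tmul,
    LinearMap.flip_apply, onElts_of_mem _ (isotypic_le_degree _ _ hm) one_ne_zero, onElts_elt,
    LinearMap.comp_apply, projOne_of_mem (isotypic_le_degree _ _ hm)]
  simp

/-- Pairs of paths of total degree one consist of a vertex and an arrow. -/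
lemma ofPath_pair_cases {V : Type*} [Quiver V]
    {motive : ∀ {x y x' y' : V}, Quiver.Path x y → Quiver.Path x' y' → Prop}
    (nil_arrow : ∀ (g : V) {x y : V} (a : x ⟶ y), motive (.nil : Quiver.Path g g) a.toPath)
    (arrow_nil : ∀ (g : V) {x y : V} (a : x ⟶ y), motive a.toPath (.nil : Quiver.Path g g))
    (ne : ∀ {x y x' y' : V} (p : Quiver.Path x y) (q : Quiver.Path x' y'),
      p.length + q.length ≠ 1 → motive p q)
    {x y x' y' : V} (p : Quiver.Path x y) (q : Quiver.Path x' y') : motive p q := by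
  by_cases h : p.length + q.length = 1
  · cases p with
    | nil =>
      induction q using ofPath_cases_one with
      | arrow a => exact nil_arrow _ a
      | ne q hq => simp at h; omega
    | cons p b =>
      cases q with
      | nil =>
        cases p with
        | nil => exact arrow_nil _ b
        | cons p c => simp at h
      | cons q c => simp at h; omega
  · exact ne p q h

lemma productOne_ne {Φ : G → G → G → kˣ} (B : ArrowBimodule k Φ R)
    {x y x' y' : HopfQuiver R} (p : Quiver.Path x y) (q : Quiver.Path x' y')
    (h : p.length + q.length ≠ 1) : productOne B (ofPath k p ⊗ₜ ofPath k q) = 0 := by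
  have key : ∀ (f : G → PathCoalg k (HopfQuiver R) →ₗ[k] PathCoalg k (HopfQuiver R))
      {x y x' y' : HopfQuiver R} (p : Quiver.Path x y) (q : Quiver.Path x' y'),
      p.length + q.length ≠ 1 →
      onElts k R (fun g : G => f g ∘ₗ projOne k (HopfQuiver R)) (ofPath k p) (ofPath k q) = 0 := by
    intro f x y x' y' p q h
    induction p using ofPath_cases with
    | nil g =>
      change onElts k R (fun g : G => f g ∘ₗ projOne k (HopfQuiver R))
        (elt k R g.val) (ofPath k q) = 0
      rw [onElts_elt, LinearMap.comp_apply, projOne_ofPath, if_neg, map_zero]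
      simpa using h
    | pos p hp => rw [onElts_ofPath _ p hp]; rfl
  rw [productOne, LinearMap.add_apply, TensorProduct.lift.tmul, TensorProduct.lift.tmul,
    LinearMap.flip_apply, key _ p q h, key _ q p (by omega), add_zero]

lemma productOne_mem {Φ : G → G → G → kˣ} (B : ArrowBimodule k Φ R) {x y x' y' : HopfQuiver R}
    (p : Quiver.Path x y) (q : Quiver.Path x' y') :
    productOne B (ofPath k p ⊗ₜ ofPath k q) ∈ isotypic k R (y.val * y'.val) (x.val * x'.val) := by
  induction p, q using ofPath_pair_cases with
  | nil_arrow g a =>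
    exact (productOne_elt_arrow B g.val (arrow_mem_isotypic a)) ▸
      B.l_mem g.val (arrow_mem_isotypic a)
  | arrow_nil g a =>
    exact (productOne_arrow_elt B g.val (arrow_mem_isotypic a)) ▸
      B.r_mem g.val (arrow_mem_isotypic a)
  | ne p q h => rw [productOne_ne B p q h]; exact zero_mem _

lemma productZero_ofPath {x y x' y' : HopfQuiver R} (p : Quiver.Path x y)
    (q : Quiver.Path x' y') :
    productZero k R (ofPath k p ⊗ₜ ofPath k q) = elt k R (y.val * y'.val) ∨
      productZero k R (ofPath k p ⊗ₜ ofPath k q) = 0 := by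
  induction p using ofPath_cases with
  | nil g =>
    induction q using ofPath_cases with
    | nil h => exact Or.inl (productZero_elt g.val h.val)
    | pos q hq => exact Or.inr (productZero_pos _ _ (by omega))
  | pos p hp => exact Or.inr (productZero_pos _ _ (by omega))

/-- Convolution with a component of `productZero`, on the left. -/
lemma convMul_productZero (x : HopfQuiver R) (ψ : PathCoalg k (HopfQuiver R) ⊗[k]
    PathCoalg k (HopfQuiver R) →ₗ[k] k) {s t s' t' : HopfQuiver R}
    (p : Quiver.Path s t) (q : Quiver.Path s' t') :
    convMul Coalgebra.comul (coord k (.nil : Quiver.Path x x) ∘ₗ productZero k R) ψ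
      (ofPath k p ⊗ₜ ofPath k q) =
      coord k (.nil : Quiver.Path x x) (elt k R (t.val * t'.val)) *
        ψ (ofPath k p ⊗ₜ ofPath k q) := by
  rw [← lconv_eq_convMul, ((isLeftCoact_path p).tmul (isLeftCoact_path q)).lconv_apply
    (by rw [LinearMap.comp_assoc, productZero_comp]), LinearMap.comp_apply, productZero_elt,
    smul_eq_mul]

/-- Convolution with a component of `productZero`, on the right. -/
lemma productZero_convMul (x : HopfQuiver R) (ψ : PathCoalg k (HopfQuiver R) ⊗[k]
    PathCoalg k (HopfQuiver R) →ₗ[k] k) {s t s' t' : HopfQuiver R}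
    (p : Quiver.Path s t) (q : Quiver.Path s' t') :
    convMul Coalgebra.comul ψ (coord k (.nil : Quiver.Path x x) ∘ₗ productZero k R)
      (ofPath k p ⊗ₜ ofPath k q) =
      coord k (.nil : Quiver.Path x x) (elt k R (s.val * s'.val)) *
        ψ (ofPath k p ⊗ₜ ofPath k q) := by
  rw [← rconv_eq_convMul, ((isRightCoact_path p).tmul (isRightCoact_path q)).rconv_apply
    (by rw [LinearMap.comp_assoc, productZero_comp]), LinearMap.comp_apply, productZero_elt,
    smul_eq_mul]

/-- Every bimodule structure on the arrows extends to a product on the path coalgebra. -/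
theorem exists_isArrowProduct {Φ : G → G → G → kˣ} (B : ArrowBimodule k Φ R) :
    ∃ F, IsArrowProduct B F := by
  classical
  have hb := (isGradedComul_comul k (HopfQuiver R)).tensorProduct
    (isGradedComul_comul k (HopfQuiver R))
  obtain ⟨F, hF, h0, h1, hdeg⟩ := exists_comulHom
    (isCoassoc_comul (C := PathCoalg k (HopfQuiver R) ⊗[k] PathCoalg k (HopfQuiver R))) hb
    (productZero k R) (productOne B)
    (by
      intro x y p hp
      refine hom_ext_tensor fun x y q x' y' q' => ?_
      rw [LinearMap.comp_apply]
      rcases productZero_ofPath (k := k) q q' with h | h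
      · rw [h, mem_degree_iff.mp (elt_mem_degree _) _ _ p hp, LinearMap.zero_apply]
      · rw [h, map_zero, LinearMap.zero_apply])
    (by
      rintro ⟨⟨x, y, p⟩, ⟨x', y', q⟩⟩ h
      rw [Module.Basis.tensorProduct_apply]
      have h : p.length + q.length ≠ 0 := h
      change productZero k R (ofPath k p ⊗ₜ ofPath k q) = 0
      exact productZero_pos p q h)
    (by
      rintro ⟨⟨x, y, p⟩, ⟨x', y', q⟩⟩ h
      rw [Module.Basis.tensorProduct_apply]
      have h : p.length + q.length ≠ 1 := h
      change productOne B (ofPath k p ⊗ₜ ofPath k q) = 0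
      exact productOne_ne B p q h)
    (by
      intro x
      refine hom_ext_tensor fun s t p s' t' q => ?_
      rw [convMul_productZero, LinearMap.comp_apply]
      rcases productZero_ofPath (k := k) p q with h | h
      · rw [h, coord_nil_elt]; split_ifs <;> simp
      · rw [h]; simp)
    (by
      intro x y hxy
      refine hom_ext_tensor fun s t p s' t' q => ?_
      rw [convMul_productZero, LinearMap.comp_apply]
      rcases productZero_ofPath (k := k) p q with h | h
      · rw [h, coord_nil_elt, coord_nil_elt]
        split_ifs with h1 h2
        · exact absurd (h1.trans h2.symm) hxy
        all_goals simp
      · rw [h]; simp)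
    (by
      intro x y a
      refine hom_ext_tensor fun s t p s' t' q => ?_
      rw [convMul_productZero, LinearMap.comp_apply, coord_nil_elt]
      split_ifs with h
      · rw [one_mul]
      · rw [coord_of_mem_isotypic_left (productOne_mem B p q) a h, mul_zero])
    (by
      intro x y z a hz
      refine hom_ext_tensor fun s t p s' t' q => ?_
      rw [convMul_productZero, LinearMap.comp_apply, coord_nil_elt]
      split_ifs with h
      · rw [coord_of_mem_isotypic_left (productOne_mem B p q) a
          (fun e => hz (h.trans e.symm)), mul_zero]; rfl
      · rw [zero_mul, LinearMap.zero_apply])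
    (by
      intro x y a
      refine hom_ext_tensor fun s t p s' t' q => ?_
      rw [productZero_convMul, LinearMap.comp_apply, coord_nil_elt]
      split_ifs with h
      · rw [one_mul]
      · rw [coord_of_mem_isotypic_right (productOne_mem B p q) a h, mul_zero])
  have hmul : ∀ {i j : ℕ} {a b : PathCoalg k (HopfQuiver R)}, a ∈ degree k (HopfQuiver R) i →
      b ∈ degree k (HopfQuiver R) j → F (a ⊗ₜ b) ∈ degree k (HopfQuiver R) (i + j) := by
    intro i j a b ha hb
    induction ha using Submodule.span_induction with
    | mem m hm =>
      obtain ⟨x, y, p, rfl, rfl⟩ := hm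
      induction hb using Submodule.span_induction with
      | mem m hm =>
        obtain ⟨x', y', q, rfl, rfl⟩ := hm
        have := hdeg (⟨x, y, p⟩, ⟨x', y', q⟩)
        rwa [Module.Basis.tensorProduct_apply] at this
      | zero => simp
      | add s t _ _ hs ht => rw [TensorProduct.tmul_add, map_add]; exact add_mem hs ht
      | smul c s _ hs => rw [TensorProduct.tmul_smul, map_smul]; exact Submodule.smul_mem _ _ hs
    | zero => simp
    | add s t _ _ hs ht => rw [TensorProduct.add_tmul, map_add]; exact add_mem hs ht
    | smul c s _ hs => rw [← TensorProduct.smul_tmul', map_smul]; exact Submodule.smul_mem _ _ hs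
  refine ⟨F, hF, hmul, ?_, ?_, ?_⟩
  · intro g h
    have hm : F (elt k R g ⊗ₜ elt k R h) ∈ degree k (HopfQuiver R) (0 + 0) :=
      hmul (elt_mem_degree g) (elt_mem_degree h)
    refine eq_of_mem_degree_zero hm (elt_mem_degree _) fun x => ?_
    rw [← LinearMap.comp_apply, h0, LinearMap.comp_apply, productZero_elt]
  · intro g x y m hm
    have hd : F (elt k R g ⊗ₜ m) ∈ degree k (HopfQuiver R) (0 + 1) :=
      hmul (elt_mem_degree g) (isotypic_le_degree _ _ hm)
    rw [zero_add] at hd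
    refine eq_of_mem_degree_one hd (isotypic_le_degree _ _ (B.l_mem g hm)) fun x y a => ?_
    rw [← LinearMap.comp_apply, h1, LinearMap.comp_apply, productOne_elt_arrow B g hm]
  · intro g x y m hm
    have hd : F (m ⊗ₜ elt k R g) ∈ degree k (HopfQuiver R) (1 + 0) :=
      hmul (isotypic_le_degree _ _ hm) (elt_mem_degree g)
    rw [add_zero] at hd
    refine eq_of_mem_degree_one hd (isotypic_le_degree _ _ (B.r_mem g hm)) fun x y a => ?_
    rw [← LinearMap.comp_apply, h1, LinearMap.comp_apply, productOne_arrow_elt B g hm]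

end Product

/-! ### Reassociators supported in degree zero -/

section Reassociator

variable {k : Type u} [Field k] {G : Type v} [Group G] {R : ConjClasses G → ℕ}

section Ext

variable {V : Type v} [Quiver.{w} V] {X : Type*} [AddCommGroup X] [Module k X]

lemma PathCoalg.hom_ext_tensor_three
    {f g : PathCoalg k V ⊗[k] (PathCoalg k V ⊗[k] PathCoalg k V) →ₗ[k] X}
    (H : ∀ {x y x' y' x'' y'' : V} (p : Quiver.Path x y) (q : Quiver.Path x' y')
      (r : Quiver.Path x'' y''), f (ofPath k p ⊗ₜ (ofPath k q ⊗ₜ ofPath k r)) =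
        g (ofPath k p ⊗ₜ (ofPath k q ⊗ₜ ofPath k r))) : f = g :=
  TensorProduct.ext (hom_ext fun _ _ p => hom_ext_tensor fun _ _ q _ _ r => H p q r)

lemma PathCoalg.hom_ext_tensor_four
    {f g : PathCoalg k V ⊗[k] (PathCoalg k V ⊗[k] (PathCoalg k V ⊗[k] PathCoalg k V)) →ₗ[k] X}
    (H : ∀ {x y x' y' x'' y'' x₃ y₃ : V} (p : Quiver.Path x y) (q : Quiver.Path x' y')
      (r : Quiver.Path x'' y'') (s : Quiver.Path x₃ y₃),
      f (ofPath k p ⊗ₜ (ofPath k q ⊗ₜ (ofPath k r ⊗ₜ ofPath k s))) =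
        g (ofPath k p ⊗ₜ (ofPath k q ⊗ₜ (ofPath k r ⊗ₜ ofPath k s)))) : f = g :=
  TensorProduct.ext (hom_ext fun _ _ p => hom_ext_tensor_three fun q r s => H p q r s)

end Ext

variable (R) in
/-- The functional on the third tensor power of the path coalgebra which is given by `Φ` on the
elements of `G` and vanishes in positive degrees. -/
def reassocMap (Φ : G → G → G → kˣ) :
    PathCoalg k (HopfQuiver R) ⊗[k] (PathCoalg k (HopfQuiver R) ⊗[k] PathCoalg k (HopfQuiver R))
      →ₗ[k] k :=
  TensorProduct.lift (onElts k R fun f => TensorProduct.lift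
    (onElts k R fun g => onElts k R fun h => (Φ f g h : k)))

@[simp] lemma reassocMap_elt (Φ : G → G → G → kˣ) (f g h : G) :
    reassocMap R Φ (elt k R f ⊗ₜ (elt k R g ⊗ₜ elt k R h)) = Φ f g h := by
  simp [reassocMap]

lemma reassocMap_pos (Φ : G → G → G → kˣ) {x y x' y' x'' y'' : HopfQuiver R}
    (p : Quiver.Path x y) (q : Quiver.Path x' y') (r : Quiver.Path x'' y'')
    (h : p.length + q.length + r.length ≠ 0) :
    reassocMap R Φ (ofPath k p ⊗ₜ (ofPath k q ⊗ₜ ofPath k r)) = 0 := by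
  rw [reassocMap, TensorProduct.lift.tmul]
  induction p using ofPath_cases with
  | nil f =>
    change (onElts k R fun f : G => TensorProduct.lift (onElts k R fun g => onElts k R fun h =>
      (Φ f g h : k))) (elt k R f.val) _ = 0
    rw [onElts_elt, TensorProduct.lift.tmul]
    induction q using ofPath_cases with
    | nil g =>
      change (onElts k R fun g => onElts k R fun h => (Φ f.val g h : k)) (elt k R g.val) _ = 0
      rw [onElts_elt, onElts_ofPath _ r (by simpa using h)]
    | pos q hq => rw [onElts_ofPath _ q hq]; rfl
  | pos p hp => rw [onElts_ofPath _ p hp]; rfl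

lemma reassocMap_projZero (Φ : G → G → G → kˣ) (a b c : PathCoalg k (HopfQuiver R)) :
    reassocMap R Φ (projZero k (HopfQuiver R) a ⊗ₜ
      (projZero k (HopfQuiver R) b ⊗ₜ projZero k (HopfQuiver R) c)) =
        reassocMap R Φ (a ⊗ₜ (b ⊗ₜ c)) := by
  suffices h : reassocMap R Φ ∘ₗ TensorProduct.map (projZero k (HopfQuiver R))
      (TensorProduct.map (projZero k (HopfQuiver R)) (projZero k (HopfQuiver R))) =
        reassocMap R Φ from LinearMap.congr_fun h (a ⊗ₜ (b ⊗ₜ c))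
  refine hom_ext_tensor_three fun p q r => ?_
  rw [LinearMap.comp_apply, TensorProduct.map_tmul, TensorProduct.map_tmul]
  by_cases h : p.length + q.length + r.length = 0
  · rw [projZero_ofPath, projZero_ofPath, projZero_ofPath, if_pos (by omega), if_pos (by omega),
      if_pos (by omega)]
  · rw [reassocMap_pos Φ p q r h, projZero_ofPath, projZero_ofPath, projZero_ofPath]
    split_ifs
    · omega
    all_goals simp

lemma reassocMap_comp_projZero (Φ : G → G → G → kˣ) :
    reassocMap R Φ ∘ₗ TensorProduct.map (projZero k (HopfQuiver R))
      (TensorProduct.map (projZero k (HopfQuiver R)) (projZero k (HopfQuiver R))) =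
        reassocMap R Φ := by
  ext a b c
  simp [reassocMap_projZero]

/-- A graded functional on the third tensor power is determined by its values on `G`. -/
lemma eq_reassocMap {Φ : G → G → G → kˣ} {Ψ : PathCoalg k (HopfQuiver R) ⊗[k]
      (PathCoalg k (HopfQuiver R) ⊗[k] PathCoalg k (HopfQuiver R)) →ₗ[k] k}
    (h0 : ∀ {i j l : ℕ} {a b c : PathCoalg k (HopfQuiver R)}, a ∈ degree k (HopfQuiver R) i →
      b ∈ degree k (HopfQuiver R) j → c ∈ degree k (HopfQuiver R) l → i + j + l ≠ 0 →
      Ψ (a ⊗ₜ (b ⊗ₜ c)) = 0)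
    (h1 : ∀ f g h : G, Ψ (elt k R f ⊗ₜ (elt k R g ⊗ₜ elt k R h)) = Φ f g h) :
    Ψ = reassocMap R Φ := by
  refine hom_ext_tensor_three fun p q r => ?_
  by_cases h : p.length + q.length + r.length = 0
  · induction p using ofPath_cases with
    | nil f =>
      induction q using ofPath_cases with
      | nil g =>
        induction r using ofPath_cases with
        | nil c => exact (h1 f.val g.val c.val).trans (reassocMap_elt Φ f.val g.val c.val).symm
        | pos p hp => omega
      | pos p hp => omega
    | pos p hp => omega
  · rw [reassocMap_pos Φ p q r h]
    exact h0 (ofPath_mem_degree p) (ofPath_mem_degree q) (ofPath_mem_degree r) h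

lemma lconv_reassocMap_reassocMap {Φ Ψ : G → G → G → kˣ} (h : ∀ a b c, Φ a b c * Ψ a b c = 1) :
    lconv (reassocMap (k := k) R Φ) (reassocMap R Ψ) = Coalgebra.counit := by
  refine hom_ext_tensor_three fun p q r => ?_
  rw [((isLeftCoact_path p).tmul ((isLeftCoact_path q).tmul (isLeftCoact_path r))).lconv_apply
    (reassocMap_comp_projZero Φ), reassocMap_elt]
  by_cases hl : p.length + q.length + r.length = 0
  · induction p using ofPath_cases with
    | nil a =>
      induction q using ofPath_cases with
      | nil b =>
        induction r using ofPath_cases with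
        | nil c =>
          change _ • reassocMap R Ψ (elt k R a.val ⊗ₜ (elt k R b.val ⊗ₜ elt k R c.val)) =
            Coalgebra.counit (elt k R a.val ⊗ₜ (elt k R b.val ⊗ₜ elt k R c.val))
          rw [reassocMap_elt, smul_eq_mul, ← Units.val_mul, h]
          simp
        | pos p hp => omega
      | pos p hp => omega
    | pos p hp => omega
  · rw [reassocMap_pos Ψ p q r hl, smul_zero, TensorProduct.counit_tmul,
      TensorProduct.counit_tmul, ← counit_projZero (ofPath k p),
      ← counit_projZero (ofPath k q), ← counit_projZero (ofPath k r), projZero_ofPath, projZero_ofPath, projZero_ofPath]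
    split_ifs
    · omega
    all_goals simp

end Reassociator

section Product

variable {k : Type u} [Field k] {G : Type v} [Group G] {R : ConjClasses G → ℕ}
  {Φ : G → G → G → kˣ} {B : ArrowBimodule k Φ R}
  {F : PathCoalg k (HopfQuiver R) ⊗[k] PathCoalg k (HopfQuiver R) →ₗ[k] PathCoalg k (HopfQuiver R)}

lemma IsLeftCoact.of_mem_isotypic {x y : G} {m : PathCoalg k (HopfQuiver R)}
    (hm : m ∈ isotypic k R y x) : IsLeftCoact (projZero k (HopfQuiver R)) m (elt k R y) := by
  rw [IsLeftCoact, (mem_isotypic.mp hm).2, map_add, LinearMap.rTensor_tmul, LinearMap.rTensor_tmul,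
    projZero_elt, projZero_of_mem_one (isotypic_le_degree _ _ hm) one_ne_zero]
  simp

lemma IsRightCoact.of_mem_isotypic {x y : G} {m : PathCoalg k (HopfQuiver R)}
    (hm : m ∈ isotypic k R y x) : IsRightCoact (projZero k (HopfQuiver R)) m (elt k R x) := by
  rw [IsRightCoact, (mem_isotypic.mp hm).2, map_add, LinearMap.lTensor_tmul, LinearMap.lTensor_tmul,
    projZero_elt, projZero_of_mem_one (isotypic_le_degree _ _ hm) one_ne_zero]
  simp

lemma isLeftCoact_elt (g : G) : IsLeftCoact (projZero k (HopfQuiver R)) (elt k R g) (elt k R g) :=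
  isLeftCoact_path (.nil : Quiver.Path (of R g) _)

lemma isRightCoact_elt (g : G) : IsRightCoact (projZero k (HopfQuiver R)) (elt k R g) (elt k R g) :=
  isRightCoact_path (.nil : Quiver.Path (of R g) _)

namespace IsArrowProduct

lemma projZero_apply (h : IsArrowProduct B F) (a b : PathCoalg k (HopfQuiver R)) :
    F (projZero k (HopfQuiver R) a ⊗ₜ projZero k (HopfQuiver R) b) =
      projZero k (HopfQuiver R) (F (a ⊗ₜ b)) := by
  suffices h : F ∘ₗ TensorProduct.map (projZero k (HopfQuiver R)) (projZero k (HopfQuiver R)) =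
      projZero k (HopfQuiver R) ∘ₗ F from LinearMap.congr_fun h (a ⊗ₜ b)
  refine hom_ext_tensor fun _ _ p _ _ q => ?_
  rw [LinearMap.comp_apply, LinearMap.comp_apply, TensorProduct.map_tmul]
  by_cases hl : p.length + q.length = 0
  · induction p using ofPath_cases with
    | nil f =>
      induction q using ofPath_cases with
      | nil g =>
        change F (projZero k (HopfQuiver R) (elt k R f.val) ⊗ₜ
          projZero k (HopfQuiver R) (elt k R g.val)) =
          projZero k (HopfQuiver R) (F (elt k R f.val ⊗ₜ elt k R g.val))
        rw [projZero_elt, projZero_elt, h.elt_elt, projZero_elt]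
      | pos p hp => omega
    | pos p hp => omega
  · rw [projZero_of_mem_one (h.mul_mem (ofPath_mem_degree p) (ofPath_mem_degree q)) hl,
      projZero_ofPath, projZero_ofPath]
    split_ifs
    · omega
    all_goals simp

lemma counit_comp (h : IsArrowProduct B F) : Coalgebra.counit ∘ₗ F = Coalgebra.counit := by
  refine hom_ext_tensor fun _ _ p _ _ q => ?_
  rw [LinearMap.comp_apply, ← counit_projZero, ← h.projZero_apply, TensorProduct.counit_tmul,
    ← counit_projZero (ofPath k p), ← counit_projZero (ofPath k q)]
  by_cases hl : p.length + q.length = 0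
  · induction p using ofPath_cases with
    | nil f =>
      induction q using ofPath_cases with
      | nil g =>
        change Coalgebra.counit (F (projZero k (HopfQuiver R) (elt k R f.val) ⊗ₜ
          projZero k (HopfQuiver R) (elt k R g.val))) =
          Coalgebra.counit (R := k) (projZero k (HopfQuiver R) (elt k R g.val)) •
            Coalgebra.counit (R := k) (projZero k (HopfQuiver R) (elt k R f.val))
        rw [projZero_elt, projZero_elt, h.elt_elt, counit_elt, counit_elt, counit_elt, one_smul]
      | pos p hp => omega
    | pos p hp => omega
  · rw [projZero_ofPath, projZero_ofPath]
    split_ifs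
    · omega
    all_goals simp

/-- The product, as a map of coalgebras. -/
def coalgHom (h : IsArrowProduct B F) :
    PathCoalg k (HopfQuiver R) ⊗[k] PathCoalg k (HopfQuiver R) →ₗc[k] PathCoalg k (HopfQuiver R) :=
  { F with
    counit_comp := h.counit_comp
    map_comp_comul := h.comul.symm }

lemma comul_comp_lTensor (h : IsArrowProduct B F) :
    Coalgebra.comul ∘ₗ (F ∘ₗ F.lTensor (PathCoalg k (HopfQuiver R))) =
      TensorProduct.map (F ∘ₗ F.lTensor (PathCoalg k (HopfQuiver R)))
        (F ∘ₗ F.lTensor (PathCoalg k (HopfQuiver R))) ∘ₗ Coalgebra.comul :=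
  (h.coalgHom.comp (Coalgebra.TensorProduct.map (CoalgHom.id k _) h.coalgHom)).map_comp_comul.symm

lemma comul_comp_rTensor (h : IsArrowProduct B F) :
    Coalgebra.comul ∘ₗ (F ∘ₗ F.rTensor (PathCoalg k (HopfQuiver R)) ∘ₗ
        (TensorProduct.assoc k _ _ _).symm.toLinearMap) =
      TensorProduct.map (F ∘ₗ F.rTensor (PathCoalg k (HopfQuiver R)) ∘ₗ
        (TensorProduct.assoc k _ _ _).symm.toLinearMap)
        (F ∘ₗ F.rTensor (PathCoalg k (HopfQuiver R)) ∘ₗ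
        (TensorProduct.assoc k _ _ _).symm.toLinearMap) ∘ₗ Coalgebra.comul :=
  (h.coalgHom.comp ((Coalgebra.TensorProduct.map h.coalgHom (CoalgHom.id k _)).comp
    (Coalgebra.TensorProduct.assoc k k (PathCoalg k (HopfQuiver R)) (PathCoalg k (HopfQuiver R))
      (PathCoalg k (HopfQuiver R))).symm.toCoalgHom)).map_comp_comul.symm

/-- Triples of paths of total degree one consist of two vertices and an arrow. -/
lemma _root_.ofPath_triple_cases {V : Type*} [Quiver V]
    {motive : ∀ {x y x' y' x'' y'' : V}, Quiver.Path x y → Quiver.Path x' y' →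
      Quiver.Path x'' y'' → Prop}
    (nil_nil_arrow : ∀ (g h : V) {x y : V} (a : x ⟶ y),
      motive (.nil : Quiver.Path g g) (.nil : Quiver.Path h h) a.toPath)
    (nil_arrow_nil : ∀ (g h : V) {x y : V} (a : x ⟶ y),
      motive (.nil : Quiver.Path g g) a.toPath (.nil : Quiver.Path h h))
    (arrow_nil_nil : ∀ (g h : V) {x y : V} (a : x ⟶ y),
      motive a.toPath (.nil : Quiver.Path g g) (.nil : Quiver.Path h h))
    (ne : ∀ {x y x' y' x'' y'' : V} (p : Quiver.Path x y) (q : Quiver.Path x' y')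
      (r : Quiver.Path x'' y''), p.length + (q.length + r.length) ≠ 1 → motive p q r)
    {x y x' y' x'' y'' : V} (p : Quiver.Path x y) (q : Quiver.Path x' y')
    (r : Quiver.Path x'' y'') : motive p q r := by
  by_cases h : p.length + (q.length + r.length) = 1
  · cases p with
    | nil =>
      induction q, r using ofPath_pair_cases with
      | nil_arrow g a => exact nil_nil_arrow _ _ a
      | arrow_nil g a => exact nil_arrow_nil _ _ a
      | ne q hq => simp at h; omega
    | cons p b =>
      cases q with
      | nil =>
        cases r with
        | nil =>
          cases p with
          | nil => exact arrow_nil_nil _ _ b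
          | cons p c => simp at h
        | cons r c => simp at h; omega
      | cons q c => simp at h; omega
  · exact ne p q r h

/-- The product is associative up to the reassociator. By `coord_cons` and induction on the length of
a path it suffices to compare the components in degree one, where the three relations of a
bimodule occur. -/
theorem quasi_assoc (h : IsArrowProduct B F) :
    rconv (F ∘ₗ F.lTensor (PathCoalg k (HopfQuiver R))) (reassocMap R Φ) =
      lconv (reassocMap R Φ) (F ∘ₗ F.rTensor (PathCoalg k (HopfQuiver R)) ∘ₗ
        (TensorProduct.assoc k _ _ _).symm.toLinearMap) := by
  refine hom_ext_coord fun x y p => ?_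
  rw [comp_rconv, comp_lconv, rconv_eq_convMul, lconv_eq_convMul]
  have hd : ∀ {x y x' y' x'' y'' : HopfQuiver R} (p : Quiver.Path x y) (q : Quiver.Path x' y')
      (r : Quiver.Path x'' y''), F (ofPath k p ⊗ₜ F (ofPath k q ⊗ₜ ofPath k r)) ∈
        degree k (HopfQuiver R) (p.length + (q.length + r.length)) := fun p q r =>
    h.mul_mem (ofPath_mem_degree p) (h.mul_mem (ofPath_mem_degree q) (ofPath_mem_degree r))
  have hd' : ∀ {x y x' y' x'' y'' : HopfQuiver R} (p : Quiver.Path x y) (q : Quiver.Path x' y')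
      (r : Quiver.Path x'' y''), F (F (ofPath k p ⊗ₜ ofPath k q) ⊗ₜ ofPath k r) ∈
        degree k (HopfQuiver R) (p.length + (q.length + r.length)) := fun p q r => by
    rw [← add_assoc]
    exact h.mul_mem (h.mul_mem (ofPath_mem_degree p) (ofPath_mem_degree q)) (ofPath_mem_degree r)
  induction p with
  | nil =>
    refine hom_ext_tensor_three fun {x₁ y₁ x₂ y₂ x₃ y₃} p q r => ?_
    rw [← rconv_eq_convMul, ← lconv_eq_convMul,
      ((isLeftCoact_path p).tmul ((isLeftCoact_path q).tmul (isLeftCoact_path r))).lconv_apply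
      (reassocMap_comp_projZero Φ),
      ((isRightCoact_path p).tmul ((isRightCoact_path q).tmul (isRightCoact_path r))).rconv_apply
      (reassocMap_comp_projZero Φ), reassocMap_elt, reassocMap_elt]
    change _ • coord k _ (F (ofPath k p ⊗ₜ F (ofPath k q ⊗ₜ ofPath k r))) =
      _ • coord k _ (F (F (ofPath k p ⊗ₜ ofPath k q) ⊗ₜ ofPath k r))
    by_cases hl : p.length + (q.length + r.length) = 0
    · induction p using ofPath_cases with
      | nil a =>
        induction q using ofPath_cases with
        | nil b =>
          induction r using ofPath_cases with
          | nil c =>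
            change _ • coord k _ (F (elt k R a.val ⊗ₜ F (elt k R b.val ⊗ₜ elt k R c.val))) =
              _ • coord k _ (F (F (elt k R a.val ⊗ₜ elt k R b.val) ⊗ₜ elt k R c.val))
            rw [h.elt_elt, h.elt_elt, h.elt_elt, h.elt_elt, mul_assoc]
          | pos p hp => omega
        | pos p hp => omega
      | pos p hp => omega
    · rw [coord_nil_of_mem (hd p q r) hl, coord_nil_of_mem (hd' p q r) hl, smul_zero, smul_zero]
  | cons p a ih =>
    -- The reassociator is moved past the factor at `p`, and then past the factor at `a`.
    rw [coord_cons, convMul_comp h.comul_comp_lTensor, convMul_comp h.comul_comp_rTensor,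
      convMul_assoc isCoassoc_comul, ih, ← convMul_assoc isCoassoc_comul,
      ← convMul_assoc isCoassoc_comul]
    congr 1
    refine hom_ext_tensor_three fun {x₁ y₁ x₂ y₂ x₃ y₃} p q r => ?_
    rw [← rconv_eq_convMul, ← lconv_eq_convMul,
      ((isLeftCoact_path p).tmul ((isLeftCoact_path q).tmul (isLeftCoact_path r))).lconv_apply
      (reassocMap_comp_projZero Φ),
      ((isRightCoact_path p).tmul ((isRightCoact_path q).tmul (isRightCoact_path r))).rconv_apply
      (reassocMap_comp_projZero Φ), reassocMap_elt, reassocMap_elt]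
    change _ • coord k _ (F (ofPath k p ⊗ₜ F (ofPath k q ⊗ₜ ofPath k r))) =
      _ • coord k _ (F (F (ofPath k p ⊗ₜ ofPath k q) ⊗ₜ ofPath k r))
    induction p, q, r using ofPath_triple_cases with
    | nil_nil_arrow e f b =>
      have hm := arrow_mem_isotypic (k := k) b
      change _ • coord k _ (F (elt k R e.val ⊗ₜ F (elt k R f.val ⊗ₜ ofPath k b.toPath))) =
        _ • coord k _ (F (F (elt k R e.val ⊗ₜ elt k R f.val) ⊗ₜ ofPath k b.toPath))
      rw [h.elt_elt, h.elt_arrow _ hm, h.elt_arrow _ hm, h.elt_arrow _ (B.l_mem _ hm)]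
      simpa only [map_smul] using congrArg (coord k a.toPath) (B.l_l e.val f.val hm)
    | nil_arrow_nil e f b =>
      have hm := arrow_mem_isotypic (k := k) b
      change _ • coord k _ (F (elt k R e.val ⊗ₜ F (ofPath k b.toPath ⊗ₜ elt k R f.val))) =
        _ • coord k _ (F (F (elt k R e.val ⊗ₜ ofPath k b.toPath) ⊗ₜ elt k R f.val))
      rw [h.elt_arrow _ hm, h.arrow_elt _ hm, h.elt_arrow _ (B.r_mem _ hm),
        h.arrow_elt _ (B.l_mem _ hm)]
      simpa only [map_smul] using congrArg (coord k a.toPath) (B.l_r e.val f.val hm)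
    | arrow_nil_nil e f b =>
      have hm := arrow_mem_isotypic (k := k) b
      change _ • coord k _ (F (ofPath k b.toPath ⊗ₜ F (elt k R e.val ⊗ₜ elt k R f.val))) =
        _ • coord k _ (F (F (ofPath k b.toPath ⊗ₜ elt k R e.val) ⊗ₜ elt k R f.val))
      rw [h.elt_elt, h.arrow_elt _ hm, h.arrow_elt _ hm, h.arrow_elt _ (B.r_mem _ hm)]
      simpa only [map_smul] using congrArg (coord k a.toPath) (B.r_r e.val f.val hm)
    | ne p q r hl =>
      rw [coord_arrow_of_mem (hd p q r) hl, coord_arrow_of_mem (hd' p q r) hl, smul_zero,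
        smul_zero]

/-- The pentagon relation. Both sides are supported in degree zero, where it is the cocycle
condition. -/
theorem pentagon (h : IsArrowProduct B F) (hΦ : IsNormalizedThreeCocycle Φ) :
    lconv (reassocMap R Φ ∘ₗ (F.lTensor (PathCoalg k (HopfQuiver R))).lTensor _)
        (reassocMap R Φ ∘ₗ F.rTensor _ ∘ₗ
          (TensorProduct.assoc k _ _ (_ ⊗[k] _)).symm.toLinearMap) =
      lconv ((TensorProduct.lid k k).toLinearMap ∘ₗ
          TensorProduct.map Coalgebra.counit (reassocMap R Φ))
        (lconv
          (reassocMap R Φ ∘ₗ (F.rTensor _ ∘ₗ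
            (TensorProduct.assoc k _ _ _).symm.toLinearMap).lTensor _)
          ((TensorProduct.rid k k).toLinearMap ∘ₗ
            TensorProduct.map (reassocMap R Φ) Coalgebra.counit ∘ₗ
            (TensorProduct.assoc k _ (_ ⊗[k] _) _).symm.toLinearMap ∘ₗ
            (TensorProduct.assoc k _ _ _).symm.toLinearMap.lTensor _)) := by
  refine hom_ext_tensor_four fun p q r s => ?_
  have hL := (isLeftCoact_path (k := k) p).tmul ((isLeftCoact_path q).tmul
    ((isLeftCoact_path r).tmul (isLeftCoact_path s)))
  rw [hL.lconv_apply, hL.lconv_apply, hL.lconv_apply]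
  · simp only [LinearMap.comp_apply, LinearMap.lTensor_tmul, LinearMap.rTensor_tmul,
      LinearEquiv.coe_coe, TensorProduct.assoc_symm_tmul, h.elt_elt, TensorProduct.map_tmul,
      reassocMap_elt, counit_elt, TensorProduct.lid_tmul, TensorProduct.rid_tmul, smul_eq_mul,
      one_mul]
    rw [← reassocMap_projZero, ← h.projZero_apply, ← reassocMap_projZero Φ (ofPath k p),
      ← counit_projZero (ofPath k s)]
    by_cases hl : p.length + q.length + r.length + s.length = 0
    · induction p using ofPath_cases with
      | nil a =>
        induction q using ofPath_cases with
        | nil b =>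
          induction r using ofPath_cases with
          | nil c =>
            induction s using ofPath_cases with
            | nil d =>
              change _ * reassocMap R Φ (F (projZero k (HopfQuiver R) (elt k R a.val) ⊗ₜ
                projZero k (HopfQuiver R) (elt k R b.val)) ⊗ₜ
                (projZero k (HopfQuiver R) (elt k R c.val) ⊗ₜ
                  projZero k (HopfQuiver R) (elt k R d.val))) = _ * (_ *
                (Coalgebra.counit (projZero k (HopfQuiver R) (elt k R d.val)) *
                reassocMap R Φ (projZero k (HopfQuiver R) (elt k R a.val) ⊗ₜ
                  (projZero k (HopfQuiver R) (elt k R b.val) ⊗ₜ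
                    projZero k (HopfQuiver R) (elt k R c.val)))))
              simp only [projZero_elt, h.elt_elt, reassocMap_elt, counit_elt, one_mul]
              have := congrArg Units.val (hΦ.cocycle a.val b.val c.val d.val)
              simp only [Units.val_mul] at this
              linear_combination -this
            | pos p hp => omega
          | pos p hp => omega
        | pos p hp => omega
      | pos p hp => omega
    · rw [projZero_ofPath, projZero_ofPath, projZero_ofPath, projZero_ofPath]
      split_ifs
      · omega
      all_goals simp
  · ext a b c d
    simp [← h.projZero_apply, ← reassocMap_projZero Φ a]
  · ext a b c d
    simp [reassocMap_projZero, counit_projZero]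
  · ext a b c d
    simp [reassocMap_projZero, h.projZero_apply]

end IsArrowProduct

end Product

/-! ### The quasi-antipode -/

section Sweedler

variable {k : Type u} [Field k] {C : Type*} [AddCommGroup C] [Module k C] [Coalgebra k C]

lemma map_comul_comul_comul (c : C) :
    TensorProduct.map Coalgebra.comul Coalgebra.comul (Coalgebra.comul (R := k) c) =
      (TensorProduct.assoc k C C (C ⊗[k] C)).symm
        ((TensorProduct.assoc k C C C).toLinearMap.lTensor C
          (((Coalgebra.comul (R := k)).rTensor C ∘ₗ Coalgebra.comul).lTensor C
            (Coalgebra.comul (R := k) c))) := by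
  rw [← LinearMap.comp_apply (LinearMap.lTensor C _), ← LinearMap.lTensor_comp, Coalgebra.coassoc,
    LinearMap.lTensor_comp, LinearMap.comp_apply, ← Coalgebra.coassoc_apply]
  generalize Coalgebra.comul (R := k) c = t
  induction t with
  | zero => simp
  | add s t hs ht => simp only [map_add, hs, ht]
  | tmul x y =>
    simp only [TensorProduct.map_tmul, LinearMap.rTensor_tmul]
    generalize Coalgebra.comul (R := k) x = t
    induction t with
    | zero => simp
    | add s t hs ht => simp only [map_add, TensorProduct.add_tmul, hs, ht]
    | tmul x y => simp

/-- If `S` reverses the comultiplication, then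
`φ(S(h₂) ⊗ h₃) ψ(S(h₁) ⊗ h₄)` is the convolution of `φ` and `ψ` evaluated at `S(h₁) ⊗ h₂`. -/
lemma convMul_antipode_left {S : C →ₗ[k] C}
    (hS : Coalgebra.comul ∘ₗ S = TensorProduct.map S S ∘ₗ (TensorProduct.comm k C C).toLinearMap ∘ₗ
      Coalgebra.comul) (φ ψ : C ⊗[k] C →ₗ[k] k) (c : C) :
    convMul Coalgebra.comul φ ψ (TensorProduct.map S LinearMap.id (Coalgebra.comul (R := k) c)) =
      ψ (TensorProduct.map S (lconv (φ ∘ₗ TensorProduct.map S LinearMap.id ∘ₗ Coalgebra.comul)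
        LinearMap.id) (Coalgebra.comul (R := k) c)) := by
  have h1 : (Coalgebra.comul ∘ₗ TensorProduct.map S LinearMap.id : C ⊗[k] C →ₗ[k] _) =
      (TensorProduct.AlgebraTensorModule.tensorTensorTensorComm k k k k C C C C).toLinearMap ∘ₗ
        TensorProduct.map (TensorProduct.map S S ∘ₗ (TensorProduct.comm k C C).toLinearMap)
          LinearMap.id ∘ₗ TensorProduct.map Coalgebra.comul Coalgebra.comul := by
    refine TensorProduct.ext' fun a b => ?_
    have := LinearMap.congr_fun hS a
    simp only [LinearMap.comp_apply] at this
    simp [this]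
  have h2 : TensorProduct.map S (lconv (φ ∘ₗ TensorProduct.map S LinearMap.id ∘ₗ Coalgebra.comul)
        LinearMap.id) =
      TensorProduct.map S ((TensorProduct.lid k C).toLinearMap ∘ₗ
        TensorProduct.map (φ ∘ₗ TensorProduct.map S LinearMap.id) LinearMap.id) ∘ₗ
        ((Coalgebra.comul (R := k)).rTensor C ∘ₗ Coalgebra.comul).lTensor C := by
    have h3 : TensorProduct.map (φ ∘ₗ TensorProduct.map S LinearMap.id ∘ₗ Coalgebra.comul) LinearMap.id =
        TensorProduct.map (φ ∘ₗ TensorProduct.map S LinearMap.id) LinearMap.id ∘ₗ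
          (Coalgebra.comul (R := k)).rTensor C := by
      rw [LinearMap.map_comp_rTensor]
      rfl
    rw [LinearMap.map_comp_lTensor, lconv, h3]
    rfl
  rw [h2, convMul_apply, ← LinearMap.comp_apply Coalgebra.comul, h1, LinearMap.comp_apply,
    LinearMap.comp_apply, map_comul_comul_comul, LinearMap.comp_apply]
  generalize ((Coalgebra.comul (R := k)).rTensor C ∘ₗ Coalgebra.comul).lTensor C
    (Coalgebra.comul (R := k) c) = t
  suffices h : (TensorProduct.lid k k).toLinearMap ∘ₗ TensorProduct.map φ ψ ∘ₗ
      (TensorProduct.AlgebraTensorModule.tensorTensorTensorComm k k k k C C C C).toLinearMap ∘ₗ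
        TensorProduct.map (TensorProduct.map S S ∘ₗ (TensorProduct.comm k C C).toLinearMap)
          LinearMap.id ∘ₗ (TensorProduct.assoc k C C (C ⊗[k] C)).symm.toLinearMap ∘ₗ
          (TensorProduct.assoc k C C C).toLinearMap.lTensor C =
      ψ ∘ₗ TensorProduct.map S ((TensorProduct.lid k C).toLinearMap ∘ₗ
        TensorProduct.map (φ ∘ₗ TensorProduct.map S LinearMap.id) LinearMap.id) from
    LinearMap.congr_fun h t
  ext a b c d
  simp

/-- If `Δ(u(h)) = S(h₂) ⊗ u(h₁)`, then `φ(h₁ ⊗ S(h₄)) ψ(h₂ ⊗ u(h₃))` is the convolution of `φ` and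
`ψ` evaluated at `h₁ ⊗ u(h₂)`. -/
lemma convMul_antipode_right {S u : C →ₗ[k] C}
    (hu : Coalgebra.comul ∘ₗ u = TensorProduct.map S u ∘ₗ (TensorProduct.comm k C C).toLinearMap ∘ₗ
      Coalgebra.comul) (φ ψ : C ⊗[k] C →ₗ[k] k) (c : C) :
    convMul Coalgebra.comul φ ψ (TensorProduct.map LinearMap.id u (Coalgebra.comul (R := k) c)) =
      φ (TensorProduct.map LinearMap.id
        (lconv (ψ ∘ₗ TensorProduct.map LinearMap.id u ∘ₗ Coalgebra.comul) S)
        (Coalgebra.comul (R := k) c)) := by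
  have h1 : (Coalgebra.comul ∘ₗ TensorProduct.map LinearMap.id u : C ⊗[k] C →ₗ[k] _) =
      (TensorProduct.AlgebraTensorModule.tensorTensorTensorComm k k k k C C C C).toLinearMap ∘ₗ
        TensorProduct.map LinearMap.id
          (TensorProduct.map S u ∘ₗ (TensorProduct.comm k C C).toLinearMap) ∘ₗ
            TensorProduct.map Coalgebra.comul Coalgebra.comul := by
    refine TensorProduct.ext' fun a b => ?_
    have := LinearMap.congr_fun hu b
    simp only [LinearMap.comp_apply] at this
    simp [this]
  have h2 : TensorProduct.map LinearMap.id
        (lconv (ψ ∘ₗ TensorProduct.map LinearMap.id u ∘ₗ Coalgebra.comul) S) =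
      TensorProduct.map LinearMap.id ((TensorProduct.lid k C).toLinearMap ∘ₗ
        TensorProduct.map (ψ ∘ₗ TensorProduct.map LinearMap.id u) S) ∘ₗ
        ((Coalgebra.comul (R := k)).rTensor C ∘ₗ Coalgebra.comul).lTensor C := by
    have h3 : TensorProduct.map (ψ ∘ₗ TensorProduct.map LinearMap.id u ∘ₗ Coalgebra.comul) S =
        TensorProduct.map (ψ ∘ₗ TensorProduct.map LinearMap.id u) S ∘ₗ
          (Coalgebra.comul (R := k)).rTensor C := by
      rw [LinearMap.map_comp_rTensor]
      rfl
    rw [LinearMap.map_comp_lTensor, lconv, h3]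
    rfl
  rw [h2, convMul_apply, ← LinearMap.comp_apply Coalgebra.comul, h1, LinearMap.comp_apply,
    LinearMap.comp_apply, map_comul_comul_comul, LinearMap.comp_apply]
  generalize ((Coalgebra.comul (R := k)).rTensor C ∘ₗ Coalgebra.comul).lTensor C
    (Coalgebra.comul (R := k) c) = t
  suffices h : (TensorProduct.lid k k).toLinearMap ∘ₗ TensorProduct.map φ ψ ∘ₗ
      (TensorProduct.AlgebraTensorModule.tensorTensorTensorComm k k k k C C C C).toLinearMap ∘ₗ
        TensorProduct.map LinearMap.id
          (TensorProduct.map S u ∘ₗ (TensorProduct.comm k C C).toLinearMap) ∘ₗ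
          (TensorProduct.assoc k C C (C ⊗[k] C)).symm.toLinearMap ∘ₗ
          (TensorProduct.assoc k C C C).toLinearMap.lTensor C =
      φ ∘ₗ TensorProduct.map LinearMap.id ((TensorProduct.lid k C).toLinearMap ∘ₗ
        TensorProduct.map (ψ ∘ₗ TensorProduct.map LinearMap.id u) S) from
    LinearMap.congr_fun h t
  ext a b c d
  simp [mul_comm]

lemma lconv_counit {X : Type*} [AddCommGroup X] [Module k X] (f : C →ₗ[k] X) :
    lconv Coalgebra.counit f = f := by
  ext c
  have h : TensorProduct.map Coalgebra.counit f =
    f.lTensor k ∘ₗ (Coalgebra.counit (R := k) (A := C)).rTensor C := by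
    rw [LinearMap.lTensor_comp_rTensor]
  rw [lconv, h, LinearMap.comp_apply, LinearMap.comp_apply, LinearMap.comp_apply,
    Coalgebra.rTensor_counit_comul]
  simp

/-- Convolving with a functional does not affect how a map reverses the comultiplication. -/
lemma comul_comp_lconv {S : C →ₗ[k] C}
    (hS : Coalgebra.comul ∘ₗ S = TensorProduct.map S S ∘ₗ (TensorProduct.comm k C C).toLinearMap ∘ₗ
      Coalgebra.comul) (β : C →ₗ[k] k) :
    Coalgebra.comul ∘ₗ lconv β S = TensorProduct.map S (lconv β S) ∘ₗ
      (TensorProduct.comm k C C).toLinearMap ∘ₗ Coalgebra.comul := by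
  rw [comp_lconv, hS]
  ext c
  have h := congrArg (fun t => TensorProduct.map S ((TensorProduct.lid k C).toLinearMap ∘ₗ
    TensorProduct.map β S) (TensorProduct.comm k _ _ t)) (Coalgebra.coassoc_symm_apply (R := k) c)
  simp only [lconv, LinearMap.comp_apply, LinearEquiv.coe_coe]
  trans TensorProduct.map S ((TensorProduct.lid k C).toLinearMap ∘ₗ
    TensorProduct.map β S) (TensorProduct.comm k _ _
      ((Coalgebra.comul (R := k)).rTensor C (Coalgebra.comul (R := k) c)))
  · rw [← h]
    generalize (Coalgebra.comul (R := k) c) = t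
    induction t with
    | zero => simp
    | add s t hs ht => simp only [map_add, hs, ht]
    | tmul x y =>
      simp only [TensorProduct.map_tmul, LinearMap.lTensor_tmul, LinearMap.comp_apply]
      generalize (Coalgebra.comul (R := k) y) = t
      induction t with
      | zero => simp
      | add s t hs ht => simp_all only [map_add, TensorProduct.tmul_add]
      | tmul x y => simp
  · generalize (Coalgebra.comul (R := k) c) = t
    induction t with
    | zero => simp
    | add s t hs ht => simp only [map_add, hs, ht]
    | tmul x y => simp

end Sweedler

section Antipode

variable {k : Type u} [Field k] {G : Type v} [Group G] {R : ConjClasses G → ℕ}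

/-- A linear endomorphism of the path coalgebra preserves degrees. -/
def PathCoalg.IsGradedMap {V : Type v} [Quiver.{w} V] (f : PathCoalg k V →ₗ[k] PathCoalg k V) :
    Prop :=
  ∀ {n : ℕ} {a : PathCoalg k V}, a ∈ degree k V n → f a ∈ degree k V n

lemma PathCoalg.isGradedMap_of_path {V : Type v} [Quiver.{w} V]
    {f : PathCoalg k V →ₗ[k] PathCoalg k V}
    (h : ∀ {x y : V} (p : Quiver.Path x y), f (ofPath k p) ∈ degree k V p.length) :
    IsGradedMap f := by
  intro n a ha
  induction ha using Submodule.span_induction with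
  | mem m hm =>
    obtain ⟨x, y, p, rfl, rfl⟩ := hm
    exact h p
  | zero => simp
  | add s t _ _ hs ht => rw [map_add]; exact add_mem hs ht
  | smul c s _ hs => rw [map_smul]; exact Submodule.smul_mem _ _ hs

/-- To prove something for the comultiplication of a path, it is enough to consider tensors of
paths with the right total length. -/
lemma PathCoalg.comul_path_induction {V : Type v} [Quiver.{w} V] {X : Type*} [AddCommGroup X]
    [Module k X] {f : PathCoalg k V ⊗[k] PathCoalg k V →ₗ[k] X} {W : Submodule k X}
    {x y : V} (p : Quiver.Path x y)
    (h : ∀ {x' y' x'' y'' : V} (q : Quiver.Path x' y') (r : Quiver.Path x'' y''),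
      q.length + r.length = p.length → f (ofPath k q ⊗ₜ ofPath k r) ∈ W) :
    f (Coalgebra.comul (R := k) (ofPath k p)) ∈ W := by
  have h1 : Submodule.span k {t | ∃ j l : Σ (x : V) (y : V), Quiver.Path x y,
      j.2.2.length + l.2.2.length = p.length ∧ t = pathBasis k V j ⊗ₜ[k] pathBasis k V l} ≤
      W.comap f := by
    rw [Submodule.span_le]
    rintro _ ⟨⟨_, _, q⟩, ⟨_, _, r⟩, hl, rfl⟩
    exact h q r hl
  exact h1 (isGradedComul_comul k V ⟨x, y, p⟩)

lemma reassocMap_of_mem (Φ : G → G → G → kˣ) {i j l : ℕ} {a b c : PathCoalg k (HopfQuiver R)}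
    (ha : a ∈ degree k (HopfQuiver R) i) (hb : b ∈ degree k (HopfQuiver R) j)
    (hc : c ∈ degree k (HopfQuiver R) l) (h : i + j + l ≠ 0) :
    reassocMap R Φ (a ⊗ₜ (b ⊗ₜ c)) = 0 := by
  rw [← reassocMap_projZero]
  by_cases hi : i = 0
  · by_cases hj : j = 0
    · rw [projZero_of_mem_one hc (by omega)]; simp
    · rw [projZero_of_mem_one hb hj]; simp
  · rw [projZero_of_mem_one ha hi]; simp

lemma reassocMap_comul_pos (Φ : G → G → G → kˣ)
    {s u t : PathCoalg k (HopfQuiver R) →ₗ[k] PathCoalg k (HopfQuiver R)}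
    (hs : IsGradedMap s) (hu : IsGradedMap u) (ht : IsGradedMap t)
    {x y : HopfQuiver R} (p : Quiver.Path x y) (hp : p.length ≠ 0) :
    reassocMap R Φ (TensorProduct.map s (TensorProduct.map u t ∘ₗ Coalgebra.comul)
      (Coalgebra.comul (R := k) (ofPath k p))) = 0 := by
  rw [← LinearMap.comp_apply, ← Submodule.mem_bot k]
  refine comul_path_induction p fun q r hqr => ?_
  rw [LinearMap.comp_apply, TensorProduct.map_tmul, LinearMap.comp_apply, Submodule.mem_bot]
  change (reassocMap R Φ ∘ₗ TensorProduct.mk k _ _ (s (ofPath k q)) ∘ₗ TensorProduct.map u t)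
    (Coalgebra.comul (R := k) (ofPath k r)) = 0
  rw [← Submodule.mem_bot k]
  refine comul_path_induction r fun q' r' hqr' => ?_
  rw [Submodule.mem_bot]
  exact reassocMap_of_mem Φ (hs (ofPath_mem_degree q)) (hu (ofPath_mem_degree q'))
    (ht (ofPath_mem_degree r')) (by omega)

variable (R) in
/-- The functional `β` of the quasi-antipode, with `β(g) = Φ(g,g⁻¹,g)⁻¹`. -/
def betaMap (Φ : G → G → G → kˣ) : PathCoalg k (HopfQuiver R) →ₗ[k] k :=
  onElts k R fun g => ((Φ g g⁻¹ g)⁻¹ : kˣ)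

@[simp] lemma betaMap_elt (Φ : G → G → G → kˣ) (g : G) :
    betaMap R Φ (elt k R g) = ((Φ g g⁻¹ g)⁻¹ : kˣ) :=
  onElts_elt _ _

lemma betaMap_comp_projZero (Φ : G → G → G → kˣ) :
    betaMap (k := k) R Φ ∘ₗ projZero k (HopfQuiver R) = betaMap R Φ := by
  refine LinearMap.ext fun h => ?_
  rw [LinearMap.comp_apply, betaMap, onElts_projZero]

lemma isGradedMap_id : IsGradedMap (LinearMap.id : PathCoalg k (HopfQuiver R) →ₗ[k] _) :=
  fun ha => ha

lemma lconv_betaMap_path (Φ : G → G → G → kˣ)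
    (S : PathCoalg k (HopfQuiver R) →ₗ[k] PathCoalg k (HopfQuiver R)) {x y : HopfQuiver R}
    (p : Quiver.Path x y) : lconv (betaMap R Φ) S (ofPath k p) =
      (((Φ y.val y.val⁻¹ y.val)⁻¹ : kˣ) : k) • S (ofPath k p) := by
  rw [(isLeftCoact_path p).lconv_apply (betaMap_comp_projZero Φ), betaMap_elt]

lemma isGradedMap_lconv_betaMap (Φ : G → G → G → kˣ)
    {S : PathCoalg k (HopfQuiver R) →ₗ[k] PathCoalg k (HopfQuiver R)} (hS : IsGradedMap S) :
    IsGradedMap (lconv (betaMap R Φ) S) := by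
  refine isGradedMap_of_path fun p => ?_
  rw [lconv_betaMap_path]
  exact Submodule.smul_mem _ _ (hS (ofPath_mem_degree p))

variable {Φ : G → G → G → kˣ} {B : ArrowBimodule k Φ R}
  {F : PathCoalg k (HopfQuiver R) ⊗[k] PathCoalg k (HopfQuiver R) →ₗ[k] PathCoalg k (HopfQuiver R)}

/-- The quasi-antipode of the product `F` on the path coalgebra, characterized by its restrictions
to degree zero and degree one. On an arrow `a` from `x` to `y` the relation `S(a₁)a₂ = 0` reads
`S(a).x = -y⁻¹.a`, and the value in `arrow` is its only solution. -/
structure IsArrowAntipode (B : ArrowBimodule k Φ R)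
    (S : PathCoalg k (HopfQuiver R) →ₗ[k] PathCoalg k (HopfQuiver R)) : Prop where
  comul : Coalgebra.comul ∘ₗ S = TensorProduct.map S S ∘ₗ
    (TensorProduct.comm k _ _).toLinearMap ∘ₗ Coalgebra.comul
  graded : IsGradedMap S
  elt_inv : ∀ g : G, S (elt k R g) = elt k R g⁻¹
  arrow : ∀ {x y : HopfQuiver R} (a : x ⟶ y), S (ofPath k a.toPath) =
    -((((Φ (y.val⁻¹ * x.val) x.val⁻¹ x.val)⁻¹ : kˣ) : k) •
      B.r x.val⁻¹ (B.l y.val⁻¹ (ofPath k a.toPath)))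

lemma IsArrowProduct.map_comul_mem (h : IsArrowProduct B F)
    {s t : PathCoalg k (HopfQuiver R) →ₗ[k] PathCoalg k (HopfQuiver R)}
    (hs : IsGradedMap s) (ht : IsGradedMap t) {x y : HopfQuiver R} (p : Quiver.Path x y) :
    F (TensorProduct.map s t (Coalgebra.comul (R := k) (ofPath k p))) ∈
      degree k (HopfQuiver R) p.length := by
  rw [← LinearMap.comp_apply]
  refine comul_path_induction p fun q r hqr => ?_
  rw [← hqr]
  exact h.mul_mem (hs (ofPath_mem_degree q)) (ht (ofPath_mem_degree r))

/-- The degree one component of the quasi-antipode. -/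
def antipodeOne (B : ArrowBimodule k Φ R) :
    PathCoalg k (HopfQuiver R) →ₗ[k] PathCoalg k (HopfQuiver R) :=
  (pathBasis k (HopfQuiver R)).constr k fun p => if p.2.2.length = 1 then
    -((((Φ (p.2.1.val⁻¹ * p.1.val) p.1.val⁻¹ p.1.val)⁻¹ : kˣ) : k) •
      B.r p.1.val⁻¹ (B.l p.2.1.val⁻¹ (ofPath k p.2.2))) else 0

lemma antipodeOne_path (B : ArrowBimodule k Φ R) {x y : HopfQuiver R} (p : Quiver.Path x y) :
    antipodeOne B (ofPath k p) = if p.length = 1 then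
    -((((Φ (y.val⁻¹ * x.val) x.val⁻¹ x.val)⁻¹ : kˣ) : k) •
      B.r x.val⁻¹ (B.l y.val⁻¹ (ofPath k p))) else 0 := by
  rw [antipodeOne, ofPath, Module.Basis.constr_basis]
  rfl

lemma antipodeOne_mem (B : ArrowBimodule k Φ R) {x y : HopfQuiver R} (p : Quiver.Path x y) :
    antipodeOne B (ofPath k p) ∈ isotypic k R x.val⁻¹ y.val⁻¹ := by
  rw [antipodeOne_path]
  split_ifs with h
  · induction p using ofPath_cases_one with
    | @arrow x y a =>
      refine neg_mem (Submodule.smul_mem _ _ ?_)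
      have := B.r_mem x.val⁻¹ (B.l_mem y.val⁻¹ (arrow_mem_isotypic (k := k) a))
      simpa using this
    | ne p hp => exact absurd h hp
  · exact zero_mem _

/-- The quasi-antipode is obtained from the universal property of the path coalgebra, applied to the
path coalgebra with the opposite comultiplication. -/
theorem exists_isArrowAntipode (B : ArrowBimodule k Φ R) : ∃ S, IsArrowAntipode B S := by
  classical
  set f₀ := onElts k R fun g => elt k R g⁻¹ with hf₀
  have hf₀P : ∀ x : HopfQuiver R, (coord k (.nil : Quiver.Path x x) ∘ₗ f₀) ∘ₗ
      projZero k (HopfQuiver R) = coord k (.nil : Quiver.Path x x) ∘ₗ f₀ := by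
    intro x
    ext h
    simp [hf₀]
  have h01 : ∀ (z : HopfQuiver R) (ψ : PathCoalg k (HopfQuiver R) →ₗ[k] k)
      {x y : HopfQuiver R} (p : Quiver.Path x y),
      convMul ((TensorProduct.comm k _ _).toLinearMap ∘ₗ Coalgebra.comul)
        (coord k (.nil : Quiver.Path z z) ∘ₗ f₀) ψ (ofPath k p) =
      if z.val = x.val⁻¹ then ψ (ofPath k p) else 0 := by
    intro z ψ x y p
    rw [convMul_comm_comul, ← rconv_eq_convMul, (isRightCoact_path p).rconv_apply (hf₀P z),
      LinearMap.comp_apply, hf₀, onElts_elt, coord_nil_elt]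
    split_ifs <;> simp
  have h10 : ∀ (z : HopfQuiver R) (ψ : PathCoalg k (HopfQuiver R) →ₗ[k] k)
      {x y : HopfQuiver R} (p : Quiver.Path x y),
      convMul ((TensorProduct.comm k _ _).toLinearMap ∘ₗ Coalgebra.comul) ψ
        (coord k (.nil : Quiver.Path z z) ∘ₗ f₀) (ofPath k p) =
      if z.val = y.val⁻¹ then ψ (ofPath k p) else 0 := by
    intro z ψ x y p
    rw [convMul_comm_comul, ← lconv_eq_convMul, (isLeftCoact_path p).lconv_apply (hf₀P z),
      LinearMap.comp_apply, hf₀, onElts_elt, coord_nil_elt]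
    split_ifs <;> simp
  have hf₀path : ∀ {x y : HopfQuiver R} (p : Quiver.Path x y),
      f₀ (ofPath k p) = 0 ∨ f₀ (ofPath k p) = elt k R x.val⁻¹ := by
    intro x y p
    induction p using ofPath_cases with
    | nil x => exact Or.inr (onElts_elt _ x.val)
    | pos p hp => exact Or.inl (onElts_ofPath _ p hp)
  obtain ⟨S, hS, h0, h1, hdeg⟩ := exists_comulHom
    (isCoassoc_comm_comul (C := PathCoalg k (HopfQuiver R)))
    (isGradedComul_comul k (HopfQuiver R)).comm f₀ (antipodeOne B)
    (by
      intro x y p hp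
      refine hom_ext fun x y q => ?_
      rw [LinearMap.comp_apply]
      rcases hf₀path q with h | h
      · rw [h, map_zero, LinearMap.zero_apply]
      · rw [h, mem_degree_iff.mp (elt_mem_degree _) _ _ p hp, LinearMap.zero_apply])
    (by
      rintro ⟨x, y, p⟩ h
      exact onElts_ofPath _ p h)
    (by
      rintro ⟨x, y, p⟩ h
      change antipodeOne B (ofPath k p) = 0
      rw [antipodeOne_path]
      exact if_neg h)
    (by
      intro x
      refine hom_ext fun s t p => ?_
      rw [h01, LinearMap.comp_apply]
      rcases hf₀path p with h | h
      · rw [h]; simp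
      · rw [h, coord_nil_elt]; split_ifs <;> rfl)
    (by
      intro x y hxy
      refine hom_ext fun s t p => ?_
      rw [h01, LinearMap.comp_apply]
      rcases hf₀path p with h | h
      · rw [h]; simp
      · rw [h, coord_nil_elt]
        split_ifs with h1 h2
        · exact absurd (h1.trans h2.symm) hxy
        all_goals rfl)
    (by
      intro x y a
      refine hom_ext fun s t p => ?_
      rw [h01, LinearMap.comp_apply]
      split_ifs with h
      · rfl
      · rw [coord_of_mem_isotypic_left (antipodeOne_mem B p) a h])
    (by
      intro x y z a hz
      refine hom_ext fun s t p => ?_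
      rw [h01, LinearMap.comp_apply, LinearMap.zero_apply]
      split_ifs with h
      · rw [coord_of_mem_isotypic_left (antipodeOne_mem B p) a (fun e => hz (h.trans e.symm))]
      · rfl)
    (by
      intro x y a
      refine hom_ext fun s t p => ?_
      rw [h10, LinearMap.comp_apply]
      split_ifs with h
      · rfl
      · rw [coord_of_mem_isotypic_right (antipodeOne_mem B p) a h])
  have hgr : IsGradedMap S := isGradedMap_of_path fun {x y} p => hdeg ⟨x, y, p⟩
  refine ⟨S, hS, hgr, fun g => ?_, fun {x y} a => ?_⟩
  · refine eq_of_mem_degree_zero (hgr (elt_mem_degree g)) (elt_mem_degree _) fun x => ?_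
    rw [← LinearMap.comp_apply, h0, LinearMap.comp_apply, hf₀, onElts_elt]
  · have h2 : antipodeOne B (ofPath k a.toPath) =
        -((((Φ (y.val⁻¹ * x.val) x.val⁻¹ x.val)⁻¹ : kˣ) : k) •
          B.r x.val⁻¹ (B.l y.val⁻¹ (ofPath k a.toPath))) := by
      rw [antipodeOne_path]; exact if_pos rfl
    rw [← h2]
    refine eq_of_mem_degree_one (hgr (arrow_mem_degree a))
      (isotypic_le_degree _ _ (antipodeOne_mem B _)) fun x y b => ?_
    rw [← LinearMap.comp_apply, h1, LinearMap.comp_apply]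

end Antipode

/-! ### The graded Majid algebra structure of a bimodule -/

section Structure

variable {k : Type u} [Field k] {G : Type v} [Group G] {R : ConjClasses G → ℕ}
  {Φ : G → G → G → kˣ} {B : ArrowBimodule k Φ R}
  {F : PathCoalg k (HopfQuiver R) ⊗[k] PathCoalg k (HopfQuiver R) →ₗ[k] PathCoalg k (HopfQuiver R)}
  {S : PathCoalg k (HopfQuiver R) →ₗ[k] PathCoalg k (HopfQuiver R)}

lemma IsNormalizedThreeCocycle.inv_apply (hΦ : IsNormalizedThreeCocycle Φ) (g : G) :
    Φ g g⁻¹ g * Φ g⁻¹ g g⁻¹ = 1 := by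
  have := hΦ.cocycle g g⁻¹ g g⁻¹
  simpa [hΦ.one_left, hΦ.one_middle, hΦ.one_right] using this

/-- The identity that compares the two sides of the quasi-antipode on arrows. -/
lemma IsNormalizedThreeCocycle.antipode_aux (hΦ : IsNormalizedThreeCocycle Φ) (x y : G) :
    Φ y (y⁻¹ * x) x⁻¹ * Φ y y⁻¹ x * Φ (y⁻¹ * x) x⁻¹ x = Φ x x⁻¹ x := by
  have := hΦ.cocycle y (y⁻¹ * x) x⁻¹ x
  simpa [hΦ.one_left, hΦ.one_middle, hΦ.one_right] using this

namespace IsArrowAntipode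

lemma arrow_mem (hS : IsArrowAntipode B S) {x y : HopfQuiver R} (a : x ⟶ y) :
    S (ofPath k a.toPath) ∈ isotypic k R x.val⁻¹ y.val⁻¹ := by
  rw [hS.arrow]
  have := B.r_mem x.val⁻¹ (B.l_mem y.val⁻¹ (arrow_mem_isotypic (k := k) a))
  exact neg_mem (Submodule.smul_mem _ _ (by simpa using this))

/-- `S(a₁)a₂ = 0` for an arrow `a`. -/
lemma mul_arrow_left (hΦ : IsNormalizedThreeCocycle Φ) (h : IsArrowProduct B F)
    (hS : IsArrowAntipode B S) {x y : HopfQuiver R}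
    (a : x ⟶ y) : F (elt k R y.val⁻¹ ⊗ₜ ofPath k a.toPath) +
      F (S (ofPath k a.toPath) ⊗ₜ elt k R x.val) = 0 := by
  have ha := arrow_mem_isotypic (k := k) a
  have hl := B.l_mem y.val⁻¹ ha
  have h1 := B.r_r x.val⁻¹ x.val hl
  rw [inv_mul_cancel, B.r_one hl, inv_mul_cancel, hΦ.one_left, Units.val_one, one_smul] at h1
  rw [h.arrow_elt _ (hS.arrow_mem a), hS.arrow, h.elt_arrow _ ha, map_neg, map_smul,
    ← sub_eq_add_neg, sub_eq_zero]
  rw [Units.val_inv_eq_inv_val, eq_inv_smul_iff₀ (Units.ne_zero _), ← h1]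

/-- `a₁β(a₂)S(a₃) = 0` for an arrow `a`. -/
lemma mul_arrow_right (hΦ : IsNormalizedThreeCocycle Φ) (h : IsArrowProduct B F)
    (hS : IsArrowAntipode B S) {x y : HopfQuiver R} (a : x ⟶ y) :
    (((Φ y.val y.val⁻¹ y.val)⁻¹ : kˣ) : k) • F (elt k R y.val ⊗ₜ S (ofPath k a.toPath)) +
      (((Φ x.val x.val⁻¹ x.val)⁻¹ : kˣ) : k) • F (ofPath k a.toPath ⊗ₜ elt k R x.val⁻¹) = 0 := by
  have ha := arrow_mem_isotypic (k := k) a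
  have hl := B.l_mem y.val⁻¹ ha
  rw [h.elt_arrow _ (hS.arrow_mem a), hS.arrow, h.arrow_elt _ ha]
  have h1 := B.l_r y.val x.val⁻¹ hl
  have h2 := B.l_l y.val y.val⁻¹ ha
  rw [mul_inv_cancel, B.l_one ha] at h2
  rw [inv_mul_cancel, hΦ.one_middle, Units.val_one, one_smul] at h1
  have h3 := congrArg Units.val (hΦ.antipode_aux x.val y.val)
  simp only [Units.val_mul] at h3
  have h4 := congrArg (B.r x.val⁻¹) h2
  rw [map_smul, map_smul, ← h1, smul_smul] at h4
  have h5 : B.l y.val (B.r x.val⁻¹ (B.l y.val⁻¹ (ofPath k a.toPath))) =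
      ((Φ y.val y.val⁻¹ x.val * Φ y.val (y.val⁻¹ * x.val) x.val⁻¹ : k)⁻¹ *
        Φ y.val y.val⁻¹ y.val) • B.r x.val⁻¹ (ofPath k a.toPath) := by
    rw [mul_smul, ← h4, inv_smul_smul₀ (mul_ne_zero (Units.ne_zero _) (Units.ne_zero _))]
  rw [map_neg, map_smul, h5, smul_neg, smul_smul, smul_smul, ← sub_eq_neg_add, sub_eq_zero]
  congr 1
  simp only [Units.val_inv_eq_inv_val]
  rw [← h3]
  have n1 := Units.ne_zero (Φ y.val y.val⁻¹ y.val)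
  field_simp

/-- The relation `S(a₁)a₂ = ε(a)1`. The coordinates of the left side at arrows vanish by the choice
of `S` on arrows, and those at longer paths are convolution products of coordinates at shorter
ones. -/
theorem alpha (hΦ : IsNormalizedThreeCocycle Φ) (h : IsArrowProduct B F)
    (hS : IsArrowAntipode B S) (c : PathCoalg k (HopfQuiver R)) :
    F (TensorProduct.map S LinearMap.id (Coalgebra.comul (R := k) c)) =
      Coalgebra.counit (R := k) c • elt k R 1 := by
  suffices H : F ∘ₗ TensorProduct.map S LinearMap.id ∘ₗ Coalgebra.comul =
      LinearMap.toSpanSingleton k _ (elt k R 1) ∘ₗ Coalgebra.counit from LinearMap.congr_fun H c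
  have helt : ∀ g : G, F (TensorProduct.map S LinearMap.id (Coalgebra.comul (R := k) (elt k R g))) =
      elt k R 1 := by
    intro g
    rw [comul_elt, TensorProduct.map_tmul, hS.elt_inv, LinearMap.id_apply, h.elt_elt, inv_mul_cancel]
  -- The component in degree one vanishes, hence so do the components in higher degrees.
  have harrow : ∀ {x y : HopfQuiver R} (a : x ⟶ y), (coord k a.toPath ∘ₗ F) ∘ₗ
      TensorProduct.map S LinearMap.id ∘ₗ Coalgebra.comul = 0 := by
    intro x y a
    refine hom_ext fun x' y' p => ?_
    change coord k a.toPath (F (TensorProduct.map S LinearMap.id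
      (Coalgebra.comul (R := k) (ofPath k p)))) = 0
    induction p using ofPath_cases_one with
    | @arrow x y b =>
      rw [comul_arrow, map_add, map_add, TensorProduct.map_tmul, TensorProduct.map_tmul,
        ← elt_val, ← elt_val, hS.elt_inv, LinearMap.id_apply, LinearMap.id_apply,
        hS.mul_arrow_left hΦ h, map_zero]
    | ne p hp => exact coord_arrow_of_mem (h.map_comul_mem hS.graded isGradedMap_id p) hp a
  have hpos : ∀ {x y : HopfQuiver R} (p : Quiver.Path x y), p.length ≠ 0 →
      (coord k p ∘ₗ F) ∘ₗ TensorProduct.map S LinearMap.id ∘ₗ Coalgebra.comul = 0 := by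
    intro x y p hp
    cases p with
    | nil => exact absurd rfl hp
    | cons p a =>
      refine LinearMap.ext fun c => ?_
      rw [coord_cons, convMul_comp h.comul, LinearMap.comp_apply, LinearMap.comp_apply,
        convMul_antipode_left hS.comul, harrow]
      simp [lconv]
  refine hom_ext_elt (fun g => ?_) fun p hp => ?_
  · simp [helt]
  · rw [LinearMap.comp_apply, LinearMap.comp_apply, LinearMap.comp_apply, ← counit_projZero,
      projZero_ofPath_eq_zero p hp, map_zero, map_zero]
    refine ext_coord fun x y q => ?_
    by_cases hq : q.length = 0
    · rw [mem_degree_iff.mp (h.map_comul_mem hS.graded isGradedMap_id p) _ _ q (by omega), map_zero]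
    · exact (LinearMap.congr_fun (hpos q hq) (ofPath k p)).trans (map_zero _).symm

/-- The relation `a₁β(a₂)S(a₃) = β(a)1`, which holds for the same reason as the relation for
`α`. -/
theorem beta (hΦ : IsNormalizedThreeCocycle Φ) (h : IsArrowProduct B F)
    (hS : IsArrowAntipode B S) (c : PathCoalg k (HopfQuiver R)) :
    F (TensorProduct.map LinearMap.id (lconv (betaMap R Φ) S) (Coalgebra.comul (R := k) c)) =
      betaMap R Φ c • elt k R 1 := by
  suffices H : F ∘ₗ TensorProduct.map LinearMap.id (lconv (betaMap R Φ) S) ∘ₗ Coalgebra.comul =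
      LinearMap.toSpanSingleton k _ (elt k R 1) ∘ₗ betaMap R Φ from LinearMap.congr_fun H c
  have hβ : IsGradedMap (lconv (betaMap R Φ) S) := isGradedMap_lconv_betaMap Φ hS.graded
  have hβelt : ∀ g : G, lconv (betaMap R Φ) S (elt k R g) =
      (((Φ g g⁻¹ g)⁻¹ : kˣ) : k) • elt k R g⁻¹ := by
    intro g
    rw [← hS.elt_inv]
    exact lconv_betaMap_path Φ S (.nil : Quiver.Path (of R g) _)
  have harrow : ∀ {x y : HopfQuiver R} (a : x ⟶ y), (coord k a.toPath ∘ₗ F) ∘ₗ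
      TensorProduct.map LinearMap.id (lconv (betaMap R Φ) S) ∘ₗ Coalgebra.comul = 0 := by
    intro x y a
    refine hom_ext fun x' y' p => ?_
    change coord k a.toPath (F (TensorProduct.map LinearMap.id (lconv (betaMap R Φ) S)
      (Coalgebra.comul (R := k) (ofPath k p)))) = 0
    induction p using ofPath_cases_one with
    | @arrow x y b =>
      rw [comul_arrow, map_add, map_add, TensorProduct.map_tmul, TensorProduct.map_tmul,
        ← elt_val, ← elt_val, hβelt, lconv_betaMap_path, LinearMap.id_apply, LinearMap.id_apply,
        TensorProduct.tmul_smul, TensorProduct.tmul_smul, map_smul, map_smul,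
        hS.mul_arrow_right hΦ h, map_zero]
    | ne p hp => exact coord_arrow_of_mem (h.map_comul_mem isGradedMap_id hβ p) hp a
  have hpos : ∀ {x y : HopfQuiver R} (p : Quiver.Path x y), p.length ≠ 0 →
      (coord k p ∘ₗ F) ∘ₗ TensorProduct.map LinearMap.id (lconv (betaMap R Φ) S) ∘ₗ
        Coalgebra.comul = 0 := by
    intro x y p hp
    induction p with
    | nil => exact absurd rfl hp
    | cons p a ih =>
      cases p with
      | nil => exact harrow a
      | cons p b =>
        refine LinearMap.ext fun c => ?_
        rw [coord_cons, convMul_comp h.comul, LinearMap.comp_apply, LinearMap.comp_apply,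
          convMul_antipode_right (comul_comp_lconv hS.comul _), ih (by simp)]
        simp [lconv]
  refine hom_ext_elt (fun g => ?_) fun p hp => ?_
  · rw [LinearMap.comp_apply, LinearMap.comp_apply, LinearMap.comp_apply, comul_elt,
      TensorProduct.map_tmul, hβelt, LinearMap.id_apply, TensorProduct.tmul_smul, map_smul,
      h.elt_elt, mul_inv_cancel, betaMap_elt, LinearMap.toSpanSingleton_apply]
  · rw [LinearMap.comp_apply, LinearMap.comp_apply, LinearMap.comp_apply, betaMap,
      onElts_ofPath _ p hp, map_zero]
    refine ext_coord fun x y q => ?_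
    by_cases hq : q.length = 0
    · rw [← betaMap, mem_degree_iff.mp (h.map_comul_mem isGradedMap_id hβ p) _ _ q (by omega),
        map_zero]
    · exact (LinearMap.congr_fun (hpos q hq) (ofPath k p)).trans (map_zero _).symm

lemma counit_comp (hS : IsArrowAntipode B S) :
    Coalgebra.counit ∘ₗ S = (Coalgebra.counit : PathCoalg k (HopfQuiver R) →ₗ[k] k) := by
  refine hom_ext_elt (fun g => ?_) fun p hp => ?_
  · simp [hS.elt_inv]
  · rw [LinearMap.comp_apply, ← counit_projZero,
      projZero_of_mem_one (hS.graded (ofPath_mem_degree p)) hp, ← counit_projZero (ofPath k p),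
      projZero_ofPath_eq_zero p hp]

/-- The relation `Φ(a₁, β(a₂)S(a₃), a₄) = ε(a)`. Both sides are supported on `G`, where this is the
definition of `β`. -/
theorem reassoc_eq (hS : IsArrowAntipode B S) (c : PathCoalg k (HopfQuiver R)) :
    reassocMap R Φ (TensorProduct.map LinearMap.id
        (TensorProduct.map (lconv (betaMap R Φ) S) LinearMap.id ∘ₗ Coalgebra.comul)
        (Coalgebra.comul (R := k) c)) = Coalgebra.counit (R := k) c := by
  suffices H : reassocMap R Φ ∘ₗ TensorProduct.map LinearMap.id
        (TensorProduct.map (lconv (betaMap R Φ) S) LinearMap.id ∘ₗ Coalgebra.comul) ∘ₗ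
        Coalgebra.comul = Coalgebra.counit from LinearMap.congr_fun H c
  refine hom_ext_elt (fun g => ?_) fun p hp => ?_
  · have hβelt : lconv (betaMap R Φ) S (elt k R g) = (((Φ g g⁻¹ g)⁻¹ : kˣ) : k) • S (elt k R g) :=
      lconv_betaMap_path Φ S (.nil : Quiver.Path (of R g) _)
    rw [LinearMap.comp_apply, LinearMap.comp_apply, comul_elt, TensorProduct.map_tmul,
      LinearMap.comp_apply, comul_elt, TensorProduct.map_tmul, hβelt, hS.elt_inv,
      ← TensorProduct.smul_tmul', TensorProduct.tmul_smul, map_smul]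
    simp
  · rw [LinearMap.comp_apply, LinearMap.comp_apply, ← counit_projZero,
      projZero_ofPath_eq_zero p hp, map_zero]
    exact reassocMap_comul_pos Φ isGradedMap_id (isGradedMap_lconv_betaMap Φ hS.graded)
      isGradedMap_id p hp

/-- The relation for the inverse of the reassociator. Both sides are supported on `G`, where it
says that `Φ(g, g⁻¹, g)` and `Φ(g⁻¹, g, g⁻¹)` are inverse to each other. -/
theorem reassocInv_eq (hΦ : IsNormalizedThreeCocycle Φ) (hS : IsArrowAntipode B S)
    (c : PathCoalg k (HopfQuiver R)) :
    reassocMap R (fun a b c => (Φ a b c)⁻¹) (TensorProduct.map S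
        (TensorProduct.map LinearMap.id (lconv (betaMap R Φ) S) ∘ₗ Coalgebra.comul)
        (Coalgebra.comul (R := k) c)) = Coalgebra.counit (R := k) c := by
  suffices H : reassocMap R (fun a b c => (Φ a b c)⁻¹) ∘ₗ TensorProduct.map S
        (TensorProduct.map LinearMap.id (lconv (betaMap R Φ) S) ∘ₗ Coalgebra.comul) ∘ₗ
        Coalgebra.comul = Coalgebra.counit from LinearMap.congr_fun H c
  refine hom_ext_elt (fun g => ?_) fun p hp => ?_
  · have hβelt : lconv (betaMap R Φ) S (elt k R g) = (((Φ g g⁻¹ g)⁻¹ : kˣ) : k) • S (elt k R g) :=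
      lconv_betaMap_path Φ S (.nil : Quiver.Path (of R g) _)
    have h1 : (Φ g g⁻¹ g)⁻¹ = Φ g⁻¹ g g⁻¹ := inv_eq_of_mul_eq_one_right (hΦ.inv_apply g)
    rw [h1] at hβelt
    simp [comul_elt, hβelt, hS.elt_inv, TensorProduct.tmul_smul]
  · rw [LinearMap.comp_apply, LinearMap.comp_apply, ← counit_projZero,
      projZero_ofPath_eq_zero p hp, map_zero]
    exact reassocMap_comul_pos _ hS.graded isGradedMap_id
      (isGradedMap_lconv_betaMap Φ hS.graded) p hp

end IsArrowAntipode

/-- The unit of `G` is a unit for the product: `a ↦ 1a` respects the comultiplications and is the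
identity in degrees zero and one. -/
lemma IsArrowProduct.one_mul (h : IsArrowProduct B F) (a : PathCoalg k (HopfQuiver R)) :
    F (elt k R 1 ⊗ₜ a) = a := by
  suffices H : F ∘ₗ TensorProduct.mk k _ _ (elt k R 1) = LinearMap.id from LinearMap.congr_fun H a
  refine comulHom_ext (Δ := Coalgebra.comul) ?_ (by simp) ?_ ?_
  · refine LinearMap.ext fun c => ?_
    have := LinearMap.congr_fun h.comul (elt k R 1 ⊗ₜ c)
    simp only [LinearMap.comp_apply, TensorProduct.mk_apply] at this ⊢
    rw [this, TensorProduct.comul_tmul, comul_elt]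
    generalize Coalgebra.comul (R := k) c = t
    induction t with
    | zero => simp
    | add s t hs ht => simp only [TensorProduct.tmul_add, map_add, hs, ht]
    | tmul x y => simp
  · intro x
    refine hom_ext_elt (fun g => ?_) fun p hp => ?_
    · simp [h.elt_elt]
    · rw [LinearMap.comp_apply, LinearMap.comp_apply, LinearMap.comp_apply, LinearMap.id_apply,
        coord_nil_of_mem (ofPath_mem_degree p) hp]
      have := h.mul_mem (elt_mem_degree 1) (ofPath_mem_degree (k := k) p)
      exact coord_nil_of_mem this (by omega) x
  · intro x y a
    refine hom_ext fun x' y' p => ?_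
    rw [LinearMap.comp_apply, LinearMap.comp_apply, LinearMap.comp_apply, LinearMap.id_apply,
      TensorProduct.mk_apply]
    induction p using ofPath_cases_one with
    | arrow b =>
      rw [h.elt_arrow _ (arrow_mem_isotypic b), B.l_one (arrow_mem_isotypic b)]
    | ne p hp =>
      have := h.mul_mem (elt_mem_degree 1) (ofPath_mem_degree (k := k) p)
      rw [coord_arrow_of_mem (ofPath_mem_degree p) hp, coord_arrow_of_mem this (by omega)]

lemma IsArrowProduct.mul_one (h : IsArrowProduct B F) (a : PathCoalg k (HopfQuiver R)) :
    F (a ⊗ₜ elt k R 1) = a := by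
  suffices H : F ∘ₗ (TensorProduct.mk k _ _).flip (elt k R 1) = LinearMap.id from
    LinearMap.congr_fun H a
  refine comulHom_ext (Δ := Coalgebra.comul) ?_ (by simp) ?_ ?_
  · refine LinearMap.ext fun c => ?_
    have := LinearMap.congr_fun h.comul (c ⊗ₜ elt k R 1)
    simp only [LinearMap.comp_apply, LinearMap.flip_apply, TensorProduct.mk_apply] at this ⊢
    rw [this, TensorProduct.comul_tmul, comul_elt]
    generalize Coalgebra.comul (R := k) c = t
    induction t with
    | zero => simp
    | add s t hs ht => simp only [TensorProduct.add_tmul, map_add, hs, ht]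
    | tmul x y => simp
  · intro x
    refine hom_ext_elt (fun g => ?_) fun p hp => ?_
    · simp [h.elt_elt]
    · rw [LinearMap.comp_apply, LinearMap.comp_apply, LinearMap.comp_apply, LinearMap.id_apply,
        coord_nil_of_mem (ofPath_mem_degree p) hp]
      have := h.mul_mem (ofPath_mem_degree (k := k) p) (elt_mem_degree 1)
      exact coord_nil_of_mem this (by omega) x
  · intro x y a
    refine hom_ext fun x' y' p => ?_
    rw [LinearMap.comp_apply, LinearMap.comp_apply, LinearMap.comp_apply, LinearMap.id_apply,
      LinearMap.flip_apply, TensorProduct.mk_apply]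
    induction p using ofPath_cases_one with
    | arrow b =>
      rw [h.arrow_elt _ (arrow_mem_isotypic b), B.r_one (arrow_mem_isotypic b)]
    | ne p hp =>
      have := h.mul_mem (ofPath_mem_degree (k := k) p) (elt_mem_degree 1)
      rw [coord_arrow_of_mem (ofPath_mem_degree p) hp, coord_arrow_of_mem this (by omega)]

/-- Every bimodule structure on the arrows comes from a graded Majid algebra structure on the path
coalgebra. -/
theorem exists_hopfQuiverMajid (hΦ : IsNormalizedThreeCocycle Φ) (B : ArrowBimodule k Φ R) :
    ∃ A : HopfQuiverMajid Φ R, IsArrowProduct B A.mul.toLinearMap := by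
  obtain ⟨F, h⟩ := exists_isArrowProduct B
  obtain ⟨S, hS⟩ := exists_isArrowAntipode B
  let A : MajidAlgebra k (PathCoalg k (HopfQuiver R)) :=
    { mul := h.coalgHom
      one := elt k R 1
      reassoc := reassocMap R Φ
      reassocInv := reassocMap R fun a b c => (Φ a b c)⁻¹
      antipode := S
      alpha := Coalgebra.counit
      beta := betaMap R Φ
      isGroupLikeElem_one := ⟨counit_elt 1, comul_elt 1⟩
      one_mul := h.one_mul
      mul_one := h.mul_one
      reassoc_conv_inv := lconv_reassocMap_reassocMap fun a b c => mul_inv_cancel (Φ a b c)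
      inv_conv_reassoc := lconv_reassocMap_reassocMap fun a b c => inv_mul_cancel (Φ a b c)
      quasi_assoc := h.quasi_assoc
      pentagon := h.pentagon hΦ
      reassoc_one := by
        intro a b
        have : reassocMap R Φ ∘ₗ TensorProduct.map LinearMap.id
            (TensorProduct.mk k _ _ (elt k R 1)) =
            LinearMap.mul' k k ∘ₗ TensorProduct.map Coalgebra.counit Coalgebra.counit := by
          refine hom_ext_tensor fun _ _ p _ _ q => ?_
          rw [LinearMap.comp_apply, LinearMap.comp_apply, TensorProduct.map_tmul,
            TensorProduct.map_tmul, LinearMap.id_apply, TensorProduct.mk_apply,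
            LinearMap.mul'_apply, ← counit_projZero, ← counit_projZero (ofPath k q),
            ← reassocMap_projZero, projZero_elt, projZero_ofPath, projZero_ofPath]
          split_ifs with h1 h2
          · induction p using ofPath_cases with
            | nil x =>
              induction q using ofPath_cases with
              | nil y =>
                change reassocMap R Φ (elt k R x.val ⊗ₜ (elt k R 1 ⊗ₜ elt k R y.val)) =
                  Coalgebra.counit (elt k R x.val) * Coalgebra.counit (elt k R y.val)
                simp [hΦ.one_middle]
              | pos q hq => exact absurd h2 hq
            | pos p hp => exact absurd h1 hp
          all_goals simp
        exact LinearMap.congr_fun this (a ⊗ₜ b)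
      counit_antipode := hS.counit_comp
      comul_antipode := hS.comul
      antipode_alpha := fun a => by
        rw [lconv_counit]
        exact hS.alpha hΦ h a
      beta_antipode := fun a => hS.beta hΦ h a
      reassoc_antipode := fun a => by
        rw [lconv_counit]
        exact hS.reassoc_eq a
      reassocInv_antipode := fun a => by
        rw [lconv_counit]
        exact hS.reassocInv_eq hΦ a }
  exact ⟨{ toMajidAlgebra := A
           isGraded :=
            { mul_mem := h.mul_mem
              one_mem := elt_mem_degree 1
              reassoc_eq_zero := reassocMap_of_mem Φ
              antipode_mem := hS.graded
              alpha_eq_zero := fun {i a} ha hi => by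
                change Coalgebra.counit (R := k) a = 0
                rw [← counit_projZero, projZero_of_mem_one ha hi, map_zero]
              beta_eq_zero := fun {i a} ha hi => by
                change betaMap R Φ a = 0
                rw [betaMap, onElts_of_mem _ ha hi] }
           mul_elt := fun g g' => h.elt_elt g g'
           one_eq := rfl
           reassoc_elt := reassocMap_elt Φ
           antipode_elt := hS.elt_inv
           alpha_elt := fun g => counit_elt g
           beta_elt := betaMap_elt Φ }, h⟩

end Structure

/-! ### The bimodule of a graded Majid algebra structure, and isomorphisms -/

section FromMajid

variable {k : Type u} [Field k] {G : Type v} [Group G] {R : ConjClasses G → ℕ}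
  {Φ : G → G → G → kˣ}

namespace HopfQuiverMajid

variable (A : HopfQuiverMajid Φ R)

lemma reassoc_eq_reassocMap : A.reassoc = reassocMap R Φ :=
  eq_reassocMap A.isGraded.reassoc_eq_zero A.reassoc_elt

lemma alpha_eq_counit : A.alpha = Coalgebra.counit :=
  hom_ext_elt (fun g => by rw [A.alpha_elt, counit_elt]) fun p hp => by
    rw [A.isGraded.alpha_eq_zero (ofPath_mem_degree p) hp, ← counit_projZero,
      projZero_ofPath_eq_zero p hp, map_zero]

lemma beta_eq_betaMap : A.beta = betaMap R Φ :=
  hom_ext_elt (fun g => by rw [A.beta_elt, betaMap_elt]) fun p hp => by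
    rw [A.isGraded.beta_eq_zero (ofPath_mem_degree p) hp, betaMap, onElts_ofPath _ p hp]

lemma comul_mul (a b : PathCoalg k (HopfQuiver R)) :
    Coalgebra.comul (R := k) (A.mul (a ⊗ₜ b)) =
      TensorProduct.map A.mul.toLinearMap A.mul.toLinearMap
        (Coalgebra.comul (R := k) (a ⊗ₜ[k] b)) :=
  (LinearMap.congr_fun A.mul.map_comp_comul (a ⊗ₜ b)).symm

lemma mul_elt_mem (g : G) {x y : G} {m : PathCoalg k (HopfQuiver R)}
    (hm : m ∈ isotypic k R y x) : A.mul (elt k R g ⊗ₜ m) ∈ isotypic k R (g * y) (g * x) := by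
  refine mem_isotypic.mpr ⟨?_, ?_⟩
  · rw [← zero_add 1]
    exact A.isGraded.mul_mem (elt_mem_degree g) (isotypic_le_degree _ _ hm)
  · rw [comul_mul, TensorProduct.comul_tmul, comul_elt, (mem_isotypic.mp hm).2]
    simp [TensorProduct.tmul_add, A.mul_elt]

lemma elt_mul_mem (g : G) {x y : G} {m : PathCoalg k (HopfQuiver R)}
    (hm : m ∈ isotypic k R y x) : A.mul (m ⊗ₜ elt k R g) ∈ isotypic k R (y * g) (x * g) := by
  refine mem_isotypic.mpr ⟨?_, ?_⟩
  · rw [← add_zero 1]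
    exact A.isGraded.mul_mem (isotypic_le_degree _ _ hm) (elt_mem_degree g)
  · rw [comul_mul, TensorProduct.comul_tmul, comul_elt, (mem_isotypic.mp hm).2]
    simp [TensorProduct.add_tmul, A.mul_elt]

lemma quasi_assoc_apply {a b c a₀ b₀ c₀ a₁ b₁ c₁ : PathCoalg k (HopfQuiver R)}
    (ha : IsRightCoact (projZero k (HopfQuiver R)) a a₀)
    (hb : IsRightCoact (projZero k (HopfQuiver R)) b b₀)
    (hc : IsRightCoact (projZero k (HopfQuiver R)) c c₀)
    (ha' : IsLeftCoact (projZero k (HopfQuiver R)) a a₁)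
    (hb' : IsLeftCoact (projZero k (HopfQuiver R)) b b₁)
    (hc' : IsLeftCoact (projZero k (HopfQuiver R)) c c₁) :
    reassocMap R Φ (a₀ ⊗ₜ (b₀ ⊗ₜ c₀)) • A.mul (a ⊗ₜ A.mul (b ⊗ₜ c)) =
      reassocMap R Φ (a₁ ⊗ₜ (b₁ ⊗ₜ c₁)) • A.mul (A.mul (a ⊗ₜ b) ⊗ₜ c) := by
  have h := LinearMap.congr_fun A.quasi_assoc (a ⊗ₜ (b ⊗ₜ c))
  rw [A.reassoc_eq_reassocMap, (ha.tmul (hb.tmul hc)).rconv_apply (reassocMap_comp_projZero Φ),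
    (ha'.tmul (hb'.tmul hc')).lconv_apply (reassocMap_comp_projZero Φ)] at h
  exact h

/-- The bimodule structure on the arrows given by the product. -/
def arrowBimodule : ArrowBimodule k Φ R where
  l g := A.mul.toLinearMap ∘ₗ TensorProduct.mk k _ _ (elt k R g)
  r g := A.mul.toLinearMap ∘ₗ (TensorProduct.mk k _ _).flip (elt k R g)
  l_mem g _ _ _ hm := A.mul_elt_mem g hm
  r_mem g _ _ _ hm := A.elt_mul_mem g hm
  l_one _ := by
    rw [← A.one_eq]
    exact A.one_mul _
  r_one _ := by
    rw [← A.one_eq]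
    exact A.mul_one _
  l_l e f x y m hm := by
    have := A.quasi_assoc_apply (isRightCoact_elt e) (isRightCoact_elt f)
      (IsRightCoact.of_mem_isotypic hm) (isLeftCoact_elt e) (isLeftCoact_elt f)
      (IsLeftCoact.of_mem_isotypic hm)
    rwa [reassocMap_elt, reassocMap_elt, A.mul_elt] at this
  l_r e f x y m hm := by
    have := A.quasi_assoc_apply (isRightCoact_elt e) (IsRightCoact.of_mem_isotypic hm)
      (isRightCoact_elt f) (isLeftCoact_elt e) (IsLeftCoact.of_mem_isotypic hm)
      (isLeftCoact_elt f)
    rwa [reassocMap_elt, reassocMap_elt] at this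
  r_r e f x y m hm := by
    have := A.quasi_assoc_apply (IsRightCoact.of_mem_isotypic hm) (isRightCoact_elt e)
      (isRightCoact_elt f) (IsLeftCoact.of_mem_isotypic hm) (isLeftCoact_elt e)
      (isLeftCoact_elt f)
    rwa [reassocMap_elt, reassocMap_elt, A.mul_elt] at this

lemma arrowBimodule_r (g : G) (m : PathCoalg k (HopfQuiver R)) :
    A.arrowBimodule.r g m = A.mul (m ⊗ₜ elt k R g) := rfl

/-- The antipode reverses the coactions. -/
lemma antipode_mem_isotypic {x y : G} {m : PathCoalg k (HopfQuiver R)}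
    (hm : m ∈ isotypic k R y x) : A.antipode m ∈ isotypic k R x⁻¹ y⁻¹ := by
  refine mem_isotypic.mpr ⟨A.isGraded.antipode_mem (isotypic_le_degree _ _ hm), ?_⟩
  rw [← LinearMap.comp_apply, A.comul_antipode, LinearMap.comp_apply, LinearMap.comp_apply,
    (mem_isotypic.mp hm).2]
  simp [A.antipode_elt, add_comm]

/-- `S(m₁)m₂ = 0` in degree one. -/
lemma antipode_arrow {x y : G} {m : PathCoalg k (HopfQuiver R)} (hm : m ∈ isotypic k R y x) :
    A.mul (A.antipode m ⊗ₜ elt k R x) = -A.mul (elt k R y⁻¹ ⊗ₜ m) := by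
  have h := A.antipode_alpha m
  rw [A.alpha_eq_counit, lconv_counit, (mem_isotypic.mp hm).2, ← counit_projZero,
    projZero_of_mem_one (isotypic_le_degree _ _ hm) one_ne_zero] at h
  simp only [map_add, TensorProduct.map_tmul, A.antipode_elt, LinearMap.id_apply, map_zero,
    zero_smul] at h
  exact eq_neg_of_add_eq_zero_right h

end HopfQuiverMajid

/-- The right action of a group element is injective on every isotypic component. -/
lemma ArrowBimodule.r_injective (B : ArrowBimodule k Φ R) (g : G) {x y : G}
    {m m' : PathCoalg k (HopfQuiver R)} (hm : m ∈ isotypic k R y x) (hm' : m' ∈ isotypic k R y x)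
    (h : B.r g m = B.r g m') : m = m' := by
  have h1 := B.r_r g g⁻¹ hm
  rw [h, ← B.r_r g g⁻¹ hm', mul_inv_cancel, B.r_one hm, B.r_one hm'] at h1
  exact smul_right_injective _ (Units.ne_zero _) h1

/-- A linear endomorphism of the space of arrows which respects the coactions extends to the path
coalgebra. -/
lemma exists_arrowLift {f : PathCoalg k (HopfQuiver R) →ₗ[k] PathCoalg k (HopfQuiver R)}
    (hf : ∀ {x y : G} {m : PathCoalg k (HopfQuiver R)}, m ∈ isotypic k R y x →
      f m ∈ isotypic k R y x) :
    ∃ φ : PathCoalg k (HopfQuiver R) →ₗ[k] PathCoalg k (HopfQuiver R),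
      Coalgebra.comul ∘ₗ φ = TensorProduct.map φ φ ∘ₗ Coalgebra.comul ∧ IsGradedMap φ ∧
      (∀ g : G, φ (elt k R g) = elt k R g) ∧
      ∀ {x y : G} {m : PathCoalg k (HopfQuiver R)}, m ∈ isotypic k R y x → φ m = f m := by
  classical
  set f₁ := f ∘ₗ projOne k (HopfQuiver R) with hf₁
  have hf₁0 : ∀ {x y : HopfQuiver R} (p : Quiver.Path x y), p.length ≠ 1 →
      f₁ (ofPath k p) = 0 := by
    intro x y p hp
    rw [hf₁, LinearMap.comp_apply, projOne_ofPath, if_neg hp, map_zero]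
  have hf₁m : ∀ {x y : HopfQuiver R} (p : Quiver.Path x y),
      f₁ (ofPath k p) ∈ isotypic k R y.val x.val := by
    intro x y p
    induction p using ofPath_cases_one with
    | arrow a =>
      rw [hf₁, LinearMap.comp_apply, projOne_of_mem (arrow_mem_degree a)]
      exact hf (arrow_mem_isotypic a)
    | ne p hp => rw [hf₁0 p hp]; exact zero_mem _
  obtain ⟨φ, hφ, h0, h1, hdeg⟩ := exists_comulHom
    (isCoassoc_comul (C := PathCoalg k (HopfQuiver R)))
    (isGradedComul_comul k (HopfQuiver R)) (projZero k (HopfQuiver R)) f₁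
    (by
      intro x y p hp
      refine hom_ext_elt (fun g => ?_) fun q hq => ?_
      · rw [LinearMap.comp_apply, projZero_elt, mem_degree_iff.mp (elt_mem_degree _) _ _ p hp,
          LinearMap.zero_apply]
      · rw [LinearMap.comp_apply, projZero_ofPath_eq_zero q hq, map_zero, LinearMap.zero_apply])
    (by
      rintro ⟨x, y, p⟩ h
      exact projZero_ofPath_eq_zero p h)
    (by
      rintro ⟨x, y, p⟩ h
      exact hf₁0 p h)
    (by
      intro x
      rw [coord_nil_comp_projZero, convMul_coord_nil_self])
    (by
      intro x y hxy
      rw [coord_nil_comp_projZero, coord_nil_comp_projZero, convMul_coord_nil_ne _ hxy])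
    (by
      intro x y a
      refine hom_ext fun s t p => ?_
      rw [coord_nil_comp_projZero, convMul_apply_ofPath (coord_nil_comp_projZero _),
        LinearMap.comp_apply, ← elt_val, coord_nil_elt]
      split_ifs with h
      · rw [one_mul]
      · rw [coord_of_mem_isotypic_left (hf₁m p) a h, mul_zero])
    (by
      intro x y z a hz
      refine hom_ext fun s t p => ?_
      rw [coord_nil_comp_projZero, convMul_apply_ofPath (coord_nil_comp_projZero _),
        LinearMap.comp_apply, ← elt_val, coord_nil_elt, LinearMap.zero_apply]
      split_ifs with h
      · rw [coord_of_mem_isotypic_left (hf₁m p) a (fun e => hz (h.trans e.symm)), mul_zero]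
      · rw [zero_mul])
    (by
      intro x y a
      refine hom_ext fun s t p => ?_
      rw [coord_nil_comp_projZero, ← rconv_eq_convMul,
        (isRightCoact_path p).rconv_apply (coord_nil_comp_projZero _),
        LinearMap.comp_apply, coord_nil_elt]
      split_ifs with h
      · rw [one_smul]
      · rw [coord_of_mem_isotypic_right (hf₁m p) a h, smul_zero])
  have hgr : IsGradedMap φ := isGradedMap_of_path fun {x y} p => hdeg ⟨x, y, p⟩
  refine ⟨φ, hφ, hgr, fun g => ?_, fun {x y m} hm => ?_⟩
  · refine eq_of_mem_degree_zero (hgr (elt_mem_degree g)) (elt_mem_degree _) fun x => ?_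
    rw [← LinearMap.comp_apply, h0, coord_nil_comp_projZero]
  · refine eq_of_mem_degree_one (hgr (isotypic_le_degree _ _ hm))
      (isotypic_le_degree _ _ (hf hm)) fun x y b => ?_
    rw [← LinearMap.comp_apply, h1, LinearMap.comp_apply, hf₁, LinearMap.comp_apply,
      projOne_of_mem (isotypic_le_degree _ _ hm)]

/-- A coalgebra endomorphism of the path coalgebra that fixes the vertices and the arrows is the
identity. -/
lemma eq_id_of_arrow {φ : PathCoalg k (HopfQuiver R) →ₗ[k] PathCoalg k (HopfQuiver R)}
    (hφ : Coalgebra.comul ∘ₗ φ = TensorProduct.map φ φ ∘ₗ Coalgebra.comul) (hgr : IsGradedMap φ)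
    (h0 : ∀ g : G, φ (elt k R g) = elt k R g)
    (h1 : ∀ {x y : HopfQuiver R} (a : x ⟶ y), φ (ofPath k a.toPath) = ofPath k a.toPath) :
    φ = LinearMap.id := by
  refine comulHom_ext hφ (by simp) (fun x => ?_) fun x y a => ?_
  · refine hom_ext_elt (fun g => ?_) fun p hp => ?_
    · rw [LinearMap.comp_apply, h0]; rfl
    · rw [LinearMap.comp_apply, LinearMap.comp_apply, LinearMap.id_apply,
        coord_nil_of_mem (ofPath_mem_degree p) hp, coord_nil_of_mem (hgr (ofPath_mem_degree p)) hp]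
  · refine hom_ext fun x' y' p => ?_
    rw [LinearMap.comp_apply, LinearMap.comp_apply, LinearMap.id_apply]
    induction p using ofPath_cases_one with
    | arrow b => rw [h1]
    | ne p hp => rw [coord_arrow_of_mem (ofPath_mem_degree p) hp,
        coord_arrow_of_mem (hgr (ofPath_mem_degree p)) hp]

lemma projZero_comp_of_graded {φ : PathCoalg k (HopfQuiver R) →ₗ[k] PathCoalg k (HopfQuiver R)}
    (hgr : IsGradedMap φ) (h0 : ∀ g : G, φ (elt k R g) = elt k R g)
    (a : PathCoalg k (HopfQuiver R)) :
    projZero k (HopfQuiver R) (φ a) = projZero k (HopfQuiver R) a := by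
  suffices H : projZero k (HopfQuiver R) ∘ₗ φ = projZero k (HopfQuiver R) from
    LinearMap.congr_fun H a
  refine hom_ext_elt (fun g => ?_) fun p hp => ?_
  · rw [LinearMap.comp_apply, h0]
  · rw [LinearMap.comp_apply, projZero_ofPath_eq_zero p hp,
      projZero_of_mem_one (hgr (ofPath_mem_degree p)) hp]

/-- A bimodule isomorphism between the spaces of arrows extends to an isomorphism of graded Majid
algebras. -/
theorem HopfQuiverMajid.isomorphic_of_arrow {A A' : HopfQuiverMajid Φ R}
    {f f' : PathCoalg k (HopfQuiver R) →ₗ[k] PathCoalg k (HopfQuiver R)}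
    (hf : ∀ {x y : G} {m : PathCoalg k (HopfQuiver R)}, m ∈ isotypic k R y x →
      f m ∈ isotypic k R y x)
    (hf' : ∀ {x y : G} {m : PathCoalg k (HopfQuiver R)}, m ∈ isotypic k R y x →
      f' m ∈ isotypic k R y x)
    (hff' : ∀ {x y : G} {m : PathCoalg k (HopfQuiver R)}, m ∈ isotypic k R y x → f (f' m) = m)
    (hf'f : ∀ {x y : G} {m : PathCoalg k (HopfQuiver R)}, m ∈ isotypic k R y x → f' (f m) = m)
    (hl : ∀ (g : G) {x y : G} {m : PathCoalg k (HopfQuiver R)}, m ∈ isotypic k R y x →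
      f (A.mul (elt k R g ⊗ₜ m)) = A'.mul (elt k R g ⊗ₜ f m))
    (hr : ∀ (g : G) {x y : G} {m : PathCoalg k (HopfQuiver R)}, m ∈ isotypic k R y x →
      f (A.mul (m ⊗ₜ elt k R g)) = A'.mul (f m ⊗ₜ elt k R g)) :
    HopfQuiverMajid.Isomorphic A A' := by
  obtain ⟨φ, hφ, hφg, hφ0, hφ1⟩ := exists_arrowLift hf
  obtain ⟨ψ, hψ, hψg, hψ0, hψ1⟩ := exists_arrowLift hf'
  have comp_comul : ∀ {φ ψ : PathCoalg k (HopfQuiver R) →ₗ[k] PathCoalg k (HopfQuiver R)},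
      Coalgebra.comul ∘ₗ φ = TensorProduct.map φ φ ∘ₗ Coalgebra.comul →
      Coalgebra.comul ∘ₗ ψ = TensorProduct.map ψ ψ ∘ₗ Coalgebra.comul →
      Coalgebra.comul ∘ₗ (φ ∘ₗ ψ) = TensorProduct.map (φ ∘ₗ ψ) (φ ∘ₗ ψ) ∘ₗ Coalgebra.comul := by
    intro φ ψ hφ hψ
    rw [← LinearMap.comp_assoc, hφ, LinearMap.comp_assoc, hψ, TensorProduct.map_comp,
      LinearMap.comp_assoc]
  have hφψ : φ ∘ₗ ψ = LinearMap.id := by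
    refine eq_id_of_arrow (comp_comul hφ hψ) (fun ha => hφg (hψg ha)) (fun g => ?_) fun a => ?_
    · rw [LinearMap.comp_apply, hψ0, hφ0]
    · have ha := arrow_mem_isotypic (k := k) a
      rw [LinearMap.comp_apply, hψ1 ha, hφ1 (hf' ha), hff' ha]
  have hψφ : ψ ∘ₗ φ = LinearMap.id := by
    refine eq_id_of_arrow (comp_comul hψ hφ) (fun ha => hψg (hφg ha)) (fun g => ?_) fun a => ?_
    · rw [LinearMap.comp_apply, hφ0, hψ0]
    · have ha := arrow_mem_isotypic (k := k) a
      rw [LinearMap.comp_apply, hφ1 ha, hψ1 (hf ha), hf'f ha]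
  let φc : PathCoalg k (HopfQuiver R) →ₗc[k] PathCoalg k (HopfQuiver R) :=
    { φ with
      counit_comp := by
        refine LinearMap.ext fun a => ?_
        change Coalgebra.counit (R := k) (φ a) = _
        rw [← counit_projZero, projZero_comp_of_graded hφg hφ0, counit_projZero]
      map_comp_comul := hφ.symm }
  let e : PathCoalg k (HopfQuiver R) ≃ₗc[k] PathCoalg k (HopfQuiver R) :=
    CoalgEquiv.ofBijective (f := φc) (Function.bijective_iff_has_inverse.2
      ⟨ψ, LinearMap.congr_fun hψφ, LinearMap.congr_fun hφψ⟩)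
  have he : ∀ a, e a = φ a := fun a => rfl
  have hmul : φ ∘ₗ A.mul.toLinearMap = A'.mul.toLinearMap ∘ₗ TensorProduct.map φ φ := by
    refine comulHom_ext (Δ := Coalgebra.comul) (φc.comp A.mul).map_comp_comul.symm
      (A'.mul.comp (Coalgebra.TensorProduct.map φc φc)).map_comp_comul.symm
      (fun x => ?_) fun x y a => ?_
    · refine hom_ext_tensor fun x' y' p x'' y'' q => ?_
      by_cases h : p.length + q.length = 0
      · induction p using ofPath_cases with
        | nil g =>
          induction q using ofPath_cases with
          | nil g' =>
            change coord k _ (φ (A.mul (elt k R g.val ⊗ₜ elt k R g'.val))) =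
              coord k _ (A'.mul (φ (elt k R g.val) ⊗ₜ φ (elt k R g'.val)))
            rw [A.mul_elt, hφ0, hφ0, hφ0, A'.mul_elt]
          | pos q hq => omega
        | pos p hp => omega
      · exact (coord_nil_of_mem (hφg (A.isGraded.mul_mem (ofPath_mem_degree p)
          (ofPath_mem_degree q))) h x).trans (coord_nil_of_mem (A'.isGraded.mul_mem
            (hφg (ofPath_mem_degree p)) (hφg (ofPath_mem_degree q))) h x).symm
    · refine hom_ext_tensor fun x' y' p x'' y'' q => ?_
      induction p, q using ofPath_pair_cases with
      | nil_arrow g b =>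
        have hb := arrow_mem_isotypic (k := k) b
        change coord k _ (φ (A.mul (elt k R g.val ⊗ₜ ofPath k b.toPath))) =
          coord k _ (A'.mul (φ (elt k R g.val) ⊗ₜ φ (ofPath k b.toPath)))
        rw [hφ1 (A.mul_elt_mem _ hb), hl _ hb, hφ0, hφ1 hb]
      | arrow_nil g b =>
        have hb := arrow_mem_isotypic (k := k) b
        change coord k _ (φ (A.mul (ofPath k b.toPath ⊗ₜ elt k R g.val))) =
          coord k _ (A'.mul (φ (ofPath k b.toPath) ⊗ₜ φ (elt k R g.val)))
        rw [hφ1 (A.elt_mul_mem _ hb), hr _ hb, hφ0, hφ1 hb]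
      | ne p q h =>
        exact (coord_arrow_of_mem (hφg (A.isGraded.mul_mem (ofPath_mem_degree p)
          (ofPath_mem_degree q))) h a).trans (coord_arrow_of_mem (A'.isGraded.mul_mem
            (hφg (ofPath_mem_degree p)) (hφg (ofPath_mem_degree q))) h a).symm
  have hS : φ ∘ₗ A.antipode = A'.antipode ∘ₗ φ := by
    refine comulHom_ext (Δ := (TensorProduct.comm k _ _).toLinearMap ∘ₗ Coalgebra.comul) ?_ ?_
      (fun x => ?_) fun x y a => ?_
    · rw [← LinearMap.comp_assoc, hφ, LinearMap.comp_assoc, A.comul_antipode,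
        TensorProduct.map_comp, LinearMap.comp_assoc]
    · rw [← LinearMap.comp_assoc, A'.comul_antipode, LinearMap.comp_assoc, LinearMap.comp_assoc, hφ,
        TensorProduct.map_comp, LinearMap.comp_assoc,
        ← LinearMap.comp_assoc _ (TensorProduct.map φ φ), ← TensorProduct.map_comp_comm_eq]
      rfl
    · refine hom_ext_elt (fun g => ?_) fun p hp => ?_
      · rw [LinearMap.comp_apply, LinearMap.comp_apply, LinearMap.comp_apply, LinearMap.comp_apply,
          A.antipode_elt, hφ0, hφ0, A'.antipode_elt]
      · exact (coord_nil_of_mem (hφg (A.isGraded.antipode_mem (ofPath_mem_degree p))) hp x).trans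
          (coord_nil_of_mem (A'.isGraded.antipode_mem (hφg (ofPath_mem_degree p))) hp x).symm
    · refine hom_ext fun x' y' p => ?_
      induction p using ofPath_cases_one with
      | @arrow x y b =>
        have hb := arrow_mem_isotypic (k := k) b
        rw [LinearMap.comp_apply, LinearMap.comp_apply, LinearMap.comp_apply, LinearMap.comp_apply]
        congr 1
        rw [hφ1 (A.antipode_mem_isotypic hb), hφ1 hb]
        refine A'.arrowBimodule.r_injective x.val (hf (A.antipode_mem_isotypic hb))
          (A'.antipode_mem_isotypic (hf hb)) ?_
        rw [A'.arrowBimodule_r, A'.arrowBimodule_r, ← hr _ (A.antipode_mem_isotypic hb),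
          A.antipode_arrow hb, A'.antipode_arrow (hf hb), map_neg, hl _ hb]
      | ne p hp =>
        exact (coord_arrow_of_mem (hφg (A.isGraded.antipode_mem (ofPath_mem_degree p))) hp a).trans
          (coord_arrow_of_mem (A'.isGraded.antipode_mem (hφg (ofPath_mem_degree p))) hp a).symm
  refine ⟨e, ⟨fun a b => ?_, ?_, fun a b c => ?_, fun a => ?_, fun a => ?_, fun a => ?_⟩,
    fun n a => ⟨fun h => ?_, fun h => hφg h⟩, fun g => hφ0 g⟩
  · exact LinearMap.congr_fun hmul (a ⊗ₜ b)
  · rw [he, A.one_eq, A'.one_eq, hφ0]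
  · rw [he, he, he, A.reassoc_eq_reassocMap, A'.reassoc_eq_reassocMap, ← reassocMap_projZero,
      ← reassocMap_projZero Φ (φ a), projZero_comp_of_graded hφg hφ0,
      projZero_comp_of_graded hφg hφ0, projZero_comp_of_graded hφg hφ0]
  · exact LinearMap.congr_fun hS a
  · rw [he, A.alpha_eq_counit, A'.alpha_eq_counit, ← counit_projZero, ← counit_projZero (φ a),
      projZero_comp_of_graded hφg hφ0]
  · rw [he, A.beta_eq_betaMap, A'.beta_eq_betaMap, betaMap, ← onElts_projZero _ a,
      ← onElts_projZero _ (φ a), projZero_comp_of_graded hφg hφ0]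
  · have := hψg h
    rw [he, ← LinearMap.comp_apply, hψφ] at this
    exact this

end FromMajid

/-! ### Projective representations attached to a graded Majid algebra structure -/

section Attached

variable {k : Type u} [Field k] {G : Type v} [Group G] {R : ConjClasses G → ℕ}
  {Φ : G → G → G → kˣ}

namespace ArrowBimodule

variable (B : ArrowBimodule k Φ R)

lemma l_l_eq (e f : G) {x y : G} {m : PathCoalg k (HopfQuiver R)} (hm : m ∈ isotypic k R y x) :
    B.l e (B.l f m) = (Φ e f y / Φ e f x) • B.l (e * f) m := by
  rw [div_eq_inv_mul, mul_smul, eq_inv_smul_iff]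
  exact B.l_l e f hm

lemma l_r_eq (e f : G) {x y : G} {m : PathCoalg k (HopfQuiver R)} (hm : m ∈ isotypic k R y x) :
    B.l e (B.r f m) = (Φ e y f / Φ e x f) • B.r f (B.l e m) := by
  rw [div_eq_inv_mul, mul_smul, eq_inv_smul_iff]
  exact B.l_r e f hm

lemma r_r_eq (e f : G) {x y : G} {m : PathCoalg k (HopfQuiver R)} (hm : m ∈ isotypic k R y x) :
    B.r f (B.r e m) = (Φ x e f / Φ y e f) • B.r (e * f) m := by
  rw [div_eq_inv_mul, mul_smul, eq_inv_smul_iff]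
  exact (B.r_r e f hm).symm

lemma l_injective (g : G) {x y : G} {m m' : PathCoalg k (HopfQuiver R)}
    (hm : m ∈ isotypic k R y x) (hm' : m' ∈ isotypic k R y x)
    (h : B.l g m = B.l g m') : m = m' := by
  have h1 := B.l_l g⁻¹ g hm
  rw [h, B.l_l g⁻¹ g hm', inv_mul_cancel, B.l_one hm, B.l_one hm'] at h1
  exact (smul_right_injective _ (Units.ne_zero _) h1).symm

/-- The adjoint action `m ↦ (f.m).f⁻¹`. -/
def adj (f : G) : PathCoalg k (HopfQuiver R) →ₗ[k] PathCoalg k (HopfQuiver R) :=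
  B.r f⁻¹ ∘ₗ B.l f

lemma adj_apply (f : G) (m : PathCoalg k (HopfQuiver R)) : B.adj f m = B.r f⁻¹ (B.l f m) := rfl

lemma adj_mem (f : G) {g : G} {m : PathCoalg k (HopfQuiver R)} (hm : m ∈ isotypic k R g 1) :
    B.adj f m ∈ isotypic k R (f * g * f⁻¹) 1 := by
  have := B.r_mem f⁻¹ (B.l_mem f hm)
  rwa [mul_one, mul_inv_cancel] at this

lemma adj_injective (f : G) {g : G} {m m' : PathCoalg k (HopfQuiver R)}
    (hm : m ∈ isotypic k R g 1) (hm' : m' ∈ isotypic k R g 1) (h : B.adj f m = B.adj f m') :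
    m = m' :=
  B.l_injective f hm hm' (B.r_injective f⁻¹ (B.l_mem f hm) (B.l_mem f hm') h)

lemma adj_one {g : G} {m : PathCoalg k (HopfQuiver R)} (hm : m ∈ isotypic k R g 1) :
    B.adj 1 m = m := by
  rw [adj_apply, B.l_one hm, inv_one, B.r_one hm]

/-- The adjoint action is a projective action with factors `Φ̃`. -/
lemma adj_adj (hΦ : IsNormalizedThreeCocycle Φ) (e f : G) {g : G}
    {m : PathCoalg k (HopfQuiver R)} (hm : m ∈ isotypic k R g 1) :
    B.adj e (B.adj f m) = tildeCocycle Φ e f g • B.adj (e * f) m := by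
  have h1 := B.l_mem f hm
  have h2 := B.l_mem (e * f) hm
  rw [mul_one] at h1 h2
  rw [adj_apply, adj_apply, adj_apply, B.l_r_eq e f⁻¹ h1, B.l_l_eq e f hm,
    LinearMap.map_smul_of_tower, LinearMap.map_smul_of_tower, LinearMap.map_smul_of_tower,
    B.r_r_eq f⁻¹ e⁻¹ h2, smul_smul, smul_smul, mul_inv_rev, hΦ.one_right, tildeCocycle]
  congr 1
  simp only [div_eq_mul_inv, mul_inv, inv_one, mul_one]
  ac_rfl

end ArrowBimodule

/-- The linear map that sends the standard basis to the arrows from `x` to `y`, when `y x⁻¹` lies in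
the class `C`. Otherwise its value is zero. -/
def arrowMap (k : Type u) [Field k] (R : ConjClasses G → ℕ) (C : ConjClasses G) (x y : G) :
    (Fin (R C) → k) →ₗ[k] PathCoalg k (HopfQuiver R) :=
  open Classical in
  if h : C = ConjClasses.mk (y * x⁻¹) then
    Fintype.linearCombination k fun i =>
      ofPath k (Quiver.Hom.toPath (V := HopfQuiver R) (a := of R x) (b := of R y)
        (Fin.cast (congrArg R h) i))
  else 0

lemma arrowMap_injective {C : ConjClasses G} {x y : G} (h : C = ConjClasses.mk (y * x⁻¹)) :
    Function.Injective (arrowMap k R C x y) := by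
  subst h
  rw [arrowMap, dif_pos rfl]
  apply LinearIndependent.fintypeLinearCombination_injective
  refine (pathBasis k (HopfQuiver R)).linearIndependent.comp
    (fun i : Fin (R (ConjClasses.mk (y * x⁻¹))) =>
      (⟨of R x, of R y, Quiver.Hom.toPath (V := HopfQuiver R) (a := of R x) (b := of R y) i⟩ :
        Σ (x : HopfQuiver R) (y : HopfQuiver R), Quiver.Path x y)) ?_
  intro i j hij
  simp only [Sigma.mk.injEq, heq_eq_eq, true_and] at hij
  injection hij with h1 h2 h3 h4

lemma range_arrowMap {C : ConjClasses G} {x y : G} (h : C = ConjClasses.mk (y * x⁻¹)) :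
    LinearMap.range (arrowMap k R C x y) = isotypic k R y x := by
  subst h
  rw [arrowMap, dif_pos rfl, Fintype.range_linearCombination, isotypic_eq_span]
  rfl

variable {γ : ConjClasses G → G}

/-- Every graded Majid algebra structure has a collection of projective representations. -/
theorem exists_isAttachedTo (hΦ : IsNormalizedThreeCocycle Φ)
    (hγ : ∀ C : ConjClasses G, ConjClasses.mk (γ C) = C) (A : HopfQuiverMajid Φ R) :
    ∃ M : RepCollection Φ R γ, M.IsAttachedTo A := by
  suffices H : ∀ C : ConjClasses G, ∃ (M : ProjRep k (Z := Subgroup.centralizer {γ C})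
      (fun e f => tildeCocycle Φ e f (γ C)) (R C)) (φ : M.V →ₗ[k] PathCoalg k (HopfQuiver R)),
      Function.Injective φ ∧ LinearMap.range φ = isotypic k R (γ C) 1 ∧
      ∀ (f : Subgroup.centralizer {γ C}) (v : M.V), φ (M.ρ f v) = A.arrowBimodule.adj f (φ v) by
    choose M hM using H
    exact ⟨M, hM⟩
  intro C
  set B := A.arrowBimodule
  have hC : C = ConjClasses.mk (γ C * 1⁻¹) := by rw [inv_one, mul_one, hγ]
  set ψ := arrowMap k R C 1 (γ C) with hψ
  have hinj : Function.Injective ψ := arrowMap_injective hC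
  have hrange : LinearMap.range ψ = isotypic k R (γ C) 1 := range_arrowMap hC
  have hmem : ∀ v, ψ v ∈ isotypic k R (γ C) 1 := fun v => hrange ▸ LinearMap.mem_range_self ψ v
  obtain ⟨θ, hθ⟩ := LinearMap.exists_leftInverse_of_injective ψ (LinearMap.ker_eq_bot.mpr hinj)
  have hψθ : ∀ m ∈ isotypic k R (γ C) 1, ψ (θ m) = m := by
    intro m hm
    rw [← hrange] at hm
    obtain ⟨v, rfl⟩ := hm
    exact congrArg ψ (LinearMap.congr_fun hθ v)
  have hadj : ∀ (f : Subgroup.centralizer {γ C}) (v), B.adj f (ψ v) ∈ isotypic k R (γ C) 1 := by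
    intro f v
    have h := B.adj_mem f (hmem v)
    rwa [Subgroup.mem_centralizer_singleton_iff.mp f.2, mul_inv_cancel_right] at h
  have hρ : ∀ (f : Subgroup.centralizer {γ C}) (v),
      ψ ((θ ∘ₗ B.adj f ∘ₗ ψ) v) = B.adj f (ψ v) := fun f v => hψθ _ (hadj f v)
  have hρinj : ∀ f : Subgroup.centralizer {γ C}, Function.Injective (θ ∘ₗ B.adj f ∘ₗ ψ) := by
    intro f v w h
    have := congrArg ψ h
    rw [hρ, hρ] at this
    exact hinj (B.adj_injective _ (hmem v) (hmem w) this)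
  refine ⟨
    { V := Fin (R C) → k
      ρ := fun f => LinearEquiv.ofInjectiveEndo (θ ∘ₗ B.adj f ∘ₗ ψ) (hρinj f)
      map_one := ?_
      map_mul := ?_
      rank_eq := by simp }, ψ, hinj, hrange, fun f v => hρ f v⟩
  · refine LinearEquiv.ext fun v => hinj ?_
    exact (hρ 1 v).trans (B.adj_one (hmem v))
  · intro e f v
    apply hinj
    rw [map_smul]
    refine (hρ e _).trans ?_
    change B.adj e (ψ ((θ ∘ₗ B.adj f ∘ₗ ψ) v)) = _ • ψ ((θ ∘ₗ B.adj (e * f : G) ∘ₗ ψ) v)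
    rw [hρ, B.adj_adj hΦ e f (hmem v)]
    exact congrArg _ (hρ (e * f) v).symm

namespace RepCollection

/-- The collection attached to a graded Majid algebra structure is unique up to isomorphism. -/
theorem IsAttachedTo.isomorphic {M N : RepCollection Φ R γ} {A : HopfQuiverMajid Φ R}
    (hM : M.IsAttachedTo A) (hN : N.IsAttachedTo A) : M.Isomorphic N := by
  intro C
  obtain ⟨φ, hφ, hφr, hφρ⟩ := hM C
  obtain ⟨ψ, hψ, hψr, hψρ⟩ := hN C
  let e : (M C).V ≃ₗ[k] (N C).V := LinearEquiv.ofInjective φ hφ ≪≫ₗ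
    LinearEquiv.ofEq _ _ (hφr.trans hψr.symm) ≪≫ₗ (LinearEquiv.ofInjective ψ hψ).symm
  have he : ∀ v, ψ (e v) = φ v := fun v =>
    congrArg Subtype.val ((LinearEquiv.ofInjective ψ hψ).apply_symm_apply _)
  refine ⟨e, fun f v => hψ ?_⟩
  rw [he, hφρ, hψρ, he]

theorem IsAttachedTo.congr_left {M N : RepCollection Φ R γ} {A : HopfQuiverMajid Φ R}
    (hM : M.IsAttachedTo A) (h : N.Isomorphic M) : N.IsAttachedTo A := by
  intro C
  obtain ⟨φ, hφ, hφr, hφρ⟩ := hM C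
  obtain ⟨e, he⟩ := h C
  refine ⟨φ ∘ₗ e.toLinearMap, hφ.comp e.injective, ?_, fun f v => ?_⟩
  · rw [LinearEquiv.range_comp, hφr]
  · rw [LinearMap.comp_apply, LinearMap.comp_apply, LinearEquiv.coe_coe, he, hφρ]

theorem IsAttachedTo.congr_right {M : RepCollection Φ R γ} {A A' : HopfQuiverMajid Φ R}
    (hM : M.IsAttachedTo A) (h : A.Isomorphic A') : M.IsAttachedTo A' := by
  obtain ⟨e, hmul, hdeg, hg⟩ := h
  have hcomul : ∀ m, Coalgebra.comul (R := k) (e m) =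
      TensorProduct.map e.toLinearMap e.toLinearMap (Coalgebra.comul (R := k) m) := fun m =>
    (LinearMap.congr_fun e.map_comp_comul m).symm
  have heinj : Function.Injective (TensorProduct.map e.toLinearMap e.toLinearMap) :=
    (TensorProduct.congr e.toLinearEquiv e.toLinearEquiv).injective
  have hiso : ∀ {x y : G} {m}, e m ∈ isotypic k R y x ↔ m ∈ isotypic k R y x := by
    intro x y m
    have key : elt k R y ⊗ₜ[k] e m + e m ⊗ₜ[k] elt k R x =
        TensorProduct.map e.toLinearMap e.toLinearMap (elt k R y ⊗ₜ m + m ⊗ₜ elt k R x) := by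
      rw [map_add, TensorProduct.map_tmul, TensorProduct.map_tmul]
      change _ = e (elt k R y) ⊗ₜ[k] e m + e m ⊗ₜ[k] e (elt k R x)
      rw [hg, hg]
    rw [mem_isotypic, mem_isotypic, hdeg, hcomul, key, heinj.eq_iff]
  intro C
  obtain ⟨φ, hφ, hφr, hφρ⟩ := hM C
  refine ⟨e.toLinearEquiv.toLinearMap ∘ₗ φ, e.injective.comp hφ, ?_, fun f v => ?_⟩
  · rw [LinearMap.range_comp, hφr]
    ext m
    constructor
    · rintro ⟨n, hn, rfl⟩
      exact hiso.mpr hn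
    · intro hm
      refine ⟨e.symm m, hiso.mp ?_, e.apply_symm_apply m⟩
      rwa [e.apply_symm_apply]
  · change e (φ _) = A'.mul (A'.mul (_ ⊗ₜ e (φ v)) ⊗ₜ _)
    rw [hφρ, hmul.map_mul, hmul.map_mul, hg, hg]

end RepCollection

end Attached

/-! ### The attached representations determine the graded Majid algebra structure -/

section Uniqueness

variable {k : Type u} [Field k] {G : Type v} [Group G] {R : ConjClasses G → ℕ}
  {Φ : G → G → G → kˣ}

/-- A linear map may be prescribed on each isotypic component separately. -/
lemma exists_linearMap_isotypic
    (F : G → G → PathCoalg k (HopfQuiver R) →ₗ[k] PathCoalg k (HopfQuiver R)) :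
    ∃ f : PathCoalg k (HopfQuiver R) →ₗ[k] PathCoalg k (HopfQuiver R),
      ∀ {x y : G} {m : PathCoalg k (HopfQuiver R)}, m ∈ isotypic k R y x → f m = F x y m := by
  let f := (pathBasis k (HopfQuiver R)).constr k fun p =>
    F p.1.val p.2.1.val (ofPath k p.2.2)
  have hf : ∀ {x y : HopfQuiver R} (p : Quiver.Path x y),
      f (ofPath k p) = F x.val y.val (ofPath k p) := fun {x y} p => by
    exact (pathBasis k (HopfQuiver R)).constr_basis k _ ⟨x, y, p⟩
  refine ⟨f, fun {x y m} hm => ?_⟩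
  rw [isotypic_eq_span] at hm
  induction hm using Submodule.span_induction with
  | mem m hm =>
    obtain ⟨a, rfl⟩ := hm
    exact hf _
  | zero => rw [map_zero, map_zero]
  | add m n _ _ hm hn => rw [map_add, map_add, hm, hn]
  | smul c m _ hm => rw [map_smul, map_smul, hm]

/-- If `s C g x` parametrizes the isotypic component `ᵍˣMˣ` for every `g` in the class `C`, then a
linear map can be prescribed on all the parameters. -/
lemma exists_linearMap_frame {V : ConjClasses G → Type*} [iV : ∀ C, AddCommGroup (V C)]
    [mV : ∀ C, Module k (V C)] {s : ∀ C, G → G → V C →ₗ[k] PathCoalg k (HopfQuiver R)}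
    (hs : ∀ {C g} (x), ConjClasses.mk g = C → Function.Injective (s C g x))
    (hr : ∀ {C g} (x), ConjClasses.mk g = C →
      LinearMap.range (s C g x) = isotypic k R (g * x) x)
    (F : ∀ C, G → G → V C →ₗ[k] PathCoalg k (HopfQuiver R)) :
    ∃ f : PathCoalg k (HopfQuiver R) →ₗ[k] PathCoalg k (HopfQuiver R),
      ∀ {C g} (x), ConjClasses.mk g = C → ∀ v : V C, f (s C g x v) = F C g x v := by
  have H : ∀ x g : G, ∃ f : PathCoalg k (HopfQuiver R) →ₗ[k] PathCoalg k (HopfQuiver R),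
      f ∘ₗ s (ConjClasses.mk g) g x = F (ConjClasses.mk g) g x := by
    intro x g
    obtain ⟨θ, hθ⟩ := LinearMap.exists_leftInverse_of_injective _
      (LinearMap.ker_eq_bot.mpr (hs x (rfl : ConjClasses.mk g = _)))
    exact ⟨F _ g x ∘ₗ θ, by rw [LinearMap.comp_assoc, hθ, LinearMap.comp_id]⟩
  choose f' hf' using H
  obtain ⟨f, hf⟩ := exists_linearMap_isotypic fun x y => f' x (y * x⁻¹)
  refine ⟨f, ?_⟩
  rintro C g x rfl v
  rw [hf (x := x) (y := g * x), mul_inv_cancel_right]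
  · exact LinearMap.congr_fun (hf' x g) v
  · rw [← hr x (rfl : ConjClasses.mk g = _)]
    exact LinearMap.mem_range_self _ v

namespace ArrowBimodule

lemma r_l_mem (B : ArrowBimodule k Φ R) (s t : G) {g : G} {m : PathCoalg k (HopfQuiver R)}
    (hm : m ∈ isotypic k R g 1) : B.r s (B.l t m) ∈ isotypic k R (t * g * s) (t * s) := by
  have := B.r_mem s (B.l_mem t hm)
  rwa [mul_one] at this

/-- Every isotypic component is a translate of one of the form `ᵍM¹`. -/
lemma exists_r_l_eq (B : ArrowBimodule k Φ R) (s t g : G) {m : PathCoalg k (HopfQuiver R)}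
    (hm : m ∈ isotypic k R (t * g * s) (t * s)) :
    ∃ v ∈ isotypic k R g 1, B.r s (B.l t v) = m := by
  have h1 := B.r_mem s⁻¹ hm
  have h2 := B.l_mem t⁻¹ h1
  have h2' := h2
  rw [mul_inv_cancel_right, mul_inv_cancel_right, inv_mul_cancel, inv_mul_cancel_left] at h2'
  have h3 := B.l_l_eq t t⁻¹ h1
  rw [mul_inv_cancel, B.l_one h1] at h3
  have h4 := B.r_r_eq s⁻¹ s hm
  rw [inv_mul_cancel, B.r_one hm] at h4
  generalize Φ t t⁻¹ (t * g * s * s⁻¹) / Φ t t⁻¹ (t * s * s⁻¹) = c at h3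
  generalize Φ (t * s) s⁻¹ s / Φ (t * g * s) s⁻¹ s = d at h4
  refine ⟨d⁻¹ • c⁻¹ • B.l t⁻¹ (B.r s⁻¹ m),
    Submodule.smul_of_tower_mem _ _ (Submodule.smul_of_tower_mem _ _ h2'), ?_⟩
  rw [LinearMap.map_smul_of_tower, LinearMap.map_smul_of_tower, LinearMap.map_smul_of_tower,
    LinearMap.map_smul_of_tower, h3, LinearMap.map_smul_of_tower,
    inv_smul_smul, h4, inv_smul_smul]

/-- The translates are permuted by the left action of `G`, up to factors that only depend on the
cocycle `Φ`. -/
lemma exists_l_r_l_eq (Φ : G → G → G → kˣ) (R : ConjClasses G → ℕ) (g s : G) {e t t' z : G}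
    (h : e * t = t' * z) :
    ∃ c : kˣ, ∀ (B : ArrowBimodule k Φ R) (m : PathCoalg k (HopfQuiver R)),
      m ∈ isotypic k R g 1 →
      B.l e (B.r s (B.l t m)) = c • B.r (z * s) (B.l t' (B.adj z m)) := by
  have h1 : ∃ c : kˣ, ∀ (B : ArrowBimodule k Φ R) (m : PathCoalg k (HopfQuiver R)),
      m ∈ isotypic k R g 1 → B.l e (B.r s (B.l t m)) = c • B.r s (B.l (t' * z) m) := by
    refine ⟨Φ e (t * g) s / Φ e (t * 1) s * (Φ e t g / Φ e t 1), fun B m hm => ?_⟩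
    rw [B.l_r_eq e s (B.l_mem t hm), B.l_l_eq e t hm, LinearMap.map_smul_of_tower, smul_smul, h]
  have h2 : ∃ c : kˣ, ∀ (B : ArrowBimodule k Φ R) (m : PathCoalg k (HopfQuiver R)),
      m ∈ isotypic k R g 1 →
      B.r (z * s) (B.l t' (B.adj z m)) = c • B.r s (B.l (t' * z) m) := by
    refine ⟨Φ t' (z * g) z⁻¹ / Φ t' (z * 1) z⁻¹ * ((Φ t' z g / Φ t' z 1) *
      (Φ (t' * z * 1) z⁻¹ (z * s) / Φ (t' * z * g) z⁻¹ (z * s))), fun B m hm => ?_⟩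
    rw [adj_apply, B.l_r_eq t' z⁻¹ (B.l_mem z hm), B.l_l_eq t' z hm, LinearMap.map_smul_of_tower,
      LinearMap.map_smul_of_tower, LinearMap.map_smul_of_tower,
      B.r_r_eq z⁻¹ (z * s) (B.l_mem (t' * z) hm), inv_mul_cancel_left, smul_smul, smul_smul,
      mul_assoc]
  obtain ⟨c, hc⟩ := h1
  obtain ⟨d, hd⟩ := h2
  refine ⟨c * d⁻¹, fun B m hm => ?_⟩
  rw [hc B m hm, hd B m hm, smul_smul, inv_mul_cancel_right]

end ArrowBimodule

/-- The parametrization of the isotypic component `ᵗᵍᵗ⁻¹ˣMˣ` by the representation space `V ≅ ᵍM¹`,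
given by the translation `v ↦ (t.v).(t⁻¹x)`. -/
def ArrowBimodule.frame (B : ArrowBimodule k Φ R) {V : Type*} [AddCommGroup V] [Module k V]
    (φ : V →ₗ[k] PathCoalg k (HopfQuiver R)) (t x : G) : V →ₗ[k] PathCoalg k (HopfQuiver R) :=
  B.r (t⁻¹ * x) ∘ₗ B.l t ∘ₗ φ

section Frame

variable (B : ArrowBimodule k Φ R) {V : Type*} [AddCommGroup V] [Module k V]
  {φ : V →ₗ[k] PathCoalg k (HopfQuiver R)} {g t x : G}

lemma ArrowBimodule.frame_injective (hφ : Function.Injective φ)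
    (hr : LinearMap.range φ = isotypic k R g 1) : Function.Injective (B.frame φ t x) := by
  intro v w h
  have hv : φ v ∈ isotypic k R g 1 := hr ▸ LinearMap.mem_range_self φ v
  have hw : φ w ∈ isotypic k R g 1 := hr ▸ LinearMap.mem_range_self φ w
  exact hφ (B.l_injective t hv hw (B.r_injective _ (B.l_mem t hv) (B.l_mem t hw) h))

lemma ArrowBimodule.range_frame (hr : LinearMap.range φ = isotypic k R g 1) :
    LinearMap.range (B.frame φ t x) = isotypic k R (t * g * t⁻¹ * x) x := by
  have hx : t * (t⁻¹ * x) = x := mul_inv_cancel_left _ _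
  have hy : t * g * (t⁻¹ * x) = t * g * t⁻¹ * x := (mul_assoc _ _ _).symm
  ext m
  constructor
  · rintro ⟨v, rfl⟩
    have := B.r_l_mem (t⁻¹ * x) t (g := g) (hr ▸ LinearMap.mem_range_self φ v)
    rwa [hx, hy] at this
  · intro hm
    obtain ⟨n, hn, rfl⟩ := B.exists_r_l_eq (t⁻¹ * x) t g (m := m) (by rwa [hx, hy])
    rw [← hr] at hn
    obtain ⟨v, rfl⟩ := hn
    exact ⟨v, rfl⟩

end Frame

lemma inv_mul_mul_mem_centralizer {c e g t t' : G} (h : t * c * t⁻¹ = g)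
    (h' : t' * c * t'⁻¹ = e * g * e⁻¹) : t'⁻¹ * e * t ∈ Subgroup.centralizer {c} := by
  rw [Subgroup.mem_centralizer_singleton_iff]
  have h3 : t' * c = e * g * e⁻¹ * t' := eq_mul_of_mul_inv_eq h'
  have h4 : t * c = g * t := eq_mul_of_mul_inv_eq h
  calc t'⁻¹ * e * t * c = t'⁻¹ * e * (t * c) := by group
    _ = t'⁻¹ * (e * g * e⁻¹ * t') * (t'⁻¹ * e * t) := by rw [h4]; group
    _ = c * (t'⁻¹ * e * t) := by rw [← h3]; group

variable {γ : ConjClasses G → G}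

/-- Graded Majid algebra structures with the same attached collection are isomorphic. -/
theorem RepCollection.IsAttachedTo.isomorphic_majid
    (hγ : ∀ C : ConjClasses G, ConjClasses.mk (γ C) = C) {M : RepCollection Φ R γ}
    {A A' : HopfQuiverMajid Φ R} (hM : M.IsAttachedTo A) (hM' : M.IsAttachedTo A') :
    A.Isomorphic A' := by
  have ht : ∀ g : G, ∃ t, t * γ (ConjClasses.mk g) * t⁻¹ = g := fun g =>
    isConj_iff.mp (ConjClasses.mk_eq_mk_iff_isConj.mp (hγ _))
  choose t ht using ht
  choose φ hφ hr hρ using hM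
  choose φ' hφ' hr' hρ' using hM'
  set B := A.arrowBimodule with hB
  set B' := A'.arrowBimodule with hB'
  have hrf : ∀ {C g} (x : G), ConjClasses.mk g = C →
      LinearMap.range (B.frame (φ C) (t g) x) = isotypic k R (g * x) x := by
    rintro C g x rfl
    rw [B.range_frame (hr _), ht]
  have hrf' : ∀ {C g} (x : G), ConjClasses.mk g = C →
      LinearMap.range (B'.frame (φ' C) (t g) x) = isotypic k R (g * x) x := by
    rintro C g x rfl
    rw [B'.range_frame (hr' _), ht]
  obtain ⟨f, hf⟩ := exists_linearMap_frame (iV := fun C => (M C).addCommGroup)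
    (mV := fun C => (M C).module) (fun {C g} x _ => B.frame_injective (hφ C) (hr C)) hrf
    fun C g x => B'.frame (φ' C) (t g) x
  obtain ⟨f', hf'⟩ := exists_linearMap_frame (iV := fun C => (M C).addCommGroup)
    (mV := fun C => (M C).module) (fun {C g} x _ => B'.frame_injective (hφ' C) (hr' C)) hrf'
    fun C g x => B.frame (φ C) (t g) x
  have hex : ∀ {x y : G} {m}, m ∈ isotypic k R y x → ∃ (C : _) (g : G) (v : (M C).V),
      ConjClasses.mk g = C ∧ y = g * x ∧ B.frame (φ C) (t g) x v = m := by
    intro x y m hm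
    rw [← inv_mul_cancel_right y x, ← hrf x rfl] at hm
    obtain ⟨v, hv⟩ := hm
    exact ⟨_, _, v, rfl, (inv_mul_cancel_right y x).symm, hv⟩
  have hex' : ∀ {x y : G} {m}, m ∈ isotypic k R y x → ∃ (C : _) (g : G) (v : (M C).V),
      ConjClasses.mk g = C ∧ y = g * x ∧ B'.frame (φ' C) (t g) x v = m := by
    intro x y m hm
    rw [← inv_mul_cancel_right y x, ← hrf' x rfl] at hm
    obtain ⟨v, hv⟩ := hm
    exact ⟨_, _, v, rfl, (inv_mul_cancel_right y x).symm, hv⟩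
  have hφm : ∀ C v, φ C v ∈ isotypic k R (γ C) 1 := fun C v => hr C ▸ LinearMap.mem_range_self _ v
  have hφm' : ∀ C v, φ' C v ∈ isotypic k R (γ C) 1 :=
    fun C v => hr' C ▸ LinearMap.mem_range_self _ v
  have hl : ∀ (e : G) {C : ConjClasses G} (x : G) {g : G} (v : (M C).V),
      ConjClasses.mk g = C → f (B.l e (B.frame (φ C) (t g) x v)) =
        B'.l e (B'.frame (φ' C) (t g) x v) := by
    intro e C x g v hC
    have hC' : ConjClasses.mk (e * g * e⁻¹) = C := by
      rw [← hC]
      exact ConjClasses.mk_eq_mk_iff_isConj.mpr (isConj_iff.mpr ⟨e, rfl⟩).symm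
    have h1 := ht (e * g * e⁻¹)
    have h2 := ht g
    rw [hC'] at h1
    rw [hC] at h2
    have hfg := hf (e * x) hC'
    generalize t (e * g * e⁻¹) = t' at h1 hfg
    have hz : e * t g = t' * (t'⁻¹ * e * t g) := by group
    have hzc : t'⁻¹ * e * t g ∈ Subgroup.centralizer {γ C} :=
      inv_mul_mul_mem_centralizer h2 h1
    obtain ⟨c, hc⟩ := ArrowBimodule.exists_l_r_l_eq Φ R (γ C) ((t g)⁻¹ * x) hz
    have hs : t'⁻¹ * e * t g * ((t g)⁻¹ * x) = t'⁻¹ * (e * x) := by group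
    rw [hs] at hc
    have h5 : B.l e (B.frame (φ C) (t g) x v) =
        c • B.frame (φ C) t' (e * x) ((M C).ρ ⟨_, hzc⟩ v) :=
      (hc B _ (hφm _ v)).trans (congrArg (fun w => c • B.r (t'⁻¹ * (e * x)) (B.l t' w))
        (hρ _ ⟨_, hzc⟩ v).symm)
    have h6 : B'.l e (B'.frame (φ' C) (t g) x v) =
        c • B'.frame (φ' C) t' (e * x) ((M C).ρ ⟨_, hzc⟩ v) :=
      (hc B' _ (hφm' _ v)).trans (congrArg (fun w => c • B'.r (t'⁻¹ * (e * x)) (B'.l t' w))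
        (hρ' _ ⟨_, hzc⟩ v).symm)
    rw [h5, h6, LinearMap.map_smul_of_tower, hfg]
  have hrr : ∀ (e : G) {C : ConjClasses G} (x : G) {g : G} (v : (M C).V),
      ConjClasses.mk g = C → f (B.r e (B.frame (φ C) (t g) x v)) =
        B'.r e (B'.frame (φ' C) (t g) x v) := by
    intro e C x g v hC
    have hc : ∀ (B : ArrowBimodule k Φ R) (w), w ∈ isotypic k R (γ C) 1 →
        B.r e (B.r ((t g)⁻¹ * x) (B.l (t g) w)) = (Φ (t g * 1) ((t g)⁻¹ * x) e /
          Φ (t g * γ C) ((t g)⁻¹ * x) e) • B.r ((t g)⁻¹ * (x * e)) (B.l (t g) w) := by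
      intro B w hw
      rw [B.r_r_eq ((t g)⁻¹ * x) e (B.l_mem (t g) hw), mul_assoc]
    have h1 := hc B _ (hφm _ v)
    have h2 := hc B' _ (hφm' _ v)
    change B.r e (B.frame _ _ _ v) = _ • B.frame _ _ _ v at h1
    change B'.r e (B'.frame _ _ _ v) = _ • B'.frame _ _ _ v at h2
    rw [h1, h2, LinearMap.map_smul_of_tower, hf _ hC]
  refine HopfQuiverMajid.isomorphic_of_arrow (f := f) (f' := f') ?_ ?_ ?_ ?_ ?_ ?_
  · intro x y m hm
    obtain ⟨C, g, v, hC, rfl, rfl⟩ := hex hm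
    rw [hf x hC, ← hrf' x hC]
    exact LinearMap.mem_range_self _ v
  · intro x y m hm
    obtain ⟨C, g, v, hC, rfl, rfl⟩ := hex' hm
    rw [hf' x hC, ← hrf x hC]
    exact LinearMap.mem_range_self _ v
  · intro x y m hm
    obtain ⟨C, g, v, hC, rfl, rfl⟩ := hex' hm
    rw [hf' x hC, hf x hC]
  · intro x y m hm
    obtain ⟨C, g, v, hC, rfl, rfl⟩ := hex hm
    rw [hf x hC, hf' x hC]
  · intro e x y m hm
    obtain ⟨C, g, v, hC, rfl, rfl⟩ := hex hm
    rw [hf x hC]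
    exact hl e x v hC
  · intro e x y m hm
    obtain ⟨C, g, v, hC, rfl, rfl⟩ := hex hm
    rw [hf x hC]
    exact hrr e x v hC

end Uniqueness

/-! ### Identities for 3-cocycles -/

section Cocycle

/-- The factors `τ(e,f,g) = Φ(e,f,g) Φ(ᵉᶠg,e,f) / Φ(e,ᶠg,f)` of the action of `G` on the arrows,
where `ʰg = hgh⁻¹`. They form a 2-cocycle of the action groupoid of `G` on itself by
conjugation. -/
def transgression {k : Type u} [Field k] {G : Type v} [Group G] (Φ : G → G → G → kˣ)
    (e f g : G) : kˣ :=
  Φ e f g * Φ (e * (f * g * f⁻¹) * e⁻¹) e f / Φ e (f * g * f⁻¹) f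

variable {k : Type u} [Field k] {G : Type v} [Group G] {Φ : G → G → G → kˣ}

/-- The cocycle condition in additive notation, where `abel` applies. -/
lemma IsNormalizedThreeCocycle.add_cocycle (hΦ : IsNormalizedThreeCocycle Φ) (e f g h : G) :
    Additive.ofMul (Φ e f g) + Additive.ofMul (Φ e (f * g) h) + Additive.ofMul (Φ f g h) =
      Additive.ofMul (Φ (e * f) g h) + Additive.ofMul (Φ e f (g * h)) :=
  hΦ.cocycle e f g h

namespace IsNormalizedThreeCocycle

variable (hΦ : IsNormalizedThreeCocycle Φ)

include hΦ

/-- The factors `Φ(e,g,x)/Φ(ege⁻¹,e,x)` of the left action and `Φ(g,x,f)⁻¹` of the right action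
satisfy the relation for the two actions to commute. -/
lemma l_r_identity (e g x f : G) :
    Φ e x f * (Φ g x f)⁻¹ * (Φ e g (x * f) / Φ (e * g * e⁻¹) e (x * f)) =
      Φ e (g * x) f * (Φ e g x / Φ (e * g * e⁻¹) e x) * (Φ (e * g * e⁻¹) (e * x) f)⁻¹ := by
  apply Additive.ofMul.injective
  simp only [ofMul_mul, ofMul_div, ofMul_inv]
  have h1 := hΦ.add_cocycle e g x f
  have h2 := hΦ.add_cocycle (e * g * e⁻¹) e x f
  rw [inv_mul_cancel_right] at h2
  linear_combination (norm := abel) h2 - h1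

/-- The factors `Φ(e,g,x)/Φ(ege⁻¹,e,x)` satisfy the relation for the left action to be associative,
provided that the operators they multiply are composed with the factors `τ`. -/
lemma l_l_identity (e f g x : G) :
    Φ e f x * (Φ f g x / Φ (f * g * f⁻¹) f x * (Φ e (f * g * f⁻¹) (f * x) /
        Φ (e * (f * g * f⁻¹) * e⁻¹) e (f * x)) * transgression Φ e f g) =
      Φ e f (g * x) * (Φ (e * f) g x / Φ (e * (f * g * f⁻¹) * e⁻¹) (e * f) x) := by
  apply Additive.ofMul.injective
  simp only [transgression, ofMul_mul, ofMul_div]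
  have h1 := hΦ.add_cocycle e f g x
  have h2 := hΦ.add_cocycle e (f * g * f⁻¹) f x
  have h3 := hΦ.add_cocycle (e * (f * g * f⁻¹) * e⁻¹) e f x
  rw [inv_mul_cancel_right] at h2 h3
  linear_combination (norm := abel) h1 - h2 + h3

lemma transgression_cocycle (d e f g : G) :
    transgression Φ e f g * transgression Φ d (e * f) g =
      transgression Φ d e (f * g * f⁻¹) * transgression Φ (d * e) f g := by
  have hc : e * f * g * (e * f)⁻¹ = e * (f * g * f⁻¹) * e⁻¹ := by group
  have hc' : d * e * (f * g * f⁻¹) * (d * e)⁻¹ = d * (e * (f * g * f⁻¹) * e⁻¹) * d⁻¹ := by group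
  apply Additive.ofMul.injective
  simp only [transgression, ofMul_mul, ofMul_div, hc, hc']
  have h1 := hΦ.add_cocycle d e f g
  have h2 := hΦ.add_cocycle d e (f * g * f⁻¹) f
  have h3 := hΦ.add_cocycle d (e * (f * g * f⁻¹) * e⁻¹) e f
  have h4 := hΦ.add_cocycle (d * (e * (f * g * f⁻¹) * e⁻¹) * d⁻¹) d e f
  rw [inv_mul_cancel_right] at h2 h3 h4
  linear_combination (norm := abel) h1 - h2 + h3 - h4

/-- The factors `Φ̃` and `τ` differ by the coboundary of `(f,g) ↦ Φ(fgf⁻¹,f,f⁻¹)`. -/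
lemma tildeCocycle_mul (e f g : G) :
    tildeCocycle Φ e f g * (Φ (f * g * f⁻¹) f f⁻¹ * Φ (e * (f * g * f⁻¹) * e⁻¹) e e⁻¹) =
      Φ (e * (f * g * f⁻¹) * e⁻¹) (e * f) (e * f)⁻¹ * transgression Φ e f g := by
  apply Additive.ofMul.injective
  simp only [transgression, tildeCocycle, ofMul_mul, ofMul_div, mul_inv_rev]
  have h1 := hΦ.add_cocycle e (f * g * f⁻¹) f f⁻¹
  have h2 := hΦ.add_cocycle (e * (f * g * f⁻¹) * e⁻¹) e f f⁻¹
  have h3 := hΦ.add_cocycle (e * (f * g * f⁻¹) * e⁻¹) (e * f) f⁻¹ e⁻¹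
  have h4 : e * (f * g * f⁻¹) * e⁻¹ * (e * f) = e * f * g := by group
  rw [inv_mul_cancel_right, mul_inv_cancel, hΦ.one_right, ofMul_one] at h1 h2
  rw [h4, mul_inv_cancel_right] at h3
  linear_combination (norm := abel) h1 - h2 + h3

lemma transgression_one_left (f g : G) : transgression Φ 1 f g = 1 := by
  simp [transgression, hΦ.one_left, hΦ.one_middle]

lemma transgression_one_middle (e g : G) : transgression Φ e 1 g = 1 := by
  simp [transgression, hΦ.one_right, hΦ.one_middle]

end IsNormalizedThreeCocycle

end Cocycle

/-! ### Extension of a projective representation of a centralizer to the conjugacy class -/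

section Extension

variable {k : Type u} [Field k] {G : Type v} [Group G] {Φ : G → G → G → kˣ}

/-- A projective representation of the centralizer of `c` extends to a projective action of the
action groupoid of `G` on the conjugacy class of `c`: the operator `act e g` belongs to the
morphism `e` from `g` to `ege⁻¹`. The factors are `τ`. -/
lemma exists_groupoidAction (hΦ : IsNormalizedThreeCocycle Φ) (c : G) {n : ℕ}
    (M : ProjRep k (Z := Subgroup.centralizer {c}) (fun e f => tildeCocycle Φ e f c) n) :
    ∃ act : G → G → M.V →ₗ[k] M.V,
      (∀ (g : G), IsConj c g → ∀ v, act 1 g v = v) ∧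
      (∀ (e f g : G), IsConj c g → ∀ v, act e (f * g * f⁻¹) (act f g v) =
        transgression Φ e f g • act (e * f) g v) ∧
      ∀ (f : Subgroup.centralizer {c}) (v : M.V),
        act f c v = Φ c f (f : G)⁻¹ • M.ρ f v := by
  classical
  have ht : ∀ g : G, ∃ t : G, IsConj c g → t * c * t⁻¹ = g ∧ (g = c → t = 1) := by
    intro g
    by_cases hg : g = c
    · exact ⟨1, fun _ => ⟨by rw [hg]; group, fun _ => rfl⟩⟩
    · by_cases h : IsConj c g
      · obtain ⟨t, ht⟩ := isConj_iff.mp h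
        exact ⟨t, fun _ => ⟨ht, fun h' => (hg h').elim⟩⟩
      · exact ⟨1, fun h' => (h h').elim⟩
  choose t ht using ht
  have htc : t c = 1 := (ht c (IsConj.refl c)).2 rfl
  -- the given representation, renormalized to have the factors `τ`, as a function on `G`
  let σ : G → M.V →ₗ[k] M.V := fun z =>
    if h : z ∈ Subgroup.centralizer {c} then Φ c z z⁻¹ • (M.ρ ⟨z, h⟩).toLinearMap else 0
  have hσ : ∀ (z : Subgroup.centralizer {c}) (v : M.V), σ z v = Φ c z (z : G)⁻¹ • M.ρ z v := by
    intro z v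
    simp only [σ, dif_pos z.2]
    rfl
  have hcomm : ∀ z ∈ Subgroup.centralizer {c}, z * c * z⁻¹ = c := fun z hz => by
    rw [Subgroup.mem_centralizer_singleton_iff.mp hz, mul_inv_cancel_right]
  have hσσ : ∀ z ∈ Subgroup.centralizer {c}, ∀ w ∈ Subgroup.centralizer {c}, ∀ v : M.V,
      σ z (σ w v) = transgression Φ z w c • σ (z * w) v := by
    intro z hz w hw v
    have h1 := hσ ⟨z, hz⟩
    have h2 := hσ ⟨w, hw⟩
    have h3 := hσ (⟨z, hz⟩ * ⟨w, hw⟩)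
    have h4 := hΦ.tildeCocycle_mul z w c
    rw [hcomm w hw, hcomm z hz] at h4
    simp only [Subgroup.coe_mul] at h1 h2 h3
    rw [h2, LinearMap.map_smul_of_tower, h1, M.map_mul, h3, ← Units.smul_def, smul_smul,
      smul_smul, smul_smul]
    congr 1
    simp only [mul_comm] at h4 ⊢
    rw [← h4]
  let z : G → G → G := fun e g => (t (e * g * e⁻¹))⁻¹ * e * t g
  have hconj : ∀ {g : G} (e : G), IsConj c g → IsConj c (e * g * e⁻¹) :=
    fun e h => h.trans (isConj_iff.mpr ⟨e, rfl⟩)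
  have hz : ∀ {g : G} (e : G), IsConj c g → z e g ∈ Subgroup.centralizer {c} := fun e h =>
    inv_mul_mul_mem_centralizer (ht _ h).1 (ht _ (hconj e h)).1
  refine ⟨fun e g => (transgression Φ e (t g) c /
    transgression Φ (t (e * g * e⁻¹)) (z e g) c) • σ (z e g), ?_, ?_, ?_⟩
  · intro g hg v
    have h1 : z 1 g = 1 := by simp [z]
    have h2 := hσ 1 v
    rw [M.map_one, Subgroup.coe_one, hΦ.one_middle, one_smul] at h2
    simp only [LinearMap.smul_apply]
    rw [h1, hΦ.transgression_one_left, hΦ.transgression_one_middle, div_one, one_smul]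
    exact h2
  · intro e f g hg v
    have hc : e * f * g * (e * f)⁻¹ = e * (f * g * f⁻¹) * e⁻¹ := by group
    have hmul : z e (f * g * f⁻¹) * z f g = z (e * f) g := by
      simp only [z, hc]
      group
    have h1 := hΦ.transgression_cocycle e f (t g) c
    have h2 := hΦ.transgression_cocycle e (t (f * g * f⁻¹)) (z f g) c
    have h3 := hΦ.transgression_cocycle (t (e * (f * g * f⁻¹) * e⁻¹)) (z e (f * g * f⁻¹))
      (z f g) c
    rw [(ht g hg).1] at h1
    rw [hcomm _ (hz f hg)] at h2 h3
    have h4 : t (f * g * f⁻¹) * z f g = f * t g := by simp only [z]; group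
    have h5 : t (e * (f * g * f⁻¹) * e⁻¹) * z e (f * g * f⁻¹) = e * t (f * g * f⁻¹) := by
      simp only [z]; group
    rw [h4] at h2
    rw [h5, hmul] at h3
    simp only [LinearMap.smul_apply, hc]
    rw [LinearMap.map_smul_of_tower, hσσ _ (hz e (hconj f hg)) _ (hz f hg), hmul, smul_smul,
      smul_smul, smul_smul]
    congr 1
    apply Additive.ofMul.injective
    have h1' := congrArg Additive.ofMul h1
    have h2' := congrArg Additive.ofMul h2
    have h3' := congrArg Additive.ofMul h3
    simp only [ofMul_mul, ofMul_div] at h1' h2' h3' ⊢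
    linear_combination (norm := abel) h1' - h2' + h3'
  · intro f v
    have h1 : z f c = f := by
      simp only [z]
      rw [hcomm _ f.2, htc, inv_one, one_mul, mul_one]
    simp only [LinearMap.smul_apply]
    rw [h1, hcomm _ f.2, htc, hΦ.transgression_one_left, hΦ.transgression_one_middle, div_one,
      one_smul, hσ]

end Extension

/-! ### The bimodule of a collection of projective representations, and the classification -/

section Classification

variable {k : Type u} [Field k] {G : Type v} [Group G] {R : ConjClasses G → ℕ}
  {Φ : G → G → G → kˣ} {γ : ConjClasses G → G}

/-- Every collection of projective representations gives a bimodule structure on the arrows, of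
which it consists of the components `ᶜM¹` with the adjoint action. -/
theorem RepCollection.exists_arrowBimodule (hΦ : IsNormalizedThreeCocycle Φ)
    (hγ : ∀ C : ConjClasses G, ConjClasses.mk (γ C) = C) (M : RepCollection Φ R γ) :
    ∃ B : ArrowBimodule k Φ R, ∀ C, ∃ φ : (M C).V →ₗ[k] PathCoalg k (HopfQuiver R),
      Function.Injective φ ∧ LinearMap.range φ = isotypic k R (γ C) 1 ∧
      ∀ (f : Subgroup.centralizer {γ C}) (v : (M C).V), φ ((M C).ρ f v) = B.adj f (φ v) := by
  have hconj : ∀ {C : ConjClasses G} {g : G}, ConjClasses.mk g = C → IsConj (γ C) g := by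
    rintro C g rfl
    exact ConjClasses.mk_eq_mk_iff_isConj.mp (hγ _)
  have hC : ∀ {C : ConjClasses G} {g : G} (e : G), ConjClasses.mk g = C →
      ConjClasses.mk (e * g * e⁻¹) = C := by
    rintro C g e rfl
    exact ConjClasses.mk_eq_mk_iff_isConj.mpr (isConj_iff.mpr ⟨e, rfl⟩).symm
  choose act act_one act_act act_ρ using fun C => exists_groupoidAction hΦ (γ C) (M C)
  -- `s C g x` identifies the space of `M C` with the span of the arrows from `x` to `gx`
  let s : ∀ C, G → G → (M C).V →ₗ[k] PathCoalg k (HopfQuiver R) := fun C g x =>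
    arrowMap k R C x (g * x) ∘ₗ (finDimVectorspaceEquiv (R C) (M C).rank_eq).toLinearMap
  have hmk : ∀ {C g} (x : G), ConjClasses.mk g = C → C = ConjClasses.mk (g * x * x⁻¹) := by
    rintro C g x rfl
    rw [mul_inv_cancel_right]
  have hs : ∀ {C g} (x : G), ConjClasses.mk g = C → Function.Injective (s C g x) :=
    fun x h => (arrowMap_injective (hmk x h)).comp (LinearEquiv.injective _)
  have hr : ∀ {C g} (x : G), ConjClasses.mk g = C →
      LinearMap.range (s C g x) = isotypic k R (g * x) x := fun x h => by
    rw [LinearEquiv.range_comp, range_arrowMap (hmk x h)]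
  have hmem : ∀ {C g} (x : G) (v : (M C).V), ConjClasses.mk g = C →
      s C g x v ∈ isotypic k R (g * x) x := fun x v h => hr x h ▸ LinearMap.mem_range_self _ v
  have hex : ∀ {x y : G} {m}, m ∈ isotypic k R y x → ∃ (C : _) (g : G) (v : (M C).V),
      ConjClasses.mk g = C ∧ y = g * x ∧ s C g x v = m := by
    intro x y m hm
    rw [← inv_mul_cancel_right y x, ← hr x rfl] at hm
    obtain ⟨v, hv⟩ := hm
    exact ⟨_, _, v, rfl, (inv_mul_cancel_right y x).symm, hv⟩
  -- With `[v]` for the element of `s C g x` given by `v`, the actions are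
  -- `e.[v] = Φ(e,g,x)/Φ(ege⁻¹,e,x) [act e g v]` and `[v].f = Φ(g,x,f)⁻¹ [v]`. The right action is the
  -- one for which `[v]` is the translate by `x` of the element of `ᵍM¹` given by `v`; the factors
  -- of the left action are then forced up to those of `act`.
  choose l hl using fun e : G => exists_linearMap_frame
    (iV := fun C => (M C).addCommGroup) (mV := fun C => (M C).module) hs hr
    fun C g x => (Φ e g x / Φ (e * g * e⁻¹) e x) • s C (e * g * e⁻¹) (e * x) ∘ₗ act C e g
  choose r hrr using fun f : G => exists_linearMap_frame
    (iV := fun C => (M C).addCommGroup) (mV := fun C => (M C).module) hs hr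
    fun C g x => (Φ g x f)⁻¹ • s C g (x * f)
  simp only [LinearMap.smul_apply, LinearMap.comp_apply] at hl hrr
  refine ⟨
    { l := l
      r := r
      l_mem := ?_
      r_mem := ?_
      l_one := ?_
      r_one := ?_
      l_l := ?_
      l_r := ?_
      r_r := ?_ }, fun C => ⟨s C (γ C) 1, hs 1 (hγ C), by rw [hr 1 (hγ C), mul_one], ?_⟩⟩
  · intro e x y m hm
    obtain ⟨C, g, v, h, rfl, rfl⟩ := hex hm
    rw [hl e x h]
    refine Submodule.smul_of_tower_mem _ _ ?_
    have := hmem (e * x) (act C e g v) (hC e h)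
    rwa [show e * g * e⁻¹ * (e * x) = e * (g * x) by group] at this
  · intro f x y m hm
    obtain ⟨C, g, v, h, rfl, rfl⟩ := hex hm
    rw [hrr f x h]
    refine Submodule.smul_of_tower_mem _ _ ?_
    have := hmem (x * f) v h
    rwa [← mul_assoc] at this
  · intro x y m hm
    obtain ⟨C, g, v, h, rfl, rfl⟩ := hex hm
    rw [hl 1 x h, hΦ.one_left, hΦ.one_middle, div_one, one_smul, one_mul, one_mul, inv_one,
      mul_one, act_one C g (hconj h)]
  · intro x y m hm
    obtain ⟨C, g, v, h, rfl, rfl⟩ := hex hm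
    rw [hrr 1 x h, hΦ.one_right, inv_one, one_smul, mul_one]
  · intro e f x y m hm
    obtain ⟨C, g, v, h, rfl, rfl⟩ := hex hm
    rw [hl f x h, LinearMap.map_smul_of_tower, hl e (f * x) (hC f h),
      act_act C e f g (hconj h), hl (e * f) x h, LinearMap.map_smul_of_tower, ← Units.smul_def,
      ← Units.smul_def, smul_smul, smul_smul, smul_smul, smul_smul]
    have hc : e * f * g * (e * f)⁻¹ = e * (f * g * f⁻¹) * e⁻¹ := by group
    rw [hc, mul_assoc e f x, ← hΦ.l_l_identity]
    simp only [mul_assoc]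
  · intro e f x y m hm
    obtain ⟨C, g, v, h, rfl, rfl⟩ := hex hm
    rw [hrr f x h, LinearMap.map_smul_of_tower, hl e (x * f) h, hl e x h,
      LinearMap.map_smul_of_tower, hrr f (e * x) (hC e h), ← Units.smul_def, ← Units.smul_def,
      smul_smul, smul_smul, smul_smul, smul_smul, mul_assoc e x f]
    exact congrArg (· • _) (hΦ.l_r_identity e g x f)
  · intro e f x y m hm
    obtain ⟨C, g, v, h, rfl, rfl⟩ := hex hm
    rw [hrr (e * f) x h, hrr e x h, LinearMap.map_smul_of_tower, hrr f (x * e) h,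
      ← Units.smul_def, ← Units.smul_def, smul_smul, smul_smul, smul_smul, mul_assoc x e f]
    congr 1
    apply Additive.ofMul.injective
    simp only [ofMul_mul, ofMul_inv]
    linear_combination (norm := abel) hΦ.add_cocycle g x e f
  · intro f v
    rw [ArrowBimodule.adj_apply]
    have hf : (f : G) * γ C * (f : G)⁻¹ = γ C := by
      rw [Subgroup.mem_centralizer_singleton_iff.mp f.2, mul_inv_cancel_right]
    dsimp only
    rw [hl f 1 (hγ C), LinearMap.map_smul_of_tower, hrr _ _ (hC f (hγ C)), hf, hΦ.one_right,
      hΦ.one_right, div_one, one_smul, mul_one, mul_inv_cancel, act_ρ, LinearMap.map_smul_of_tower,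
      inv_smul_smul]

/-- Every collection of projective representations is attached to a graded Majid algebra
structure. -/
theorem RepCollection.exists_isAttachedTo (hΦ : IsNormalizedThreeCocycle Φ)
    (hγ : ∀ C : ConjClasses G, ConjClasses.mk (γ C) = C) (M : RepCollection Φ R γ) :
    ∃ A : HopfQuiverMajid Φ R, M.IsAttachedTo A := by
  obtain ⟨B, hB⟩ := M.exists_arrowBimodule hΦ hγ
  obtain ⟨A, hA⟩ := exists_hopfQuiverMajid hΦ B
  refine ⟨A, fun C => ?_⟩
  obtain ⟨φ, hφ, hr, hρ⟩ := hB C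
  refine ⟨φ, hφ, hr, fun f v => ?_⟩
  have hm : φ v ∈ isotypic k R (γ C) 1 := hr ▸ LinearMap.mem_range_self φ v
  have h1 : A.mul (elt k R (f : G) ⊗ₜ φ v) = B.l f (φ v) := hA.elt_arrow f hm
  have h2 : A.mul (B.l f (φ v) ⊗ₜ elt k R (f : G)⁻¹) = B.r (f : G)⁻¹ (B.l f (φ v)) :=
    hA.arrow_elt _ (B.l_mem f hm)
  rw [hρ, h1, h2, ArrowBimodule.adj_apply]

end Classification

end

theorem theorem4p2 {k : Type u} [Field k] {G : Type v} [Group G] (Φ : G → G → G → kˣ)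
    (hΦ : IsNormalizedThreeCocycle Φ) (R : ConjClasses G → ℕ)
    (γ : ConjClasses G → G) (hγ : ∀ C : ConjClasses G, ConjClasses.mk (γ C) = C) :
    ∃ e : Quotient (HopfQuiverMajid.setoid Φ R) ≃ Quotient (RepCollection.setoid Φ R γ),
      ∀ (A : HopfQuiverMajid Φ R) (M : RepCollection Φ R γ),
        e (Quotient.mk _ A) = Quotient.mk _ M ↔ M.IsAttachedTo A := by
  choose M hM using fun A : HopfQuiverMajid Φ R => exists_isAttachedTo (γ := γ) hΦ hγ A
  choose A hA using fun M : RepCollection Φ R γ => M.exists_isAttachedTo hΦ hγ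
  refine ⟨
    { toFun := Quotient.map M fun B B' h => ((hM B).congr_right h).isomorphic (hM B')
      invFun := Quotient.map A fun N N' h => ((hA N).isomorphic_majid hγ ((hA N').congr_left h))
      left_inv := ?_
      right_inv := ?_ }, fun B N => ?_⟩
  · rintro ⟨B⟩
    exact Quotient.sound ((hA (M B)).isomorphic_majid hγ (hM B))
  · rintro ⟨N⟩
    exact Quotient.sound ((hM (A N)).isomorphic (hA N))
  · refine Quotient.eq.trans ⟨fun h => (hM B).congr_left ?_, fun h => (hM B).isomorphic h⟩
    exact (RepCollection.setoid Φ R γ).symm h
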